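/- **Scaling law under additive quantization, an upper bound.** *Setting.* Let $p,M,N\ge 1$ be integers (data dimension, model size, sample size) and let $\mathbf S\in\mathbb R^{M\times p}$ have independent $\mathcal N(0,1/M)$ entries. The target $\mathbf w^*\in\mathbb R^p$ is random with $\mathbb E[\mathbf w^*{\mathbf w^*}^\top]=\mathbf I$, the data vector $\mathbf x\in\mathbb R^p$ is independent of $\mathbf w^*$, and the response satisfies $\mathbb E[y\mid\mathbf x,\mathbf w^*]=\mathbf x^\top\mathbf w^*$ and $\mathbb E[(y-\mathbf x^\top\mathbf w^*)^2]=\sigma^2$. The covariance $\mathbf H=\mathbb E[\mathbf x\mathbf x^\top]$ is finite and positive definite, and its ordered eigenvalues satisfy $c_1 i^{-a}\le\lambda_i\le c_2 i^{-a}$ for $1\le i\le p$, where $a>1$ and $c_1,c_2>0$. For $\mathbf v\in\mathbb R^M$ put $\mathcal R_M(\mathbf v)=\frac12\mathbb E[(\langle\mathbf S\mathbf x,\mathbf v\rangle-y)^2]$. *Quantizers.* $\mathcal Q_d,\mathcal Q_s,\mathcal Q_f,\mathcal Q_l,\mathcal Q_p,\mathcal Q_a,\mathcal Q_o$ (for data,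 sketch, feature, label, parameter, activation, output gradient) are random maps, applied with fresh independent randomness at each use, and unbiased: $\mathbb E[\mathcal Q_i(\mathbf u)\mid\mathbf u]=\mathbf u$. For $i\in\{s,d,f,p,a,o\}$, $\mathcal Q_i$ is $\overline\epsilon_i$-additive: $\mathbb E[(\mathcal Q_i(\mathbf u)-\mathbf u)(\mathcal Q_i(\mathbf u)-\mathbf u)^\top\mid\mathbf u]\preceq\overline\epsilon_i\mathbf I$ for vectors and scalars, and $\mathbb E[(\mathcal Q_s(\mathbf X)-\mathbf X)\mathbf A(\mathcal Q_s(\mathbf X)-\mathbf X)^\top\mid\mathbf X]\preceq\overline\epsilon_s\operatorname{tr}(\mathbf A)\mathbf I$ for all matrices $\mathbf X$ and all PSD $\mathbf A$. *Algorithm.* Given $\mathbf S$ and $\mathbf w^*$, let $(\mathbf x_t,y_t)_{t=1}^N$ be i.i.d. copies of $(\mathbf x,y)$, let $\mathbf v_0=0$ and, for $\gamma>0$, $$\mathbf v_t=\mathbf v_{t-1}+\gamma\,\mathcal Q_o\big(\mathcal Q_l(y_t)-\mathcal Q_a({\mathbf f_t}^\top\mathcal Q_p(\mathbf v_{t-1}))\big)\mathbf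 f_t,\qquad \mathbf f_t=\mathcal Q_f(\mathcal Q_s(\mathbf S)\mathcal Q_d(\mathbf x_t)),\qquad \overline{\mathbf v}_N=\frac1N\sum_{t=0}^{N-1}\mathbf v_t .$$ *Conditions on the quantized feature.* Given $\mathbf S$, let $\tilde{\mathbf x}^{(q)}=\mathcal Q_f(\mathcal Q_s(\mathbf S)\mathcal Q_d(\mathbf x))$ and $\mathbf H_f^{(q)}=\mathbb E[\tilde{\mathbf x}^{(q)}(\tilde{\mathbf x}^{(q)})^\top]$. Consider the conditions: 1. $\mathbf H_f^{(q)}$ and the fourth moment of $\tilde{\mathbf x}^{(q)}$ are finite, and for every PSD $\mathbf A$, $$\mathbf H_f^{(q)}\mathbf A\mathbf H_f^{(q)}+\beta\operatorname{tr}(\mathbf H_f^{(q)}\mathbf A)\mathbf H_f^{(q)}\preceq\mathbb E\big[\tilde{\mathbf x}^{(q)}(\tilde{\mathbf x}^{(q)})^\top\mathbf A\tilde{\mathbf x}^{(q)}(\tilde{\mathbf x}^{(q)})^\top\big]\preceq\alpha\operatorname{tr}(\mathbf H_f^{(q)}\mathbf A)\mathbf H_f^{(q)},\qquad\alpha,\beta>0.$$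 2. With ${\mathbf v^{(q)}}^*$ a global minimizer (given $\mathbf w^*$) of the finite risk $\frac12\mathbb E[(\langle\tilde{\mathbf x}^{(q)},\mathbf v\rangle-\mathcal Q_l(y))^2\mid\mathbf w^*]$ and $\xi=\mathcal Q_l(y)-\langle{\mathbf v^{(q)}}^*,\tilde{\mathbf x}^{(q)}\rangle$, one has $\underline\sigma^2\mathbf H_f^{(q)}\preceq\mathbb E[\xi^2\tilde{\mathbf x}^{(q)}(\tilde{\mathbf x}^{(q)})^\top]\preceq\overline\sigma^2\mathbf H_f^{(q)}$, with $\overline\sigma,\underline\sigma>0$. 3. $\gamma<1/(\alpha\operatorname{tr}\mathbf H_f^{(q)})$, and $\mathbf H_f^{(q)}$ commutes with $\mathbf S\mathbf H\mathbf S^\top$. *Coefficients.* Let $D=\overline\epsilon_f+\overline\epsilon_s(1+\overline\epsilon_d p)+\overline\epsilon_d\frac pM$ and $$\overline\epsilon_3^{(A)}=\frac{D}{M^{-a}+D},\qquad\overline\epsilon_2^{(A)}=\overline\epsilon_a+\overline\epsilon_o+\overline\epsilon_p\big[1+p\overline\epsilon_d+M(\overline\epsilon_f+\overline\epsilon_s+\overline\epsilon_s\overline\epsilon_d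 p)\big],$$ $$M_{\rm eff}=M\Big[1+(1+\overline\epsilon_2^{(A)})\frac{(\overline\epsilon_3^{(A)})^2}{1-\overline\epsilon_3^{(A)}}\Big]^{-\frac1{a-1}},\qquad N_{\rm eff}=N\Big[\frac{1+\overline\epsilon_2^{(A)}}{(1-\overline\epsilon_3^{(A)})^{1/a}}\Big]^{-\frac a{a-1}}.$$ *Claim.* There are constants $c,C>0$, depending only on $a,c_1,c_2,\alpha,\overline\sigma,\gamma$, such that in this setting, with probability at least $1-e^{-cM}$ over $\mathbf S$: if conditions 1–3 hold for $\mathbf S$, then $$\mathbb E\,\mathcal R_M(\overline{\mathbf v}_N)\le C\Big(\frac1{M_{\rm eff}^{a-1}}+\frac1{N_{\rm eff}^{(a-1)/a}}+\sigma^2+\overline\epsilon_3^{(A)}\Big),$$ where $\mathbb E$ is over $\mathbf w^*$, the samples and all quantizations, conditionally on $\mathbf S$. -/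

import Mathlib

open MeasureTheory ProbabilityTheory Matrix
open scoped ENNReal NNReal MatrixOrder

namespace QuantSGD

noncomputable section

/-- Vectors of length `n`; only dot products, no norm, are used below. -/
abbrev Vec (n : ℕ) : Type := Fin n → ℝ

/-- Sketches: real `M × p` arrays (with the product sigma-algebra). -/
abbrev Sketch (M p : ℕ) : Type := Fin M → Fin p → ℝ

/-- The law of a Gaussian sketch: independent `N(0, 1/M)` entries. -/
def gaussianSketch (M p : ℕ) : Measure (Sketch M p) :=
  Measure.pi fun _ => Measure.pi fun _ => gaussianReal 0 (1 / (M : ℝ≥0))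

/-! ### Moments of a law on `ℝⁿ` -/

/-- All entries of `E[z zᵀ]` are finite. -/
def HasSecondMoment {n : ℕ} (μ : Measure (Vec n)) : Prop :=
  ∀ i j, Integrable (fun z : Vec n => z i * z j) μ

/-- The (uncentred) covariance matrix `E[z zᵀ]`. -/
def secondMoment {n : ℕ} (μ : Measure (Vec n)) : Matrix (Fin n) (Fin n) ℝ :=
  Matrix.of fun i j => ∫ z, z i * z j ∂μ

theorem secondMoment_isHermitian {n : ℕ} (μ : Measure (Vec n)) :
    (secondMoment μ).IsHermitian := by
  ext i j
  simp [secondMoment, mul_comm]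

/-- The matrix `E[z zᵀ A z zᵀ]`. -/
def fourthMoment {n : ℕ} (μ : Measure (Vec n)) (A : Matrix (Fin n) (Fin n) ℝ) :
    Matrix (Fin n) (Fin n) ℝ :=
  Matrix.of fun i j => ∫ z, (z ⬝ᵥ (A *ᵥ z)) * (z i * z j) ∂μ

/-! ### Quantizers

A (stochastic) quantizer is a Markov kernel: `Q u` is the law of the quantized value of `u`. -/

/-- `E[Q(u) | u] = u` for a scalar quantizer. -/
def UnbiasedScalar (Q : Kernel ℝ ℝ) : Prop :=
  ∀ u, Integrable (fun r : ℝ => r) (Q u) ∧ ∫ r, r ∂(Q u) = u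

/-- `E[Q(u) | u] = u` for a vector quantizer. -/
def UnbiasedVec {n : ℕ} (Q : Kernel (Vec n) (Vec n)) : Prop :=
  ∀ u i, Integrable (fun r : Vec n => r i) (Q u) ∧ ∫ r, r i ∂(Q u) = u i

/-- `E[Q(X) | X] = X` for a matrix quantizer. -/
def UnbiasedMat {M p : ℕ} (Q : Kernel (Sketch M p) (Sketch M p)) : Prop :=
  ∀ X i j, Integrable (fun R : Sketch M p => R i j) (Q X) ∧ ∫ R, R i j ∂(Q X) = X i j

/-- `E[(Q(u) - u)² | u] ≤ ε`. -/
def AdditiveScalar (Q : Kernel ℝ ℝ) (ε : ℝ) : Prop :=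
  ∀ u, Integrable (fun r : ℝ => (r - u) ^ 2) (Q u) ∧ ∫ r, (r - u) ^ 2 ∂(Q u) ≤ ε

/-- `E[(Q(u) - u)(Q(u) - u)ᵀ | u] ⪯ ε I`. -/
def AdditiveVec {n : ℕ} (Q : Kernel (Vec n) (Vec n)) (ε : ℝ) : Prop :=
  ∀ u, (∀ i j, Integrable (fun r : Vec n => (r i - u i) * (r j - u j)) (Q u)) ∧
    (Matrix.of fun i j => ∫ r, (r i - u i) * (r j - u j) ∂(Q u)) ≤
      ε • (1 : Matrix (Fin n) (Fin n) ℝ)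

/-- `E[(Q(X) - X) A (Q(X) - X)ᵀ | X] ⪯ ε tr(A) I` for every PSD matrix `A`. -/
def AdditiveMat {M p : ℕ} (Q : Kernel (Sketch M p) (Sketch M p)) (ε : ℝ) : Prop :=
  ∀ X, (∀ i j k l, Integrable
        (fun R : Sketch M p => (R i k - X i k) * (R j l - X j l)) (Q X)) ∧
    ∀ A : Matrix (Fin p) (Fin p) ℝ, A.PosSemidef →
      (Matrix.of fun i j =>
          ∫ R, ((Matrix.of R - Matrix.of X) * A * (Matrix.of R - Matrix.of X)ᵀ) i j ∂(Q X)) ≤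
        (ε * A.trace) • (1 : Matrix (Fin M) (Fin M) ℝ)

/-- The seven quantizers: data, sketch, feature, label, parameter, activation, output gradient. -/
structure Quantizers (p M : ℕ) where
  d : Kernel (Vec p) (Vec p)
  s : Kernel (Sketch M p) (Sketch M p)
  f : Kernel (Vec M) (Vec M)
  l : Kernel ℝ ℝ
  p : Kernel (Vec M) (Vec M)
  a : Kernel ℝ ℝ
  o : Kernel ℝ ℝ
  markov_d : IsMarkovKernel d
  markov_s : IsMarkovKernel s
  markov_f : IsMarkovKernel f
  markov_l : IsMarkovKernel l
  markov_p : IsMarkovKernel p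
  markov_a : IsMarkovKernel a
  markov_o : IsMarkovKernel o

attribute [instance] Quantizers.markov_d Quantizers.markov_s Quantizers.markov_f
  Quantizers.markov_l Quantizers.markov_p Quantizers.markov_a Quantizers.markov_o

/-- Error levels of the six quantizers other than the label quantizer. -/
structure ErrorLevels where
  s : ℝ
  d : ℝ
  f : ℝ
  p : ℝ
  a : ℝ
  o : ℝ

/-- All seven quantizers are unbiased. -/
structure Quantizers.Unbiased {p M : ℕ} (Q : Quantizers p M) : Prop where
  d : UnbiasedVec Q.d
  s : UnbiasedMat Q.s
  f : UnbiasedVec Q.f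
  l : UnbiasedScalar Q.l
  p : UnbiasedVec Q.p
  a : UnbiasedScalar Q.a
  o : UnbiasedScalar Q.o

/-- The quantizers `s, d, f, p, a, o` are additive with the given levels. -/
structure Quantizers.Additive {p M : ℕ} (Q : Quantizers p M) (ε : ErrorLevels) : Prop where
  s : AdditiveMat Q.s ε.s
  d : AdditiveVec Q.d ε.d
  f : AdditiveVec Q.f ε.f
  p : AdditiveVec Q.p ε.p
  a : AdditiveScalar Q.a ε.a
  o : AdditiveScalar Q.o ε.o

/-! ### The data model -/

/-- The target `w` is drawn from `prior` and, independently of it, `x` from `feature`;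
given `(w, x)`, the response `y` has law `label (w, x)`. -/
structure DataModel (p : ℕ) where
  prior : Measure (Vec p)
  feature : Measure (Vec p)
  label : Kernel (Vec p × Vec p) ℝ
  prob_prior : IsProbabilityMeasure prior
  prob_feature : IsProbabilityMeasure feature
  markov_label : IsMarkovKernel label

attribute [instance] DataModel.prob_prior DataModel.prob_feature DataModel.markov_label

namespace DataModel

variable {p : ℕ} (D : DataModel p)

/-- The law of a sample `(x, y)` given the target `w`. -/
def sample : Kernel (Vec p) (Vec p × ℝ) := Kernel.const (Vec p) D.feature ⊗ₖ D.label

instance : IsMarkovKernel D.sample := by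
  unfold sample
  infer_instance

/-- The data covariance `H = E[x xᵀ]`. -/
def H : Matrix (Fin p) (Fin p) ℝ := secondMoment D.feature

/-- The eigenvalues `λ₁ ≥ λ₂ ≥ …` of `H` satisfy `c₁ i^{-a} ≤ λᵢ ≤ c₂ i^{-a}`
(the index `i` of `eigenvalues₀` starts at `0`). -/
def PowerLaw (a c₁ c₂ : ℝ) : Prop :=
  ∀ i : Fin (Fintype.card (Fin p)),
    c₁ * (((i : ℕ) : ℝ) + 1) ^ (-a) ≤ (secondMoment_isHermitian D.feature).eigenvalues₀ i ∧
      (secondMoment_isHermitian D.feature).eigenvalues₀ i ≤ c₂ * (((i : ℕ) : ℝ) + 1) ^ (-a)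

/-- Well-specified model: `E[y | x, w] = xᵀ w` and `E[(y - xᵀ w)²] = σ²`. -/
structure WellSpecified (σ : ℝ) : Prop where
  mean : ∀ᵐ wx ∂(D.prior.prod D.feature), Integrable (fun y : ℝ => y) (D.label wx) ∧
    ∫ y, y ∂(D.label wx) = wx.2 ⬝ᵥ wx.1
  noise : ∫⁻ z, ENNReal.ofReal ((z.2.2 - z.2.1 ⬝ᵥ z.1) ^ 2) ∂(D.prior ⊗ₘ D.sample) =
    ENNReal.ofReal (σ ^ 2)

/-- The prior has `E[w wᵀ] = I`. -/
def IsotropicPrior : Prop := HasSecondMoment D.prior ∧ secondMoment D.prior = 1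

/-- The population risk `½ E[(⟨S x, v⟩ - y)²]` given the target `w`. -/
def risk {M : ℕ} (S : Sketch M p) (w : Vec p) (v : Vec M) : ℝ≥0∞ :=
  ∫⁻ z, ENNReal.ofReal (1 / 2 * ((Matrix.of S *ᵥ z.1) ⬝ᵥ v - z.2) ^ 2) ∂(D.sample w)

end DataModel

/-! ### The quantized feature -/

variable {p M : ℕ}

theorem measurable_mulVec :
    Measurable fun z : Sketch M p × Vec p => (Matrix.of z.1 *ᵥ z.2 : Vec M) := by
  refine measurable_pi_lambda _ fun i => ?_
  simp only [Matrix.mulVec, dotProduct, Matrix.of_apply]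
  fun_prop

theorem measurable_dot : Measurable fun z : Vec M × Vec M => z.1 ⬝ᵥ z.2 := by
  simp only [dotProduct]
  fun_prop

/-- The law of `Q_f(Q_s(S) Q_d(x))` given `x` (and `S`), with fresh independent quantizations. -/
def quantFeature (Q : Quantizers p M) (S : Sketch M p) : Kernel (Vec p) (Vec M) :=
  Q.f ∘ₖ (Kernel.const (Vec p) (Q.s S) ×ₖ Q.d).map fun z => (Matrix.of z.1 *ᵥ z.2 : Vec M)

instance (Q : Quantizers p M) (S : Sketch M p) : IsMarkovKernel (quantFeature Q S) := by
  have := Kernel.IsMarkovKernel.map (Kernel.const (Vec p) (Q.s S) ×ₖ Q.d)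
    (measurable_mulVec (p := p) (M := M))
  unfold quantFeature
  infer_instance

/-- The unconditional law of the quantized feature. -/
def quantFeatureLaw (D : DataModel p) (Q : Quantizers p M) (S : Sketch M p) : Measure (Vec M) :=
  D.feature.bind (quantFeature Q S)

/-- The quantized feature covariance. -/
def Hf (D : DataModel p) (Q : Quantizers p M) (S : Sketch M p) : Matrix (Fin M) (Fin M) ℝ :=
  secondMoment (quantFeatureLaw D Q S)

/-- The law of (quantized feature, quantized label) given the target `w`: both come from the same
sample `(x, y)` and are quantized independently. -/
def quantSample (D : DataModel p) (Q : Quantizers p M) (S : Sketch M p) :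
    Kernel (Vec p) (Vec M × ℝ) :=
  (quantFeature Q S ∥ₖ Q.l) ∘ₖ D.sample

instance (D : DataModel p) (Q : Quantizers p M) (S : Sketch M p) :
    IsMarkovKernel (quantSample D Q S) := by
  unfold quantSample
  infer_instance

/-- The risk `½ E[(⟨f, v⟩ - Q_l(y))²]` in the quantized feature space, given the target `w`. -/
def quantRisk (D : DataModel p) (Q : Quantizers p M) (S : Sketch M p) (w : Vec p) (v : Vec M) :
    ℝ≥0∞ :=
  ∫⁻ z, ENNReal.ofReal (1 / 2 * (z.1 ⬝ᵥ v - z.2) ^ 2) ∂(quantSample D Q S w)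

/-- `v` is a global minimizer of the (finite) quantized risk. -/
def IsQuantOptimum (D : DataModel p) (Q : Quantizers p M) (S : Sketch M p) (w : Vec p)
    (v : Vec M) : Prop :=
  quantRisk D Q S w v ≠ ∞ ∧ ∀ u, quantRisk D Q S w v ≤ quantRisk D Q S w u

/-- Data covariance: finite second moments of `x` and of the quantized feature, `H ≻ 0`. -/
structure CovarianceCondition (D : DataModel p) (Q : Quantizers p M) (S : Sketch M p) : Prop where
  data : HasSecondMoment D.feature
  quant : HasSecondMoment (quantFeatureLaw D Q S)
  posDef : D.H.PosDef

/-- Fourth-moment conditions on the quantized feature. -/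
structure FourthMomentCondition (D : DataModel p) (Q : Quantizers p M) (S : Sketch M p)
    (α β : ℝ) : Prop where
  finite : ∀ i, Integrable (fun z : Vec M => z i ^ 4) (quantFeatureLaw D Q S)
  lower : ∀ A : Matrix (Fin M) (Fin M) ℝ, A.PosSemidef →
    Hf D Q S * A * Hf D Q S + (β * (Hf D Q S * A).trace) • Hf D Q S ≤
      fourthMoment (quantFeatureLaw D Q S) A
  upper : ∀ A : Matrix (Fin M) (Fin M) ℝ, A.PosSemidef →
    fourthMoment (quantFeatureLaw D Q S) A ≤ (α * (Hf D Q S * A).trace) • Hf D Q S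

/-- Noise conditions: with `vq w` a global minimizer of the quantized risk given `w` and
`ξ = Q_l(y) - ⟨vq w, f⟩`, one has `σmin² H_f ⪯ E[ξ² f fᵀ] ⪯ σmax² H_f`; the expectation is over the
target `w` too, which is implied by the same inequalities for every fixed `w`. -/
def NoiseCondition (D : DataModel p) (Q : Quantizers p M) (S : Sketch M p) (σmin σmax : ℝ) :
    Prop :=
  ∃ vq : Vec p → Vec M, Measurable vq ∧ (∀ᵐ w ∂D.prior, IsQuantOptimum D Q S w (vq w)) ∧
    (∀ i j, Integrable
      (fun z : Vec p × (Vec M × ℝ) => (z.2.2 - vq z.1 ⬝ᵥ z.2.1) ^ 2 * (z.2.1 i * z.2.1 j))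
      (D.prior ⊗ₘ quantSample D Q S)) ∧
    (σmin ^ 2 • Hf D Q S ≤ Matrix.of fun i j =>
      ∫ z, (z.2.2 - vq z.1 ⬝ᵥ z.2.1) ^ 2 * (z.2.1 i * z.2.1 j)
        ∂(D.prior ⊗ₘ quantSample D Q S)) ∧
    (Matrix.of fun i j =>
      ∫ z, (z.2.2 - vq z.1 ⬝ᵥ z.2.1) ^ 2 * (z.2.1 i * z.2.1 j)
        ∂(D.prior ⊗ₘ quantSample D Q S)) ≤ σmax ^ 2 • Hf D Q S

/-! ### Quantized SGD -/

/-- The randomness of one SGD step from `(w, v)`: a fresh pair `(f, b)` of quantized feature and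
label, the quantized parameter `Q_p(v)`, the quantized activation `Q_a(fᵀ Q_p(v))`, and the
quantized output gradient `Q_o(b - Q_a(fᵀ Q_p(v)))`; as a tuple `(((f, b), v'), act), g)`. -/
def stepDraw (D : DataModel p) (Q : Quantizers p M) (S : Sketch M p) :
    Kernel (Vec p × Vec M) ((((Vec M × ℝ) × Vec M) × ℝ) × ℝ) :=
  (((quantSample D Q S).comap Prod.fst measurable_fst ×ₖ Q.p.comap Prod.snd measurable_snd)
    ⊗ₖ Q.a.comap
      (fun z : (Vec p × Vec M) × ((Vec M × ℝ) × Vec M) => z.2.1.1 ⬝ᵥ z.2.2)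
      (measurable_dot.comp (by fun_prop : Measurable
        fun z : (Vec p × Vec M) × ((Vec M × ℝ) × Vec M) => (z.2.1.1, z.2.2))))
    ⊗ₖ Q.o.comap
      (fun z : (Vec p × Vec M) × (((Vec M × ℝ) × Vec M) × ℝ) => z.2.1.1.2 - z.2.2)
      (by fun_prop)

instance (D : DataModel p) (Q : Quantizers p M) (S : Sketch M p) :
    IsMarkovKernel (stepDraw D Q S) := by
  unfold stepDraw
  infer_instance

/-- One SGD step `v ↦ v + γ g f`, as a kernel from `(w, v)`. -/
def sgdStep (D : DataModel p) (Q : Quantizers p M) (S : Sketch M p) (γ : ℝ) :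
    Kernel (Vec p × Vec M) (Vec M) :=
  (Kernel.id ×ₖ stepDraw D Q S).map fun z => z.1.2 + (γ * z.2.2) • z.2.1.1.1.1

instance (D : DataModel p) (Q : Quantizers p M) (S : Sketch M p) (γ : ℝ) :
    IsMarkovKernel (sgdStep D Q S γ) :=
  Kernel.IsMarkovKernel.map _ (by fun_prop)

/-- The joint law of `(w, (v_t, v_0 + … + v_{t-1}))`, where `w` has the prior law and `v_0 = 0`. -/
def sgdLaw (D : DataModel p) (Q : Quantizers p M) (S : Sketch M p) (γ : ℝ) :
    ℕ → Measure (Vec p × (Vec M × Vec M))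
  | 0 => D.prior.map fun w => (w, (0, 0))
  | t + 1 => (sgdLaw D Q S γ t).bind
      ((Kernel.id ×ₖ (sgdStep D Q S γ).comap
          (fun z : Vec p × (Vec M × Vec M) => (z.1, z.2.1)) (by fun_prop)).map
        fun z => (z.1.1, (z.2, z.1.2.2 + z.1.2.1)))

instance (D : DataModel p) (Q : Quantizers p M) (S : Sketch M p) (γ : ℝ) (t : ℕ) :
    IsProbabilityMeasure (sgdLaw D Q S γ t) := by
  induction t with
  | zero => exact Measure.isProbabilityMeasure_map (by fun_prop)
  | succ t ih =>
    have := Kernel.IsMarkovKernel.map (f := fun z : (Vec p × (Vec M × Vec M)) × Vec M =>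
        (z.1.1, (z.2, z.1.2.2 + z.1.2.1)))
      (Kernel.id ×ₖ (sgdStep D Q S γ).comap
          (fun z : Vec p × (Vec M × Vec M) => (z.1, z.2.1)) (by fun_prop)) (by fun_prop)
    unfold sgdLaw
    infer_instance

/-- `E R_M(v̄_N)` for `v̄_N = (v_0 + … + v_{N-1}) / N`, the expectation being over the target, the
training samples and all quantizations, for a fixed sketch. -/
def expectedRisk (D : DataModel p) (Q : Quantizers p M) (S : Sketch M p) (γ : ℝ) (N : ℕ) : ℝ≥0∞ :=
  ∫⁻ z, D.risk S z.1 ((N : ℝ)⁻¹ • z.2.2) ∂(sgdLaw D Q S γ N)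

/-! ### Compound coefficients and effective sizes -/

/-- The spectral distortion coefficient. -/
def eps3 (a : ℝ) (p M : ℕ) (ε : ErrorLevels) : ℝ :=
  (ε.f + ε.s * (1 + ε.d * p) + ε.d * (p / M)) /
    ((M : ℝ) ^ (-a) + (ε.f + ε.s * (1 + ε.d * p) + ε.d * (p / M)))

/-- The noise amplification coefficient. -/
def eps2 (p M : ℕ) (ε : ErrorLevels) : ℝ :=
  ε.a + ε.o + ε.p * (1 + p * ε.d + M * (ε.f + ε.s + ε.s * ε.d * p))

/-- The effective model size. -/
def Meff (a : ℝ) (p M : ℕ) (ε : ErrorLevels) : ℝ :=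
  M * (1 + (1 + eps2 p M ε) * (eps3 a p M ε ^ 2 / (1 - eps3 a p M ε))) ^ (-(1 / (a - 1)))

/-- The effective data size. -/
def Neff (a : ℝ) (p M N : ℕ) (ε : ErrorLevels) : ℝ :=
  N * ((1 + eps2 p M ε) / (1 - eps3 a p M ε) ^ (1 / a)) ^ (-(a / (a - 1)))

end

end QuantSGD

namespace QuantSGD

/-! ### Gaussian sketches -/

/-! The argument has a deterministic half, valid for a fixed sketch `S`, and a random half, which
controls a few quantities attached to `S`.

Deterministic half. Unbiasedness makes conditional variances add, so `S H Sᵀ ⪯ H_f ⪯ S H Sᵀ + ε_d S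
Sᵀ + (ε_s (tr H + ε_d p) + ε_f) I` (`quadForm_Hf`). Likewise the stochastic gradient has conditional
mean `-H_f (v - v*)`, and its second moment is at most `H_f` times label noise, a fraction of the
current error and the quantization noise (`Setting.ae_gradient`). Since `H_f` and `S H Sᵀ` commute,
a joint eigenbasis (eigenvalues `h` and `g`) splits the dynamics into scalar recursions for the
error, its correlation with the accumulated error, and the accumulated error squared
(`Setting.moment_recursion`). These are coupled only through one feedback term, absorbed because `γ
α tr H_f < 1`. Solving them (`averaged_error_le`) leaves a bias `∑ h λ/(h+λ) (v*)²` with `λ =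
1/(Nγ)`, and a variance `(1/N) ∑ min(1, N γ g)`.

The bias is the value of a ridge problem. Together with the excess risk of `v*` it is therefore at
most the regularized risk of any trial vector (`Setting.bias_le`). Taking the trial vector linear in
the target, `u = K w`, and averaging over the isotropic target gives `trialRisk`; the result is
`Setting.expectedRisk_le`.

Random half. Let `k` be the smallest of `M/2`, `N^{1/a}` rounded up, and `p`. If `S` is bounded
below on the span of the top `k` eigenvectors of `H`, a right inverse `K` reproduces these
directions exactly, with norm controlled by the lower bound (`exists_trial`). Only the spectral tail
beyond `k`, the ridge term `k/(Nγ)` and quantization terms remain, and the same tail bounds the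
effective dimension in the variance (`sum_min_le`). The lower bound on `S` (`exists_sketch_lower`)
comes from averaging `exp (c M |S x|²)` over a ball and an annulus: by Tonelli and Markov the
averages are typical, and an atypical direction would spoil them on a whole small ball. Weighted
sums of `|S q_j|²` are controlled by Jensen and Markov (`measure_weighted_sketchSq`), at no cost in
`p`.

Finally, with `D` the compound quantization error, either `D ≥ M^{-a}`, so that `eps3 ≥ 1/2` and the
zero predictor suffices, or `M D ≤ 2 eps3`, which pays for all quantization terms in the bias
(`exists_trialRisk_le`). The noise factor `1 + eps2` of the variance is the one built into `Neff`.
-/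

theorem integrable_exp_mul_sq_gaussianReal (v : ℝ≥0) {s : ℝ} (hs : 2 * s * v < 1) :
    Integrable (fun x : ℝ => Real.exp (s * x ^ 2)) (gaussianReal 0 v) ∧
      ∫ x, Real.exp (s * x ^ 2) ∂(gaussianReal 0 v) = (√(1 - 2 * s * v))⁻¹ := by
  by_cases hv : v = 0
  · subst hv
    simp [gaussianReal_zero_var, integrable_dirac]
  have hv' : (0 : ℝ) < v := by exact_mod_cast pos_iff_ne_zero.mpr hv
  have hb : 0 < (1 - 2 * s * v) / (2 * v) := div_pos (by linarith) (by positivity)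
  have key : ∀ x : ℝ, gaussianPDFReal 0 v x * Real.exp (s * x ^ 2) =
      (√(2 * Real.pi * v))⁻¹ * Real.exp (-((1 - 2 * s * v) / (2 * v)) * x ^ 2) := by
    intro x
    rw [gaussianPDFReal, mul_assoc, ← Real.exp_add]
    congr 2
    field_simp
    ring
  constructor
  · rw [gaussianReal_of_var_ne_zero _ hv, integrable_withDensity_iff_integrable_smul₀'
      (measurable_gaussianPDF 0 v).aemeasurable (by simp [gaussianPDF_lt_top])]
    simp only [toReal_gaussianPDF, smul_eq_mul, key]
    exact (integrable_exp_neg_mul_sq hb).const_mul _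
  · rw [integral_gaussianReal_eq_integral_smul hv]
    simp only [smul_eq_mul, key]
    rw [integral_const_mul, integral_gaussian, ← Real.sqrt_inv, ← Real.sqrt_mul (by positivity),
      ← Real.sqrt_inv]
    congr 1
    have : 1 - 2 * s * v ≠ 0 := by linarith
    have := Real.pi_pos
    field_simp

theorem dotProduct_self_nonneg' {n : ℕ} (u : Vec n) : 0 ≤ u ⬝ᵥ u :=
  Finset.sum_nonneg fun i _ => mul_self_nonneg (u i)

/-- Characteristic functions factor over the independent coordinates. Applied to the rows of a
sketch, this makes every law below depend on `u` only through its length. -/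
theorem map_dotProduct_pi_gaussianReal {p : ℕ} (v : ℝ≥0) (u : Vec p) :
    (Measure.pi fun _ : Fin p => gaussianReal 0 v).map (fun x => x ⬝ᵥ u) =
      gaussianReal 0 (v * (u ⬝ᵥ u).toNNReal) := by
  have hm : Measurable fun x : Vec p => x ⬝ᵥ u := by
    simp only [dotProduct]; fun_prop
  have : IsProbabilityMeasure ((Measure.pi fun _ : Fin p => gaussianReal 0 v).map
      (fun x => x ⬝ᵥ u)) := Measure.isProbabilityMeasure_map hm.aemeasurable
  apply Measure.ext_of_charFun
  ext t
  rw [charFun_apply_real, charFun_gaussianReal, integral_map hm.aemeasurable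
    (by fun_prop)]
  have h1 : ∀ x : Vec p, Complex.exp (t * ((x ⬝ᵥ u : ℝ) : ℂ) * Complex.I) =
      ∏ i, Complex.exp (((t * u i : ℝ) : ℂ) * (x i : ℂ) * Complex.I) := by
    intro x
    rw [← Complex.exp_sum]
    congr 1
    simp only [dotProduct]
    push_cast
    rw [Finset.mul_sum, Finset.sum_mul]
    exact Finset.sum_congr rfl fun i _ => by ring
  simp_rw [h1]
  rw [integral_fintype_prod_eq_prod
    (f := fun (i : Fin p) (y : ℝ) => Complex.exp (((t * u i : ℝ) : ℂ) * (y : ℂ) * Complex.I))]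
  simp_rw [← charFun_apply_real, charFun_gaussianReal]
  rw [← Complex.exp_sum]
  congr 1
  have h2 : (((v * (u ⬝ᵥ u).toNNReal : ℝ≥0) : ℝ) : ℂ) = (v : ℝ) * ∑ i, (u i : ℂ) * u i := by
    rw [NNReal.coe_mul, Real.coe_toNNReal _ (dotProduct_self_nonneg' u)]
    simp [dotProduct]
  rw [h2]
  push_cast
  simp only [mul_zero, zero_mul, zero_sub, Finset.sum_neg_distrib]
  rw [Finset.mul_sum, Finset.sum_mul, Finset.sum_div]
  refine congrArg _ (Finset.sum_congr rfl fun i _ => by ring)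

instance (M p : ℕ) : IsProbabilityMeasure (gaussianSketch M p) := by
  unfold gaussianSketch
  infer_instance

/-- The squared Euclidean length of the sketch of `u`. -/
noncomputable def sketchSq {M p : ℕ} (S : Sketch M p) (u : Vec p) : ℝ :=
  (Matrix.of S *ᵥ u) ⬝ᵥ (Matrix.of S *ᵥ u)

theorem sketchSq_eq_sum {M p : ℕ} (S : Sketch M p) (u : Vec p) :
    sketchSq S u = ∑ m, (S m ⬝ᵥ u) ^ 2 := by
  simp [sketchSq, dotProduct, Matrix.mulVec, pow_two]

theorem measurable_sketchSq {M p : ℕ} :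
    Measurable fun z : Sketch M p × Vec p => sketchSq z.1 z.2 := by
  simp only [sketchSq_eq_sum, dotProduct]
  refine Finset.measurable_sum _ fun m _ => Measurable.pow_const
    (Finset.measurable_sum _ fun j _ => Measurable.mul ?_ ?_) 2
  · exact (measurable_pi_apply j).comp ((measurable_pi_apply m).comp measurable_fst)
  · exact (measurable_pi_apply j).comp measurable_snd

theorem measurable_sketchSq_left {M p : ℕ} (u : Vec p) :
    Measurable fun S : Sketch M p => sketchSq S u :=
  measurable_sketchSq.comp (f := fun S : Sketch M p => (S, u))
    (measurable_id.prodMk measurable_const)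

/-- The moment generating function of `M |S u|²` for a Gaussian sketch `S`. -/
theorem lintegral_exp_sketchSq {M p : ℕ} (hM : 1 ≤ M) (u : Vec p) {s : ℝ}
    (hs : 2 * s * (u ⬝ᵥ u) < 1) :
    ∫⁻ S, ENNReal.ofReal (Real.exp (s * M * sketchSq S u)) ∂(gaussianSketch M p) =
      ENNReal.ofReal ((√(1 - 2 * s * (u ⬝ᵥ u)))⁻¹ ^ M) := by
  have hM0 : (0 : ℝ) < M := by exact_mod_cast hM
  set v : ℝ≥0 := 1 / (M : ℝ≥0) * (u ⬝ᵥ u).toNNReal with hv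
  have hvr : (v : ℝ) = (u ⬝ᵥ u) / M := by
    rw [hv]; push_cast
    rw [Real.coe_toNNReal _ (dotProduct_self_nonneg' u)]; ring
  have h2 : 2 * (s * M) * v = 2 * s * (u ⬝ᵥ u) := by rw [hvr]; field_simp
  obtain ⟨hi, he⟩ := integrable_exp_mul_sq_gaussianReal v (s := s * M) (by rw [h2]; exact hs)
  have hm : Measurable fun x : Vec p => x ⬝ᵥ u := by
    simp only [dotProduct]; fun_prop
  rw [h2, hv, ← map_dotProduct_pi_gaussianReal, integral_map hm.aemeasurable (by fun_prop)] at he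
  rw [hv, ← map_dotProduct_pi_gaussianReal, integrable_map_measure (by fun_prop)
    hm.aemeasurable] at hi
  have hprod : ∀ S : Sketch M p, Real.exp (s * M * sketchSq S u) =
      ∏ m, Real.exp (s * M * (S m ⬝ᵥ u) ^ 2) := by
    intro S
    rw [← Real.exp_sum, sketchSq_eq_sum, Finset.mul_sum]
  have hint : Integrable (fun S : Sketch M p => ∏ m, Real.exp (s * M * (S m ⬝ᵥ u) ^ 2))
      (gaussianSketch M p) :=
    Integrable.fintype_prod (f := fun (_ : Fin M) (x : Vec p) =>
      Real.exp (s * M * (x ⬝ᵥ u) ^ 2)) fun _ => hi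
  simp_rw [hprod]
  rw [← ofReal_integral_eq_lintegral_ofReal hint
    (Filter.Eventually.of_forall fun S => Finset.prod_nonneg fun m _ => (Real.exp_pos _).le)]
  congr 1
  rw [gaussianSketch, integral_fintype_prod_eq_prod
    (f := fun (_ : Fin M) (x : Vec p) => Real.exp (s * M * (x ⬝ᵥ u) ^ 2))]
  simp only [he, Finset.prod_const, Finset.card_univ, Fintype.card_fin]

/-- The exact value has base at most `√2`. The cruder `2` is enough, since all later comparisons are
between exponentials in `M`. -/
theorem lintegral_exp_sketchSq_upper {M p : ℕ} (hM : 1 ≤ M) (u : Vec p) {s : ℝ}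
    (hs : 4 * s * (u ⬝ᵥ u) ≤ 1) :
    ∫⁻ S, ENNReal.ofReal (Real.exp (s * M * sketchSq S u)) ∂(gaussianSketch M p) ≤
      ENNReal.ofReal (2 ^ M) := by
  rw [lintegral_exp_sketchSq hM u (by linarith)]
  refine ENNReal.ofReal_le_ofReal (pow_le_pow_left₀ (by positivity) ?_ _)
  rw [inv_le_comm₀ (Real.sqrt_pos.mpr (by linarith)) two_pos]
  exact Real.le_sqrt_of_sq_le (by norm_num; linarith)

/-- There is no upper limit on `t`, so `r⁻¹` can be made as small as desired; this is what later
beats the volume of a tiny ball. -/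
theorem lintegral_exp_sketchSq_lower {M p : ℕ} (hM : 1 ≤ M) (u : Vec p) {t r : ℝ}
    (ht : 0 ≤ t) (hr : 0 < r) (hu : r ^ 2 ≤ 2 * t * (u ⬝ᵥ u)) :
    ∫⁻ S, ENNReal.ofReal (Real.exp (-t * M * sketchSq S u)) ∂(gaussianSketch M p) ≤
      ENNReal.ofReal (r⁻¹ ^ M) := by
  rw [lintegral_exp_sketchSq hM u
    (by have := mul_nonneg ht (dotProduct_self_nonneg' u); linarith)]
  refine ENNReal.ofReal_le_ofReal (pow_le_pow_left₀ (by positivity) ?_ _)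
  refine inv_anti₀ hr (Real.le_sqrt_of_sq_le (by linarith))

/-- The event that a weighted sum of the squared lengths `|S q_j|²` has the size of its mean. -/
theorem measure_weighted_sketchSq {M p : ℕ} {ι : Type*} [Fintype ι] (hM : 1 ≤ M)
    (q : ι → Vec p) (hq : ∀ j, q j ⬝ᵥ q j = 1) (ν : ι → ℝ) (hν : ∀ j, 0 ≤ ν j) (R : ℝ) :
    gaussianSketch M p {S | ¬ ∑ j, ν j * sketchSq S (q j) ≤ 4 * (R + 1) * ∑ j, ν j} ≤
      ENNReal.ofReal (Real.exp (-R * M)) := by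
  set Λ := ∑ j, ν j with hΛ
  have hΛ0 : 0 ≤ Λ := Finset.sum_nonneg fun j _ => hν j
  rcases hΛ0.eq_or_lt with h0 | hpos
  · have hz : ∀ j, ν j = 0 := fun j =>
      (Finset.sum_eq_zero_iff_of_nonneg fun j _ => hν j).mp h0.symm j (Finset.mem_univ j)
    simp [hz, ← h0]
  -- A convex combination of exponentials. By Jensen it dominates the exponential of the weighted
  -- mean, and its expectation is at most `2 ^ M` however many vectors there are, so no union bound
  -- is needed. The rate `1/4` is the largest allowed by `lintegral_exp_sketchSq_upper` for unit
  -- vectors.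
  set F : Sketch M p → ℝ≥0∞ := fun S =>
    ∑ j, ENNReal.ofReal (ν j / Λ) * ENNReal.ofReal (Real.exp (1 / 4 * M * sketchSq S (q j)))
    with hF
  have hmeas := fun j => measurable_sketchSq_left (M := M) (q j)
  have hFm : Measurable F := by
    rw [hF]
    exact Finset.measurable_sum _ fun j _ =>
      (((hmeas j).const_mul _).exp.ennreal_ofReal).const_mul _
  have hFi : ∫⁻ S, F S ∂(gaussianSketch M p) ≤ ENNReal.ofReal (2 ^ M) := by
    have hmj : ∀ j, Measurable fun S : Sketch M p =>
        ENNReal.ofReal (Real.exp (1 / 4 * M * sketchSq S (q j))) :=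
      fun j => ((hmeas j).const_mul _).exp.ennreal_ofReal
    rw [hF, lintegral_finsetSum _ fun j _ => (hmj j).const_mul _]
    calc _ ≤ ∑ j, ENNReal.ofReal (ν j / Λ) * ENNReal.ofReal (2 ^ M) := by
          refine Finset.sum_le_sum fun j _ => ?_
          rw [lintegral_const_mul _ (hmj j)]
          gcongr
          exact lintegral_exp_sketchSq_upper hM _ (by rw [hq j]; norm_num)
      _ = ENNReal.ofReal (2 ^ M) := by
          rw [← Finset.sum_mul, ← ENNReal.ofReal_sum_of_nonneg
            fun j _ => div_nonneg (hν j) hΛ0, ← Finset.sum_div, div_self hpos.ne']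
          simp
  have hsub : {S : Sketch M p | ¬ ∑ j, ν j * sketchSq S (q j) ≤ 4 * (R + 1) * Λ} ⊆
      {S | ENNReal.ofReal (Real.exp ((R + 1) * M)) ≤ F S} := by
    intro S hS
    simp only [Set.mem_ofPred_eq, not_le] at hS ⊢
    have hFS : F S = ENNReal.ofReal
        (∑ j, ν j / Λ * Real.exp (1 / 4 * M * sketchSq S (q j))) := by
      rw [hF, ENNReal.ofReal_sum_of_nonneg
        fun j _ => mul_nonneg (div_nonneg (hν j) hΛ0) (Real.exp_pos _).le]
      exact Finset.sum_congr rfl fun j _ =>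
        (ENNReal.ofReal_mul (div_nonneg (hν j) hΛ0)).symm
    rw [hFS]
    refine ENNReal.ofReal_le_ofReal ?_
    have hj := convexOn_exp.map_sum_le (t := Finset.univ) (w := fun j => ν j / Λ)
      (p := fun j => 1 / 4 * M * sketchSq S (q j)) (fun j _ => div_nonneg (hν j) hΛ0)
      (by rw [← Finset.sum_div, div_self hpos.ne']) (fun _ _ => Set.mem_univ _)
    simp only [smul_eq_mul] at hj
    refine le_trans (Real.exp_le_exp.mpr ?_) hj
    have : ∑ j, ν j / Λ * (1 / 4 * M * sketchSq S (q j)) =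
        M / (4 * Λ) * ∑ j, ν j * sketchSq S (q j) := by
      rw [Finset.mul_sum]
      exact Finset.sum_congr rfl fun j _ => by field_simp
    rw [this]
    calc (R + 1) * M = M / (4 * Λ) * (4 * (R + 1) * Λ) := by field_simp
      _ ≤ _ := by gcongr
  calc _ ≤ gaussianSketch M p {S | ENNReal.ofReal (Real.exp ((R + 1) * M)) ≤ F S} :=
        measure_mono hsub
    _ ≤ (∫⁻ S, F S ∂(gaussianSketch M p)) / ENNReal.ofReal (Real.exp ((R + 1) * M)) :=
        meas_ge_le_lintegral_div hFm.aemeasurable (by simp [Real.exp_pos]) (by simp)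
    _ ≤ ENNReal.ofReal (2 ^ M) / ENNReal.ofReal (Real.exp ((R + 1) * M)) := by gcongr
    _ = ENNReal.ofReal (2 ^ M / Real.exp ((R + 1) * M)) :=
        (ENNReal.ofReal_div_of_pos (Real.exp_pos _)).symm
    _ ≤ _ := by
        refine ENNReal.ofReal_le_ofReal ?_
        rw [div_le_iff₀ (Real.exp_pos _), ← Real.exp_add]
        have : -R * M + (R + 1) * M = (M : ℝ) * 1 := by ring
        rw [this, Real.exp_nat_mul]
        exact pow_le_pow_left₀ two_pos.le (by have := Real.add_one_le_exp 1; linarith) _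

end QuantSGD

namespace QuantSGD

/-! ### The smallest singular value of a tall Gaussian matrix -/

/-- The combination `∑ xᵢ qᵢ`. -/
def comb {p k : ℕ} (q : Fin k → Vec p) : EuclideanSpace ℝ (Fin k) →ₗ[ℝ] Vec p where
  toFun x := ∑ i, x i • q i
  map_add' x y := by simp [add_smul, Finset.sum_add_distrib]
  map_smul' c x := by simp [mul_smul, Finset.smul_sum]

theorem comb_apply {p k : ℕ} (q : Fin k → Vec p) (x : EuclideanSpace ℝ (Fin k)) :
    comb q x = ∑ i, x i • q i := rfl

theorem comb_dotProduct_self {p k : ℕ} {q : Fin k → Vec p}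
    (hq : ∀ i j, q i ⬝ᵥ q j = if i = j then 1 else 0) (x : EuclideanSpace ℝ (Fin k)) :
    comb q x ⬝ᵥ comb q x = ‖x‖ ^ 2 := by
  rw [EuclideanSpace.norm_sq_eq]
  simp [comb_apply, sum_dotProduct, dotProduct_sum, hq, pow_two]

/-- The sketch restricted to the span of `q`, as a map of Euclidean spaces. -/
noncomputable def sketchMap {M p k : ℕ} (S : Sketch M p) (q : Fin k → Vec p) :
    EuclideanSpace ℝ (Fin k) →ₗ[ℝ] EuclideanSpace ℝ (Fin M) :=
  (WithLp.linearEquiv 2 ℝ (Fin M → ℝ)).symm.toLinearMap ∘ₗ (Matrix.of S).mulVecLin ∘ₗ comb q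

theorem norm_sketchMap_sq {M p k : ℕ} (S : Sketch M p) (q : Fin k → Vec p)
    (x : EuclideanSpace ℝ (Fin k)) : ‖sketchMap S q x‖ ^ 2 = sketchSq S (comb q x) := by
  rw [EuclideanSpace.norm_sq_eq]
  simp [sketchMap, sketchSq, dotProduct, pow_two]

theorem measurable_exp_sketchMap {M p k : ℕ} (q : Fin k → Vec p) (c : ℝ) :
    Measurable fun z : Sketch M p × EuclideanSpace ℝ (Fin k) =>
      ENNReal.ofReal (Real.exp (c * ‖sketchMap z.1 q z.2‖ ^ 2)) := by
  simp only [norm_sketchMap_sq]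
  have hc : Measurable (comb q : EuclideanSpace ℝ (Fin k) → Vec p) :=
    (comb q).continuous_of_finiteDimensional.measurable
  have := measurable_sketchSq.comp (f := fun z : Sketch M p × EuclideanSpace ℝ (Fin k) =>
    (z.1, comb q z.2)) (measurable_fst.prodMk (hc.comp measurable_snd))
  exact ((this.const_mul c).exp).ennreal_ofReal

/-- Tonelli, then Markov's inequality for the average over `A`. The average takes the place of a
union bound over a net. -/
theorem measure_setLIntegral_exp_sketchMap {M p k : ℕ} (q : Fin k → Vec p)
    {A : Set (EuclideanSpace ℝ (Fin k))} (h0 : volume A ≠ 0)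
    (htop : volume A ≠ ∞) (c : ℝ) {b : ℝ} (hb : 0 < b) (R : ℝ)
    (h : ∀ x ∈ A, ∫⁻ S, ENNReal.ofReal (Real.exp (c * ‖sketchMap S q x‖ ^ 2))
      ∂(gaussianSketch M p) ≤ ENNReal.ofReal b) :
    gaussianSketch M p {S | ¬ ∫⁻ x in A, ENNReal.ofReal (Real.exp (c * ‖sketchMap S q x‖ ^ 2)) ≤
      volume A * ENNReal.ofReal (b * Real.exp R)} ≤ ENNReal.ofReal (Real.exp (-R)) := by
  have hm := measurable_exp_sketchMap (M := M) q c
  have hF : Measurable fun S : Sketch M p =>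
      ∫⁻ x in A, ENNReal.ofReal (Real.exp (c * ‖sketchMap S q x‖ ^ 2)) :=
    hm.lintegral_prod_right'
  have hbR : 0 < b * Real.exp R := mul_pos hb (Real.exp_pos _)
  have hE : ∫⁻ S, (∫⁻ x in A, ENNReal.ofReal (Real.exp (c * ‖sketchMap S q x‖ ^ 2)))
      ∂(gaussianSketch M p) ≤ volume A * ENNReal.ofReal b := by
    rw [lintegral_lintegral_swap hm.aemeasurable]
    calc _ ≤ ∫⁻ x in A, ENNReal.ofReal b := setLIntegral_mono measurable_const h
      _ = volume A * ENNReal.ofReal b := by rw [setLIntegral_const, mul_comm]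
  calc _ ≤ gaussianSketch M p {S | volume A * ENNReal.ofReal (b * Real.exp R) ≤
        ∫⁻ x in A, ENNReal.ofReal (Real.exp (c * ‖sketchMap S q x‖ ^ 2))} :=
        measure_mono fun S hS => (not_le.mp hS).le
    _ ≤ (∫⁻ S, (∫⁻ x in A, ENNReal.ofReal (Real.exp (c * ‖sketchMap S q x‖ ^ 2)))
          ∂(gaussianSketch M p)) / (volume A * ENNReal.ofReal (b * Real.exp R)) :=
        meas_ge_le_lintegral_div hF.aemeasurable
          (mul_ne_zero h0 (by simpa using hbR)) (ENNReal.mul_ne_top htop ENNReal.ofReal_ne_top)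
    _ ≤ (volume A * ENNReal.ofReal b) / (volume A * ENNReal.ofReal (b * Real.exp R)) := by gcongr
    _ = ENNReal.ofReal (b / (b * Real.exp R)) := by
        rw [ENNReal.mul_div_mul_left _ _ h0 htop, ENNReal.ofReal_div_of_pos hbR]
    _ = _ := by
        congr 1
        rw [Real.exp_neg]
        field_simp

/-- If the integral of `exp (c |T x|²)` over a ball is small, then `T` is bounded. -/
theorem norm_le_of_setLIntegral_exp {k M : ℕ} (hk : k ≤ M) {F : Type*} [NormedAddCommGroup F]
    [NormedSpace ℝ F] (T : EuclideanSpace ℝ (Fin k) →ₗ[ℝ] F)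
    (h : ∫⁻ x in Metric.closedBall 0 (3 / 2),
      ENNReal.ofReal (Real.exp (1 / 9 * M * ‖T x‖ ^ 2)) ≤
      volume (Metric.closedBall (0 : EuclideanSpace ℝ (Fin k)) (3 / 2)) *
        ENNReal.ofReal (2 ^ M * Real.exp (3 * M))) (x : EuclideanSpace ℝ (Fin k)) :
    ‖T x‖ ≤ 16 * ‖x‖ := by
  by_cases hx : x = 0
  · simp [hx]
  have hne : (Metric.sphere (0 : EuclideanSpace ℝ (Fin k)) 1).Nonempty :=
    ⟨‖x‖⁻¹ • x, by simp [norm_smul, norm_ne_zero_iff.mpr hx]⟩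
  have hTc : Continuous T := T.continuous_of_finiteDimensional
  -- `‖T y‖` is the operator norm, so `T` changes by at most `‖T y‖ / 2` on the ball of radius `1/2`
  -- around `y`. The integrand is large on that whole ball.
  obtain ⟨y, hy, hmax⟩ := (isCompact_sphere (0 : EuclideanSpace ℝ (Fin k)) 1).exists_isMaxOn hne
    hTc.norm.continuousOn
  have hy1 : ‖y‖ = 1 := by simpa using hy
  have hT : ∀ z, ‖T z‖ ≤ ‖T y‖ * ‖z‖ := by
    intro z
    by_cases hz : z = 0
    · simp [hz]
    have hz' : 0 < ‖z‖ := norm_pos_iff.mpr hz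
    have := hmax (show ‖z‖⁻¹ • z ∈ Metric.sphere (0 : EuclideanSpace ℝ (Fin k)) 1 by
      simp [norm_smul, hz'.ne'])
    simp only [Set.mem_ofPred_eq, map_smul, norm_smul, norm_inv, norm_norm] at this
    rwa [inv_mul_le_iff₀ hz', mul_comm] at this
  have hM : (1 : ℝ) ≤ M := by
    have : k ≠ 0 := by
      rintro rfl
      exact hx (Subsingleton.elim _ _)
    exact_mod_cast (Nat.one_le_iff_ne_zero.mpr this).trans hk
  set V := volume (Metric.ball (0 : EuclideanSpace ℝ (Fin k)) 1) with hV
  have hV0 : V ≠ 0 := (Metric.measure_ball_pos _ _ one_pos).ne'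
  have hVt : V ≠ ∞ := measure_ball_lt_top.ne
  have hlow : ENNReal.ofReal (Real.exp (1 / 9 * M * (‖T y‖ / 2) ^ 2)) *
      volume (Metric.closedBall y (1 / 2)) ≤
      ∫⁻ x in Metric.closedBall 0 (3 / 2), ENNReal.ofReal (Real.exp (1 / 9 * M * ‖T x‖ ^ 2)) := by
    rw [← setLIntegral_const]
    calc _ ≤ ∫⁻ x in Metric.closedBall y (1 / 2),
          ENNReal.ofReal (Real.exp (1 / 9 * M * ‖T x‖ ^ 2)) := by
          refine setLIntegral_mono' measurableSet_closedBall fun z hz => ?_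
          refine ENNReal.ofReal_le_ofReal (Real.exp_le_exp.mpr ?_)
          have h1 : ‖T (z - y)‖ ≤ ‖T y‖ * (1 / 2) :=
            (hT _).trans (by gcongr; exact mem_closedBall_iff_norm.mp hz)
          have h2 : ‖T y‖ - ‖T z‖ ≤ ‖T (z - y)‖ := by
            rw [map_sub, norm_sub_rev]; exact norm_sub_norm_le _ _
          gcongr
          linarith
      _ ≤ _ := lintegral_mono_set (Metric.closedBall_subset_closedBall' (by
          simp [hy1]; norm_num))
  have hcmp := hlow.trans h
  rw [Measure.addHaar_closedBall _ _ (by norm_num), Measure.addHaar_closedBall _ _ (by norm_num),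
    ← hV, finrank_euclideanSpace_fin, ← mul_assoc, mul_right_comm _ V] at hcmp
  rw [ENNReal.mul_le_mul_iff_left hV0 hVt, ← ENNReal.ofReal_mul (Real.exp_pos _).le,
    ← ENNReal.ofReal_mul (by positivity), ENNReal.ofReal_le_ofReal_iff (by positivity)] at hcmp
  have h3 : (3 : ℝ) ^ k ≤ Real.exp 2 ^ M := by
    calc (3 : ℝ) ^ k ≤ 3 ^ M := pow_le_pow_right₀ (by norm_num) hk
      _ ≤ Real.exp 2 ^ M := pow_le_pow_left₀ (by norm_num)
          (by have := Real.add_one_le_exp 2; linarith) _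
  have h2 : (2 : ℝ) ^ M ≤ Real.exp 1 ^ M := pow_le_pow_left₀ (by norm_num)
    (by have := Real.add_one_le_exp 1; linarith) _
  -- The volume ratio `3 ^ k` and the factors `2 ^ M`, `e ^ (3M)` are absorbed into `e ^ (6M)`. This
  -- yields `‖T y‖² ≤ 216`, below `16²`.
  have h4 : Real.exp (1 / 9 * M * (‖T y‖ / 2) ^ 2) ≤ Real.exp (6 * M) := by
    have e1 : (3 / 2 : ℝ) ^ k = 3 ^ k * (1 / 2) ^ k := by rw [← mul_pow]; norm_num
    rw [e1, mul_right_comm ((3 : ℝ) ^ k)] at hcmp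
    have := le_of_mul_le_mul_right hcmp (by positivity)
    refine this.trans ?_
    calc (3 : ℝ) ^ k * (2 ^ M * Real.exp (3 * M))
        ≤ Real.exp 2 ^ M * (Real.exp 1 ^ M * Real.exp (3 * M)) := by gcongr
      _ = Real.exp (6 * M) := by
        rw [← Real.exp_nat_mul, ← Real.exp_nat_mul, ← Real.exp_add, ← Real.exp_add]
        congr 1; ring
  have h5 := Real.exp_le_exp.mp h4
  have h6 : ‖T y‖ ^ 2 ≤ 16 ^ 2 := by
    have : (M : ℝ) * ‖T y‖ ^ 2 ≤ M * 16 ^ 2 := by nlinarith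
    exact le_of_mul_le_mul_left this (by linarith)
  have h7 : ‖T y‖ ≤ 16 := le_of_sq_le_sq h6 (by norm_num)
  exact (hT x).trans (by gcongr)

/-- If the integral of `exp (-c |T x|²)` over an annulus is small for a large `c`, then a bounded
map `T` is bounded below. -/
theorem norm_ge_of_setLIntegral_exp {k M : ℕ} (hk : 2 * k ≤ M) {F : Type*} [NormedAddCommGroup F]
    [NormedSpace ℝ F] (T : EuclideanSpace ℝ (Fin k) →ₗ[ℝ] F) (hT : ∀ x, ‖T x‖ ≤ 16 * ‖x‖)
    (h : ∫⁻ x in Metric.closedBall 0 2 \ Metric.ball 0 (1 / 2),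
      ENNReal.ofReal (Real.exp (-Real.exp 40 * M * ‖T x‖ ^ 2)) ≤
      volume (Metric.closedBall (0 : EuclideanSpace ℝ (Fin k)) 2 \ Metric.ball 0 (1 / 2)) *
        ENNReal.ofReal ((√2 * Real.exp (-20)) ^ M * Real.exp (3 * M)))
    (x : EuclideanSpace ℝ (Fin k)) : Real.exp (-20) * ‖x‖ ≤ ‖T x‖ := by
  by_cases hx : x = 0
  · simp [hx]
  by_contra! hcon
  have hx' : 0 < ‖x‖ := norm_pos_iff.mpr hx
  set y := ‖x‖⁻¹ • x with hy
  have hy1 : ‖y‖ = 1 := by simp [hy, norm_smul, hx'.ne']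
  have hTy : ‖T y‖ ≤ Real.exp (-20) := by
    rw [hy, map_smul, norm_smul, norm_inv, norm_norm, inv_mul_le_iff₀ hx', mul_comm]
    exact hcon.le
  have hM : 1 ≤ M := by
    have : k ≠ 0 := by
      rintro rfl
      exact hx (Subsingleton.elim _ _)
    omega
  set e := Real.exp (-20) with he
  have he0 : 0 < e := Real.exp_pos _
  -- This fixes the constant `e ^ (-20)`: the final comparison of bases is `exp (-8) * (e / 32)`
  -- against `2 * e ^ 2 * exp 6`, which contradicts the assumption exactly when `64 * exp 14 * e <
  -- 1`.
  have hesmall : e * (64 * Real.exp 14) < 1 := by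
    have h6 : (64 : ℝ) < Real.exp 6 := by
      have h1 : (2.7 : ℝ) < Real.exp 1 := lt_trans (by norm_num) Real.exp_one_gt_d9
      have h2 : Real.exp 6 = Real.exp 1 ^ 6 := by rw [← Real.exp_nat_mul]; norm_num
      rw [h2]
      calc (64 : ℝ) < 2.7 ^ 6 := by norm_num
        _ < _ := pow_lt_pow_left₀ h1 (by norm_num) (by norm_num)
    calc e * (64 * Real.exp 14) < e * (Real.exp 6 * Real.exp 14) := by gcongr
      _ = 1 := by rw [he, ← Real.exp_add, ← Real.exp_add]; norm_num
  have he1 : e ≤ 1 := Real.exp_le_one_iff.mpr (by norm_num)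
  have he40 : Real.exp 40 * e ^ 2 = 1 := by
    rw [he, ← Real.exp_nat_mul, ← Real.exp_add]; norm_num
  set V := volume (Metric.ball (0 : EuclideanSpace ℝ (Fin k)) 1) with hV
  have hV0 : V ≠ 0 := (Metric.measure_ball_pos _ _ one_pos).ne'
  have hVt : V ≠ ∞ := measure_ball_lt_top.ne
  -- As `T` is 16-Lipschitz, it moves by at most `e` on this ball, so `‖T z‖ ≤ 2e` there. The weight
  -- `exp 40 = e ^ (-2)` then leaves the harmless factor `exp (-4M)`.
  have hlow : ENNReal.ofReal (Real.exp (-4 * M)) * volume (Metric.closedBall y (e / 16)) ≤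
      ∫⁻ x in Metric.closedBall 0 2 \ Metric.ball 0 (1 / 2),
        ENNReal.ofReal (Real.exp (-Real.exp 40 * M * ‖T x‖ ^ 2)) := by
    rw [← setLIntegral_const]
    calc _ ≤ ∫⁻ x in Metric.closedBall y (e / 16),
          ENNReal.ofReal (Real.exp (-Real.exp 40 * M * ‖T x‖ ^ 2)) := by
          refine setLIntegral_mono' measurableSet_closedBall fun z hz => ?_
          refine ENNReal.ofReal_le_ofReal (Real.exp_le_exp.mpr ?_)
          have h1 : ‖T (z - y)‖ ≤ e :=
            (hT _).trans (by have := mem_closedBall_iff_norm.mp hz; linarith)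
          have h2 : ‖T z‖ ≤ ‖T (z - y)‖ + ‖T y‖ := by
            have := norm_add_le (T (z - y)) (T y)
            rwa [← map_add, sub_add_cancel] at this
          have h3 : ‖T z‖ ^ 2 ≤ (2 * e) ^ 2 := by gcongr; linarith
          have h4 : Real.exp 40 * ‖T z‖ ^ 2 ≤ 4 := by
            calc Real.exp 40 * ‖T z‖ ^ 2 ≤ Real.exp 40 * (2 * e) ^ 2 := by gcongr
              _ = 4 := by rw [mul_pow, mul_left_comm, he40]; norm_num
          have hM' : (0 : ℝ) ≤ M := Nat.cast_nonneg M
          nlinarith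
      _ ≤ _ := by
        refine lintegral_mono_set fun z hz => ⟨?_, ?_⟩
        · exact Metric.closedBall_subset_closedBall' (by simp [hy1]; linarith) hz
        · simp only [Metric.mem_ball, dist_zero_right, not_lt]
          have h1 := mem_closedBall_iff_norm'.mp hz
          have h2 := norm_sub_norm_le y z
          linarith
  have hcmp := (hlow.trans h).trans (mul_le_mul_left (measure_mono Set.sdiff_subset) _)
  rw [Measure.addHaar_closedBall _ _ (by positivity), Measure.addHaar_closedBall _ _ (by norm_num),
    ← hV, finrank_euclideanSpace_fin, ← mul_assoc, mul_right_comm _ V] at hcmp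
  rw [ENNReal.mul_le_mul_iff_left hV0 hVt, ← ENNReal.ofReal_mul (Real.exp_pos _).le,
    ← ENNReal.ofReal_mul (by positivity), ENNReal.ofReal_le_ofReal_iff (by positivity)] at hcmp
  have h32 : Real.exp (-4 * M) * (e / 32) ^ k ≤ (√2 * e) ^ M * Real.exp (3 * M) := by
    have e1 : (e / 16) ^ k = 2 ^ k * (e / 32) ^ k := by rw [← mul_pow]; congr 1; ring
    rw [e1, mul_left_comm] at hcmp
    exact le_of_mul_le_mul_left hcmp (by positivity)
  -- Volume costs `e ^ k` while the expectation gains `e ^ M`. Squaring turns `k` into `2k ≤ M`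
  -- without halving exponents, and leaves a spare factor `e ^ M`.
  have hsq := pow_le_pow_left₀ (by positivity) h32 2
  have hl : (Real.exp (-4 * M) * (e / 32) ^ k) ^ 2 = Real.exp (-8) ^ M * (e / 32) ^ (2 * k) := by
    rw [mul_pow, ← pow_mul, mul_comm k 2, ← Real.exp_nat_mul, ← Real.exp_nat_mul]
    congr 2; push_cast; ring
  have hr : ((√2 * e) ^ M * Real.exp (3 * M)) ^ 2 = (2 * e ^ 2 * Real.exp 6) ^ M := by
    have h6 : Real.exp (3 * M) ^ 2 = Real.exp 6 ^ M := by
      rw [← Real.exp_nat_mul, ← Real.exp_nat_mul]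
      congr 1; push_cast; ring
    rw [mul_pow, h6, ← pow_mul, mul_comm M 2, pow_mul, mul_pow, Real.sq_sqrt (by norm_num),
      ← mul_pow]
  rw [hl, hr] at hsq
  have hfin : (Real.exp (-8) * (e / 32)) ^ M ≤ (2 * e ^ 2 * Real.exp 6) ^ M := by
    refine le_trans ?_ hsq
    rw [mul_pow]
    exact mul_le_mul_of_nonneg_left
      (pow_le_pow_of_le_one (by positivity) (by linarith) hk) (by positivity)
  have hlt : 2 * e ^ 2 * Real.exp 6 < Real.exp (-8) * (e / 32) := by
    have h14 : Real.exp 14 * Real.exp (-8) = Real.exp 6 := by rw [← Real.exp_add]; norm_num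
    rw [← h14]
    have : 0 < Real.exp (-8) * (e / 32) := by positivity
    nlinarith
  exact absurd hfin (not_le.mpr (pow_lt_pow_left₀ hlt (by positivity) (by omega)))

/-- With overwhelming probability, a Gaussian sketch is bounded below on a subspace of at most half
its dimension. -/
theorem exists_sketch_lower {M p k : ℕ} (hM : 1 ≤ M) (hk : 2 * k ≤ M) (q : Fin k → Vec p)
    (hq : ∀ i j, q i ⬝ᵥ q j = if i = j then 1 else 0) :
    ∃ B : Set (Sketch M p), gaussianSketch M p B ≤ ENNReal.ofReal (2 * Real.exp (-(3 * M))) ∧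
      MeasurableSet B ∧
      ∀ S ∉ B, ∀ x : EuclideanSpace ℝ (Fin k), Real.exp (-20) * ‖x‖ ≤ ‖sketchMap S q x‖ := by
  -- In dimension zero the annulus is empty, so it cannot be averaged over.
  rcases Nat.eq_zero_or_pos k with rfl | hk0
  · exact ⟨∅, by simp, MeasurableSet.empty, fun S _ x => by simp [Subsingleton.elim x 0]⟩
  obtain ⟨A₁, hA₁⟩ : ∃ A : Set (EuclideanSpace ℝ (Fin k)), A = Metric.closedBall 0 (3 / 2) :=
    ⟨_, rfl⟩
  obtain ⟨A₂, hA₂⟩ : ∃ A : Set (EuclideanSpace ℝ (Fin k)),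
    A = Metric.closedBall 0 2 \ Metric.ball 0 (1 / 2) := ⟨_, rfl⟩
  have hA₁0 : volume A₁ ≠ 0 := by
    rw [hA₁]; exact (Metric.measure_closedBall_pos _ _ (by norm_num)).ne'
  have hA₁t : volume A₁ ≠ ∞ := by rw [hA₁]; exact measure_closedBall_lt_top.ne
  have hA₂0 : volume A₂ ≠ 0 := by
    have hy : ‖EuclideanSpace.single (⟨0, hk0⟩ : Fin k) (1 : ℝ)‖ = 1 := by simp
    refine ((Metric.measure_ball_pos volume (EuclideanSpace.single (⟨0, hk0⟩ : Fin k) (1 : ℝ))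
      (by norm_num : (0 : ℝ) < 1 / 2)).trans_le (measure_mono ?_)).ne'
    intro z hz
    rw [hA₂]
    have h1 := mem_ball_iff_norm.mp hz
    have h2 := norm_sub_norm_le z (EuclideanSpace.single (⟨0, hk0⟩ : Fin k) (1 : ℝ))
    have h3 := norm_sub_norm_le (EuclideanSpace.single (⟨0, hk0⟩ : Fin k) (1 : ℝ)) z
    rw [norm_sub_rev] at h3
    simp only [Set.mem_sdiff, Metric.mem_closedBall, dist_zero_right, Metric.mem_ball, not_lt]
    constructor <;> linarith
  have hA₂t : volume A₂ ≠ ∞ := by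
    rw [hA₂]
    exact ((measure_mono Set.sdiff_subset).trans_lt measure_closedBall_lt_top).ne
  have hr2 : (Real.exp 20 / √2) ^ 2 = Real.exp 40 / 2 := by
    rw [div_pow, Real.sq_sqrt (by norm_num), ← Real.exp_nat_mul]; norm_num
  have hrinv : (Real.exp 20 / √2)⁻¹ = √2 * Real.exp (-20) := by
    rw [inv_div, Real.exp_neg]; rfl
  -- The rate `1/9` is the largest permitted on the ball of radius `3/2`, since `4 * (1/9) * (3/2)²
  -- = 1`.
  have m₁ := measure_setLIntegral_exp_sketchMap (M := M) q hA₁0 hA₁t (1 / 9 * M)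
    (b := 2 ^ M) (by positivity) (3 * M) (fun x hx => by
      simp only [norm_sketchMap_sq]
      refine lintegral_exp_sketchSq_upper hM _ ?_
      rw [hA₁, mem_closedBall_zero_iff] at hx
      rw [comb_dotProduct_self hq]
      nlinarith [norm_nonneg x])
  -- On the annulus `‖x‖² ≥ 1/4`, so `r = exp 20 / √2` satisfies `r² ≤ 2 * exp 40 * ‖x‖²`, which is
  -- what the lower-tail moment bound asks for.
  have m₂ := measure_setLIntegral_exp_sketchMap (M := M) q hA₂0 hA₂t (-Real.exp 40 * M)
    (b := (√2 * Real.exp (-20)) ^ M) (by positivity) (3 * M) (fun x hx => by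
      simp only [norm_sketchMap_sq]
      rw [← hrinv]
      refine lintegral_exp_sketchSq_lower hM _ (Real.exp_pos _).le (by positivity) ?_
      rw [hA₂] at hx
      simp only [Set.mem_sdiff, Metric.mem_closedBall, dist_zero_right, Metric.mem_ball,
        not_lt] at hx
      rw [comb_dotProduct_self hq, hr2]
      have : 1 / 4 ≤ ‖x‖ ^ 2 := by nlinarith [hx.2]
      nlinarith [Real.exp_pos 40])
  refine ⟨_, (measure_union_le _ _).trans ((add_le_add m₁ m₂).trans ?_), ?_, ?_⟩
  · rw [← ENNReal.ofReal_add (Real.exp_pos _).le (Real.exp_pos _).le]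
    exact ENNReal.ofReal_le_ofReal (by linarith)
  · refine MeasurableSet.union ?_ ?_ <;>
    exact (measurableSet_le (measurable_exp_sketchMap q _).lintegral_prod_right'
      measurable_const).compl
  · intro S hS
    rw [Set.mem_union, not_or] at hS
    have g₁ := not_not.mp hS.1
    have g₂ := not_not.mp hS.2
    rw [hA₁] at g₁
    rw [hA₂] at g₂
    exact norm_ge_of_setLIntegral_exp hk _ (norm_le_of_setLIntegral_exp (by omega) _ g₁) g₂

end QuantSGD

namespace QuantSGD

/-! ### Quadratic forms of moment matrices -/

theorem dotProduct_mulVec_le_of_le {n : ℕ} {A B : Matrix (Fin n) (Fin n) ℝ} (h : A ≤ B)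
    (u : Vec n) : u ⬝ᵥ (A *ᵥ u) ≤ u ⬝ᵥ (B *ᵥ u) := by
  have := (Matrix.le_iff.mp h).dotProduct_mulVec_nonneg u
  simp only [star_trivial, sub_mulVec, dotProduct_sub] at this
  linarith

theorem integral_sum_sum_mul {Ω : Type*} [MeasurableSpace Ω] {μ : Measure Ω} {n : ℕ}
    {W : Fin n → Fin n → Ω → ℝ} (hW : ∀ i j, Integrable (W i j) μ) (u v : Vec n) :
    Integrable (fun ω => ∑ i, ∑ j, u i * (W i j ω * v j)) μ ∧
      ∫ ω, ∑ i, ∑ j, u i * (W i j ω * v j) ∂μ =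
        u ⬝ᵥ ((Matrix.of fun i j => ∫ ω, W i j ω ∂μ) *ᵥ v) := by
  have h1 : ∀ i j, Integrable (fun ω => u i * (W i j ω * v j)) μ := fun i j =>
    ((hW i j).mul_const _).const_mul _
  refine ⟨integrable_finsetSum _ fun i _ => integrable_finsetSum _ fun j _ => h1 i j, ?_⟩
  rw [integral_finsetSum _ fun i _ => integrable_finsetSum _ fun j _ => h1 i j]
  simp only [dotProduct, mulVec, Matrix.of_apply, Finset.mul_sum]
  refine Finset.sum_congr rfl fun i _ => ?_
  rw [integral_finsetSum _ fun j _ => h1 i j]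
  refine Finset.sum_congr rfl fun j _ => ?_
  rw [integral_const_mul, integral_mul_const]

theorem sum_sum_mul_eq {n : ℕ} (g : ℝ) (x u v : Vec n) :
    ∑ i, ∑ j, u i * (g * (x i * x j) * v j) = g * ((u ⬝ᵥ x) * (v ⬝ᵥ x)) := by
  rw [dotProduct, dotProduct, Finset.sum_mul_sum, Finset.mul_sum]
  refine Finset.sum_congr rfl fun i _ => ?_
  rw [Finset.mul_sum]
  exact Finset.sum_congr rfl fun j _ => by ring

theorem integral_mul_dotProduct_mul_dotProduct {Ω : Type*} [MeasurableSpace Ω] {μ : Measure Ω}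
    {n : ℕ} {g : Ω → ℝ} {φ : Ω → Vec n}
    (h : ∀ i j, Integrable (fun ω => g ω * (φ ω i * φ ω j)) μ) (u v : Vec n) :
    Integrable (fun ω => g ω * ((u ⬝ᵥ φ ω) * (v ⬝ᵥ φ ω))) μ ∧
      ∫ ω, g ω * ((u ⬝ᵥ φ ω) * (v ⬝ᵥ φ ω)) ∂μ =
        u ⬝ᵥ ((Matrix.of fun i j => ∫ ω, g ω * (φ ω i * φ ω j) ∂μ) *ᵥ v) := by
  have := integral_sum_sum_mul h u v
  simpa only [sum_sum_mul_eq] using this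

theorem integral_dotProduct_mul_dotProduct {Ω : Type*} [MeasurableSpace Ω] {μ : Measure Ω}
    {n : ℕ} {φ : Ω → Vec n} (h : ∀ i j, Integrable (fun ω => φ ω i * φ ω j) μ) (u v : Vec n) :
    Integrable (fun ω => (u ⬝ᵥ φ ω) * (v ⬝ᵥ φ ω)) μ ∧
      ∫ ω, (u ⬝ᵥ φ ω) * (v ⬝ᵥ φ ω) ∂μ =
        u ⬝ᵥ ((Matrix.of fun i j => ∫ ω, φ ω i * φ ω j ∂μ) *ᵥ v) := by
  have := integral_mul_dotProduct_mul_dotProduct (g := fun _ => 1) (φ := φ) (μ := μ)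
    (by simpa using h) u v
  simpa only [one_mul] using this

theorem HasSecondMoment.integral_mul {n : ℕ} {μ : Measure (Vec n)} (h : HasSecondMoment μ)
    (u v : Vec n) :
    Integrable (fun z => (u ⬝ᵥ z) * (v ⬝ᵥ z)) μ ∧
      ∫ z, (u ⬝ᵥ z) * (v ⬝ᵥ z) ∂μ = u ⬝ᵥ (secondMoment μ *ᵥ v) :=
  integral_dotProduct_mul_dotProduct (φ := fun z => z) h u v

theorem HasSecondMoment.integral_sq {n : ℕ} {μ : Measure (Vec n)} (h : HasSecondMoment μ)
    (u : Vec n) :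
    Integrable (fun z => (u ⬝ᵥ z) ^ 2) μ ∧
      ∫ z, (u ⬝ᵥ z) ^ 2 ∂μ = u ⬝ᵥ (secondMoment μ *ᵥ u) := by
  simpa only [pow_two] using h.integral_mul u u

theorem measurable_dotProduct_left {n : ℕ} (u : Vec n) : Measurable fun z : Vec n => u ⬝ᵥ z := by
  simp only [dotProduct]
  fun_prop

/-- The second moment of a square integrable variable is `mean² + variance`. -/
theorem lintegral_sq_eq_of_mean {Ω : Type*} [MeasurableSpace Ω] {μ : Measure Ω}
    [IsProbabilityMeasure μ] {φ : Ω → ℝ} {m : ℝ} (hφ : Integrable φ μ) (hm : ∫ ω, φ ω ∂μ = m)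
    (h2 : Integrable (fun ω => (φ ω - m) ^ 2) μ) :
    ∫⁻ ω, ENNReal.ofReal (φ ω ^ 2) ∂μ = ENNReal.ofReal (m ^ 2 + ∫ ω, (φ ω - m) ^ 2 ∂μ) := by
  have e : ∀ ω, φ ω ^ 2 = (φ ω - m) ^ 2 + (2 * m * φ ω - m ^ 2) := fun ω => by ring
  have hi : Integrable (fun ω => 2 * m * φ ω - m ^ 2) μ :=
    (hφ.const_mul _).sub (integrable_const _)
  rw [← ofReal_integral_eq_lintegral_ofReal]
  · congr 1
    simp_rw [e]
    rw [integral_add h2 hi, integral_sub (hφ.const_mul _) (integrable_const _),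
      integral_const_mul, hm]
    simp
    ring
  · simp_rw [e]
    exact h2.add hi
  · exact Filter.Eventually.of_forall fun ω => sq_nonneg _

/-! ### Moments of quantized values -/

theorem UnbiasedVec.integral_dotProduct {n : ℕ} {Q : Kernel (Vec n) (Vec n)} (h : UnbiasedVec Q)
    (y u : Vec n) : Integrable (fun r => u ⬝ᵥ r) (Q y) ∧ ∫ r, u ⬝ᵥ r ∂(Q y) = u ⬝ᵥ y := by
  have hi : ∀ i, Integrable (fun r : Vec n => u i * r i) (Q y) := fun i =>
    (h y i).1.const_mul _
  constructor
  · exact integrable_finsetSum _ fun i _ => hi i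
  · simp only [dotProduct]
    rw [integral_finsetSum _ fun i _ => hi i]
    exact Finset.sum_congr rfl fun i _ => by rw [integral_const_mul, (h y i).2]

theorem AdditiveVec.integral_dotProduct_sub_sq {n : ℕ} {Q : Kernel (Vec n) (Vec n)} {ε : ℝ}
    (h : AdditiveVec Q ε) (y u : Vec n) :
    Integrable (fun r => (u ⬝ᵥ r - u ⬝ᵥ y) ^ 2) (Q y) ∧
      ∫ r, (u ⬝ᵥ r - u ⬝ᵥ y) ^ 2 ∂(Q y) ≤ ε * (u ⬝ᵥ u) := by
  have := integral_dotProduct_mul_dotProduct (φ := fun r : Vec n => r - y) (μ := Q y) (h y).1 u u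
  simp only [dotProduct_sub, ← pow_two] at this
  refine ⟨this.1, this.2.trans_le ?_⟩
  refine (dotProduct_mulVec_le_of_le (h y).2 u).trans ?_
  rw [smul_mulVec, one_mulVec, dotProduct_smul, smul_eq_mul]

theorem AdditiveVec.lintegral_sq {n : ℕ} {Q : Kernel (Vec n) (Vec n)} [IsMarkovKernel Q] {ε : ℝ}
    (h : AdditiveVec Q ε) (hu : UnbiasedVec Q) (y u : Vec n) :
    ENNReal.ofReal ((u ⬝ᵥ y) ^ 2) ≤ ∫⁻ r, ENNReal.ofReal ((u ⬝ᵥ r) ^ 2) ∂(Q y) ∧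
      ∫⁻ r, ENNReal.ofReal ((u ⬝ᵥ r) ^ 2) ∂(Q y) ≤
        ENNReal.ofReal ((u ⬝ᵥ y) ^ 2 + ε * (u ⬝ᵥ u)) := by
  obtain ⟨h1, h2⟩ := hu.integral_dotProduct y u
  obtain ⟨h3, h4⟩ := h.integral_dotProduct_sub_sq y u
  rw [lintegral_sq_eq_of_mean h1 h2 h3]
  constructor <;> apply ENNReal.ofReal_le_ofReal
  · have : 0 ≤ ∫ r, (u ⬝ᵥ r - u ⬝ᵥ y) ^ 2 ∂(Q y) := integral_nonneg fun r => sq_nonneg _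
    linarith
  · linarith

theorem AdditiveScalar.lintegral_sq {Q : Kernel ℝ ℝ} [IsMarkovKernel Q] {ε : ℝ}
    (h : AdditiveScalar Q ε) (hu : UnbiasedScalar Q) (y c : ℝ) :
      ∫⁻ r, ENNReal.ofReal ((c - r) ^ 2) ∂(Q y) ≤ ENNReal.ofReal ((c - y) ^ 2 + ε) := by
  have hi : Integrable (fun r : ℝ => c - r) (Q y) := (integrable_const c).sub (hu y).1
  have hm : ∫ r, (c - r) ∂(Q y) = c - y := by
    rw [integral_sub (integrable_const c) (hu y).1, (hu y).2]
    simp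
  have e : ∀ r : ℝ, (c - r - (c - y)) ^ 2 = (r - y) ^ 2 := fun r => by ring
  have h3 : Integrable (fun r : ℝ => (c - r - (c - y)) ^ 2) (Q y) := by
    simp_rw [e]; exact (h y).1
  rw [lintegral_sq_eq_of_mean hi hm h3]
  refine ENNReal.ofReal_le_ofReal ?_
  simp_rw [e]
  have := (h y).2
  linarith

/-- Signs of the error levels are not assumed. They follow from the presence of a variance, here and
in the vector and matrix analogues, where a coordinate must exist. -/
theorem AdditiveScalar.nonneg {Q : Kernel ℝ ℝ} {ε : ℝ} (h : AdditiveScalar Q ε) : 0 ≤ ε :=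
  (integral_nonneg fun _ => sq_nonneg _).trans (h 0).2

theorem AdditiveVec.nonneg {n : ℕ} (hn : 1 ≤ n) {Q : Kernel (Vec n) (Vec n)} {ε : ℝ}
    (h : AdditiveVec Q ε) : 0 ≤ ε := by
  have h1 := (h.integral_dotProduct_sub_sq 0 (Pi.single ⟨0, hn⟩ 1)).2
  simp only [single_one_dotProduct, Pi.single_eq_same, mul_one] at h1
  exact (integral_nonneg fun r => sq_nonneg _).trans h1

theorem dotProduct_mulVec_of_eq_sum {M p : ℕ} (R : Sketch M p) (u : Vec M) (z : Vec p) :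
    u ⬝ᵥ (Matrix.of R *ᵥ z) = ∑ i, ∑ k, u i * (R i k * z k) := by
  simp [dotProduct, mulVec, Finset.mul_sum]

theorem UnbiasedMat.integral_dotProduct {M p : ℕ} {Q : Kernel (Sketch M p) (Sketch M p)}
    (h : UnbiasedMat Q) (X : Sketch M p) (u : Vec M) (z : Vec p) :
    Integrable (fun R : Sketch M p => u ⬝ᵥ (Matrix.of R *ᵥ z)) (Q X) ∧
      ∫ R, u ⬝ᵥ (Matrix.of R *ᵥ z) ∂(Q X) = u ⬝ᵥ (Matrix.of X *ᵥ z) := by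
  have hi : ∀ i k, Integrable (fun R : Sketch M p => u i * (R i k * z k)) (Q X) := fun i k =>
    ((h X i k).1.mul_const _).const_mul _
  simp only [dotProduct_mulVec_of_eq_sum]
  refine ⟨integrable_finsetSum _ fun i _ => integrable_finsetSum _ fun k _ => hi i k, ?_⟩
  rw [integral_finsetSum _ fun i _ => integrable_finsetSum _ fun k _ => hi i k]
  refine Finset.sum_congr rfl fun i _ => ?_
  rw [integral_finsetSum _ fun k _ => hi i k]
  refine Finset.sum_congr rfl fun k _ => ?_
  rw [integral_const_mul, integral_mul_const, (h X i k).2]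

/-- The matrix condition is tested on the rank-one `A = z zᵀ`, whose trace is `|z|²`. -/
theorem AdditiveMat.integral_dotProduct_sub_sq {M p : ℕ}
    {Q : Kernel (Sketch M p) (Sketch M p)} {ε : ℝ} (h : AdditiveMat Q ε) (X : Sketch M p)
    (u : Vec M) (z : Vec p) :
    Integrable (fun R : Sketch M p =>
        (u ⬝ᵥ (Matrix.of R *ᵥ z) - u ⬝ᵥ (Matrix.of X *ᵥ z)) ^ 2) (Q X) ∧
      ∫ R, (u ⬝ᵥ (Matrix.of R *ᵥ z) - u ⬝ᵥ (Matrix.of X *ᵥ z)) ^ 2 ∂(Q X) ≤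
        ε * (z ⬝ᵥ z) * (u ⬝ᵥ u) := by
  have hP : (vecMulVec z z).PosSemidef := by
    simpa using Matrix.posSemidef_vecMulVec_self_star z
  have hle := dotProduct_mulVec_le_of_le ((h X).2 _ hP) u
  have hent : ∀ (R : Sketch M p) (i j : Fin M),
      ((Matrix.of R - Matrix.of X) * vecMulVec z z * (Matrix.of R - Matrix.of X)ᵀ) i j =
        ∑ k, ∑ l, z k * ((R i k - X i k) * (R j l - X j l) * z l) := by
    intro R i j
    simp only [Matrix.mul_apply, vecMulVec_apply, Matrix.sub_apply, Matrix.of_apply,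
      Matrix.transpose_apply, Finset.sum_mul]
    rw [Finset.sum_comm]
    exact Finset.sum_congr rfl fun k _ => Finset.sum_congr rfl fun l _ => by ring
  have hW : ∀ i j, Integrable (fun R : Sketch M p =>
      ((Matrix.of R - Matrix.of X) * vecMulVec z z * (Matrix.of R - Matrix.of X)ᵀ) i j)
      (Q X) := by
    intro i j
    simp_rw [hent]
    exact integrable_finsetSum _ fun k _ => integrable_finsetSum _ fun l _ =>
      (((h X).1 i j k l).mul_const _).const_mul _
  have hq := integral_sum_sum_mul hW u u
  have hpt : ∀ R : Sketch M p, ∑ i, ∑ j, u i *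
      (((Matrix.of R - Matrix.of X) * vecMulVec z z * (Matrix.of R - Matrix.of X)ᵀ) i j * u j) =
      (u ⬝ᵥ (Matrix.of R *ᵥ z) - u ⬝ᵥ (Matrix.of X *ᵥ z)) ^ 2 := by
    intro R
    have h1 : u ⬝ᵥ (Matrix.of R *ᵥ z) - u ⬝ᵥ (Matrix.of X *ᵥ z) =
        u ⬝ᵥ ((Matrix.of R - Matrix.of X) *ᵥ z) := by
      rw [sub_mulVec, dotProduct_sub]
    have h2 : ∑ i, ∑ j, u i * (((Matrix.of R - Matrix.of X) * vecMulVec z z *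
        (Matrix.of R - Matrix.of X)ᵀ) i j * u j) =
        u ⬝ᵥ (((Matrix.of R - Matrix.of X) * vecMulVec z z * (Matrix.of R - Matrix.of X)ᵀ) *ᵥ u) := by
      simp [dotProduct, mulVec, Finset.mul_sum]
    rw [h1, h2, mul_vecMulVec, vecMulVec_mul, vecMul_transpose, vecMulVec_mulVec]
    simp [dotProduct_smul, pow_two, dotProduct_comm]
  simp_rw [hpt] at hq
  refine ⟨hq.1, hq.2.trans_le (hle.trans ?_)⟩
  rw [smul_mulVec, one_mulVec, dotProduct_smul, smul_eq_mul, trace_vecMulVec]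

theorem AdditiveMat.lintegral_sq {M p : ℕ}
    {Q : Kernel (Sketch M p) (Sketch M p)} [IsMarkovKernel Q] {ε : ℝ} (h : AdditiveMat Q ε)
    (hu : UnbiasedMat Q) (X : Sketch M p) (u : Vec M) (z : Vec p) :
    ENNReal.ofReal ((u ⬝ᵥ (Matrix.of X *ᵥ z)) ^ 2) ≤
        ∫⁻ R, ENNReal.ofReal ((u ⬝ᵥ (Matrix.of R *ᵥ z)) ^ 2) ∂(Q X) ∧
      ∫⁻ R, ENNReal.ofReal ((u ⬝ᵥ (Matrix.of R *ᵥ z)) ^ 2) ∂(Q X) ≤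
        ENNReal.ofReal ((u ⬝ᵥ (Matrix.of X *ᵥ z)) ^ 2 + ε * (z ⬝ᵥ z) * (u ⬝ᵥ u)) := by
  obtain ⟨h1, h2⟩ := hu.integral_dotProduct X u z
  obtain ⟨h3, h4⟩ := h.integral_dotProduct_sub_sq X u z
  rw [lintegral_sq_eq_of_mean h1 h2 h3]
  constructor <;> apply ENNReal.ofReal_le_ofReal
  · have : 0 ≤ ∫ R : Sketch M p,
        (u ⬝ᵥ (Matrix.of R *ᵥ z) - u ⬝ᵥ (Matrix.of X *ᵥ z)) ^ 2 ∂(Q X) :=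
      integral_nonneg fun r => sq_nonneg _
    linarith
  · linarith

theorem AdditiveMat.nonneg {M p : ℕ} (hM : 1 ≤ M) (hp : 1 ≤ p)
    {Q : Kernel (Sketch M p) (Sketch M p)} {ε : ℝ} (h : AdditiveMat Q ε) : 0 ≤ ε := by
  have h1 := (h.integral_dotProduct_sub_sq 0 (Pi.single ⟨0, hM⟩ 1) (Pi.single ⟨0, hp⟩ 1)).2
  simp only [single_one_dotProduct, Pi.single_eq_same, mul_one] at h1
  exact (integral_nonneg fun r => sq_nonneg _).trans h1

theorem AdditiveVec.lintegral_self {n : ℕ} {Q : Kernel (Vec n) (Vec n)} [IsMarkovKernel Q] {ε : ℝ}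
    (hε : 0 ≤ ε) (h : AdditiveVec Q ε) (hu : UnbiasedVec Q) (y : Vec n) :
    ∫⁻ r, ENNReal.ofReal (r ⬝ᵥ r) ∂(Q y) ≤ ENNReal.ofReal (y ⬝ᵥ y + ε * n) := by
  have e : ∀ r : Vec n, ENNReal.ofReal (r ⬝ᵥ r) =
      ∑ i, ENNReal.ofReal ((Pi.single i 1 ⬝ᵥ r) ^ 2) := by
    intro r
    rw [← ENNReal.ofReal_sum_of_nonneg fun i _ => sq_nonneg _]
    simp only [single_one_dotProduct]
    simp only [dotProduct, pow_two]
  simp_rw [e]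
  rw [lintegral_finsetSum _ fun i _ =>
    ((measurable_dotProduct_left _).pow_const 2).ennreal_ofReal]
  calc _ ≤ ∑ i, ENNReal.ofReal ((Pi.single i 1 ⬝ᵥ y) ^ 2 +
        ε * ((Pi.single i 1 : Vec n) ⬝ᵥ Pi.single i 1)) :=
        Finset.sum_le_sum fun i _ => (h.lintegral_sq hu y _).2
    _ = _ := by
        rw [← ENNReal.ofReal_sum_of_nonneg fun i _ =>
          add_nonneg (sq_nonneg _) (mul_nonneg hε (dotProduct_self_nonneg' _))]
        congr 1
        simp only [single_one_dotProduct, Pi.single_eq_same, mul_one, Finset.sum_add_distrib,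
          pow_two, Finset.sum_const, Finset.card_univ, Fintype.card_fin, nsmul_eq_mul]
        rw [dotProduct, mul_comm ε]

end QuantSGD

namespace QuantSGD

/-! ### Moments of the quantized feature -/

section Feature

variable {p M : ℕ}

theorem integrable_sq_of_lintegral_ne_top {Ω : Type*} [MeasurableSpace Ω] {μ : Measure Ω}
    {φ : Ω → ℝ} (hφ : Measurable φ) (h : ∫⁻ ω, ENNReal.ofReal (φ ω ^ 2) ∂μ ≠ ∞) :
    Integrable (fun ω => φ ω ^ 2) μ :=
  (lintegral_ofReal_ne_top_iff_integrable (hφ.pow_const 2).aestronglyMeasurable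
    (Filter.Eventually.of_forall fun _ => sq_nonneg _)).mp h

theorem memLp_two_of_lintegral_ne_top {Ω : Type*} [MeasurableSpace Ω] {μ : Measure Ω}
    {φ : Ω → ℝ} (hφ : Measurable φ) (h : ∫⁻ ω, ENNReal.ofReal (φ ω ^ 2) ∂μ ≠ ∞) : MemLp φ 2 μ :=
  (memLp_two_iff_integrable_sq hφ.aestronglyMeasurable).mpr
    (integrable_sq_of_lintegral_ne_top hφ h)

theorem lintegral_quantFeature (Q : Quantizers p M) (S : Sketch M p) (x : Vec p)
    {g : Vec M → ℝ≥0∞} (hg : Measurable g) :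
    ∫⁻ r, g r ∂(quantFeature Q S x) =
      ∫⁻ z, ∫⁻ R, ∫⁻ r, g r ∂(Q.f (Matrix.of R *ᵥ z)) ∂(Q.s S) ∂(Q.d x) := by
  have h1 : Measurable fun y : Vec M => ∫⁻ r, g r ∂(Q.f y) := hg.lintegral_kernel
  have h2 : Measurable fun z : Sketch M p × Vec p => ∫⁻ r, g r ∂(Q.f (Matrix.of z.1 *ᵥ z.2)) :=
    h1.comp measurable_mulVec
  rw [quantFeature, Kernel.lintegral_comp _ _ _ hg, Kernel.lintegral_map _ measurable_mulVec _ h1,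
    Kernel.lintegral_prod_symm _ _ _ h2]
  rfl

/-- Conditional variances add. `Q_f` contributes `ε_f |u|²`; `Q_s` contributes `ε_s |z|² |u|²` at
the quantized data `z`, with `E|z|² ≤ |x|² + ε_d p`; `Q_d` contributes `ε_d |Sᵀu|²`. The lower bound
drops these nonnegative variances. -/
theorem lintegral_sq_quantFeature {Q : Quantizers p M} {ε : ErrorLevels} (hM : 1 ≤ M) (hp : 1 ≤ p)
    (hu : Q.Unbiased) (ha : Q.Additive ε) (S : Sketch M p) (x : Vec p) (u : Vec M) :
    ENNReal.ofReal ((u ⬝ᵥ (Matrix.of S *ᵥ x)) ^ 2) ≤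
        ∫⁻ r, ENNReal.ofReal ((u ⬝ᵥ r) ^ 2) ∂(quantFeature Q S x) ∧
      ∫⁻ r, ENNReal.ofReal ((u ⬝ᵥ r) ^ 2) ∂(quantFeature Q S x) ≤
        ENNReal.ofReal ((u ⬝ᵥ (Matrix.of S *ᵥ x)) ^ 2 +
          ε.d * (((Matrix.of S)ᵀ *ᵥ u) ⬝ᵥ ((Matrix.of S)ᵀ *ᵥ u)) +
          (ε.s * (x ⬝ᵥ x + ε.d * p) + ε.f) * (u ⬝ᵥ u)) := by
  have hf0 := ha.f.nonneg hM
  have hd0 := ha.d.nonneg hp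
  have hs0 := ha.s.nonneg hM hp
  have huu := dotProduct_self_nonneg' u
  rw [lintegral_quantFeature _ _ _ ((measurable_dotProduct_left u).pow_const 2).ennreal_ofReal]
  have hS : ∀ z : Vec p, u ⬝ᵥ (Matrix.of S *ᵥ z) = ((Matrix.of S)ᵀ *ᵥ u) ⬝ᵥ z := fun z => by
    rw [dotProduct_mulVec, mulVec_transpose]
  constructor
  · calc _ = ENNReal.ofReal ((((Matrix.of S)ᵀ *ᵥ u) ⬝ᵥ x) ^ 2) := by rw [hS]
      _ ≤ ∫⁻ z, ENNReal.ofReal ((((Matrix.of S)ᵀ *ᵥ u) ⬝ᵥ z) ^ 2) ∂(Q.d x) :=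
        (ha.d.lintegral_sq hu.d x _).1
      _ ≤ _ := by
        refine lintegral_mono fun z => ?_
        rw [← hS]
        refine (ha.s.lintegral_sq hu.s S u z).1.trans (lintegral_mono fun R => ?_)
        exact (ha.f.lintegral_sq hu.f _ u).1
  · have h1 : ∀ z, ∫⁻ R, ∫⁻ r, ENNReal.ofReal ((u ⬝ᵥ r) ^ 2) ∂(Q.f (Matrix.of R *ᵥ z)) ∂(Q.s S) ≤
        ENNReal.ofReal ((((Matrix.of S)ᵀ *ᵥ u) ⬝ᵥ z) ^ 2) +
          ENNReal.ofReal (ε.s * (u ⬝ᵥ u)) * ENNReal.ofReal (z ⬝ᵥ z) +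
          ENNReal.ofReal (ε.f * (u ⬝ᵥ u)) := by
      intro z
      have hm : Measurable fun R : Sketch M p =>
          ENNReal.ofReal ((u ⬝ᵥ (Matrix.of R *ᵥ z)) ^ 2) := by
        simp only [dotProduct_mulVec_of_eq_sum]
        fun_prop
      calc _ ≤ ∫⁻ R, (ENNReal.ofReal ((u ⬝ᵥ (Matrix.of R *ᵥ z)) ^ 2) +
            ENNReal.ofReal (ε.f * (u ⬝ᵥ u))) ∂(Q.s S) := by
            refine lintegral_mono fun R => (ha.f.lintegral_sq hu.f _ u).2.trans ?_
            rw [ENNReal.ofReal_add (sq_nonneg _) (mul_nonneg hf0 huu)]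
        _ = (∫⁻ R, ENNReal.ofReal ((u ⬝ᵥ (Matrix.of R *ᵥ z)) ^ 2) ∂(Q.s S)) +
            ENNReal.ofReal (ε.f * (u ⬝ᵥ u)) := by
            rw [lintegral_add_left hm]
            simp
        _ ≤ _ := by
            gcongr
            refine (ha.s.lintegral_sq hu.s S u z).2.trans_eq ?_
            rw [hS, ← ENNReal.ofReal_mul (mul_nonneg hs0 huu), ← ENNReal.ofReal_add (sq_nonneg _)
              (mul_nonneg (mul_nonneg hs0 huu) (dotProduct_self_nonneg' z))]
            congr 1
            ring
    have hm1 : Measurable fun z : Vec p => ENNReal.ofReal ((((Matrix.of S)ᵀ *ᵥ u) ⬝ᵥ z) ^ 2) :=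
      ((measurable_dotProduct_left _).pow_const 2).ennreal_ofReal
    have hm2 : Measurable fun z : Vec p => ENNReal.ofReal (z ⬝ᵥ z) := by
      simp only [dotProduct]
      fun_prop
    calc _ ≤ ∫⁻ z, (ENNReal.ofReal ((((Matrix.of S)ᵀ *ᵥ u) ⬝ᵥ z) ^ 2) +
          ENNReal.ofReal (ε.s * (u ⬝ᵥ u)) * ENNReal.ofReal (z ⬝ᵥ z) +
          ENNReal.ofReal (ε.f * (u ⬝ᵥ u))) ∂(Q.d x) := lintegral_mono h1
      _ = (∫⁻ z, ENNReal.ofReal ((((Matrix.of S)ᵀ *ᵥ u) ⬝ᵥ z) ^ 2) ∂(Q.d x)) +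
          ENNReal.ofReal (ε.s * (u ⬝ᵥ u)) * (∫⁻ z, ENNReal.ofReal (z ⬝ᵥ z) ∂(Q.d x)) +
          ENNReal.ofReal (ε.f * (u ⬝ᵥ u)) := by
          rw [lintegral_add_right _ measurable_const, lintegral_add_left hm1,
            lintegral_const_mul _ hm2]
          simp
      _ ≤ ENNReal.ofReal ((((Matrix.of S)ᵀ *ᵥ u) ⬝ᵥ x) ^ 2 +
            ε.d * (((Matrix.of S)ᵀ *ᵥ u) ⬝ᵥ ((Matrix.of S)ᵀ *ᵥ u))) +
          ENNReal.ofReal (ε.s * (u ⬝ᵥ u)) * ENNReal.ofReal (x ⬝ᵥ x + ε.d * p) +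
          ENNReal.ofReal (ε.f * (u ⬝ᵥ u)) := by
          gcongr
          · exact (ha.d.lintegral_sq hu.d x _).2
          · exact ha.d.lintegral_self hd0 hu.d x
      _ = _ := by
          have hxx := dotProduct_self_nonneg' x
          have hvv := dotProduct_self_nonneg' ((Matrix.of S)ᵀ *ᵥ u)
          have hp0 : (0 : ℝ) ≤ p := Nat.cast_nonneg p
          rw [← ENNReal.ofReal_mul (by positivity), ← ENNReal.ofReal_add (by positivity)
            (by positivity), ← ENNReal.ofReal_add (by positivity) (by positivity), hS]
          congr 1
          ring

/-- The tower property through `Q_f`, `Q_s` and `Q_d`. The second-moment bound supplies the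
integrability that Fubini needs. -/
theorem integral_quantFeature {Q : Quantizers p M} {ε : ErrorLevels} (hM : 1 ≤ M) (hp : 1 ≤ p)
    (hu : Q.Unbiased) (ha : Q.Additive ε) (S : Sketch M p) (x : Vec p) (u : Vec M) :
    ∫ r, u ⬝ᵥ r ∂(quantFeature Q S x) = u ⬝ᵥ (Matrix.of S *ᵥ x) := by
  have hL2 : MemLp (fun r : Vec M => u ⬝ᵥ r) 2 (quantFeature Q S x) :=
    memLp_two_of_lintegral_ne_top (measurable_dotProduct_left u)
      ((lintegral_sq_quantFeature hM hp hu ha S x u).2.trans_lt ENNReal.ofReal_lt_top).ne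
  have hi := hL2.integrable (by norm_num)
  have hmv : Measurable fun y : Vec M => u ⬝ᵥ y := measurable_dotProduct_left u
  unfold quantFeature at hi ⊢
  have hi2 := hi.integral_comp
  rw [Kernel.integral_comp hi]
  simp only [fun y => (hu.f.integral_dotProduct y u).2] at hi2 ⊢
  rw [Kernel.map_apply _ measurable_mulVec] at hi2 ⊢
  rw [integrable_map_measure hmv.aestronglyMeasurable measurable_mulVec.aemeasurable,
    Kernel.prod_apply] at hi2
  replace hi2 : Integrable (fun z : Sketch M p × Vec p => u ⬝ᵥ (Matrix.of z.1 *ᵥ z.2))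
    ((Kernel.const (Vec p) (Q.s S) x).prod (Q.d x)) := hi2
  rw [integral_map measurable_mulVec.aemeasurable hmv.aestronglyMeasurable, Kernel.prod_apply,
    integral_prod_symm _ hi2]
  simp only [Kernel.const_apply, fun z => (hu.s.integral_dotProduct S u z).2]
  have hS : ∀ z : Vec p, u ⬝ᵥ (Matrix.of S *ᵥ z) = ((Matrix.of S)ᵀ *ᵥ u) ⬝ᵥ z := fun z => by
    rw [dotProduct_mulVec, mulVec_transpose]
  simp only [hS]
  exact (hu.d.integral_dotProduct x _).2

/-- The covariance `S H Sᵀ` of the sketched data. -/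
noncomputable def sketchCov (D : DataModel p) (S : Sketch M p) : Matrix (Fin M) (Fin M) ℝ :=
  Matrix.of S * D.H * (Matrix.of S)ᵀ

theorem dotProduct_sketchCov (D : DataModel p) (S : Sketch M p) (u v : Vec M) :
    u ⬝ᵥ (sketchCov D S *ᵥ v) =
      ((Matrix.of S)ᵀ *ᵥ u) ⬝ᵥ (D.H *ᵥ ((Matrix.of S)ᵀ *ᵥ v)) := by
  rw [sketchCov, ← mulVec_mulVec, ← mulVec_mulVec, dotProduct_mulVec, ← mulVec_transpose]

theorem lintegral_quantFeatureLaw (D : DataModel p) (Q : Quantizers p M) (S : Sketch M p)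
    {g : Vec M → ℝ≥0∞} (hg : Measurable g) :
    ∫⁻ r, g r ∂(quantFeatureLaw D Q S) = ∫⁻ x, ∫⁻ r, g r ∂(quantFeature Q S x) ∂D.feature := by
  rw [quantFeatureLaw, Measure.lintegral_bind (Kernel.aemeasurable _) hg.aemeasurable]

/-- The quantized covariance dominates the covariance of the sketched data, and exceeds it by at
most the quantization errors. -/
theorem quadForm_Hf {D : DataModel p} {Q : Quantizers p M} {ε : ErrorLevels} (hM : 1 ≤ M)
    (hp : 1 ≤ p) (hu : Q.Unbiased) (ha : Q.Additive ε) {S : Sketch M p}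
    (hC : CovarianceCondition D Q S) (u : Vec M) :
    u ⬝ᵥ (sketchCov D S *ᵥ u) ≤ u ⬝ᵥ (Hf D Q S *ᵥ u) ∧
      u ⬝ᵥ (Hf D Q S *ᵥ u) ≤ u ⬝ᵥ (sketchCov D S *ᵥ u) +
        ε.d * (((Matrix.of S)ᵀ *ᵥ u) ⬝ᵥ ((Matrix.of S)ᵀ *ᵥ u)) +
        (ε.s * (D.H.trace + ε.d * p) + ε.f) * (u ⬝ᵥ u) := by
  have hf0 := ha.f.nonneg hM
  have hd0 := ha.d.nonneg hp
  have hs0 := ha.s.nonneg hM hp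
  have huu := dotProduct_self_nonneg' u
  have hvv := dotProduct_self_nonneg' ((Matrix.of S)ᵀ *ᵥ u)
  have hp0 : (0 : ℝ) ≤ p := Nat.cast_nonneg p
  obtain ⟨hq1, hq2⟩ := hC.quant.integral_sq u
  have hS : ∀ z : Vec p, u ⬝ᵥ (Matrix.of S *ᵥ z) = ((Matrix.of S)ᵀ *ᵥ u) ⬝ᵥ z := fun z => by
    rw [dotProduct_mulVec, mulVec_transpose]
  obtain ⟨hx1, hx2⟩ := hC.data.integral_sq ((Matrix.of S)ᵀ *ᵥ u)
  have hm : Measurable fun r : Vec M => ENNReal.ofReal ((u ⬝ᵥ r) ^ 2) :=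
    ((measurable_dotProduct_left u).pow_const 2).ennreal_ofReal
  have key : ENNReal.ofReal (u ⬝ᵥ (Hf D Q S *ᵥ u)) =
      ∫⁻ x, ∫⁻ r, ENNReal.ofReal ((u ⬝ᵥ r) ^ 2) ∂(quantFeature Q S x) ∂D.feature := by
    rw [← lintegral_quantFeatureLaw D Q S hm, Hf, ← hq2, ofReal_integral_eq_lintegral_ofReal hq1
      (Filter.Eventually.of_forall fun _ => sq_nonneg _)]
  have hG : u ⬝ᵥ (sketchCov D S *ᵥ u) =
      ∫ x, (((Matrix.of S)ᵀ *ᵥ u) ⬝ᵥ x) ^ 2 ∂D.feature := by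
    rw [dotProduct_sketchCov, hx2, DataModel.H]
  have htr : Integrable (fun x : Vec p => x ⬝ᵥ x) D.feature ∧
      ∫ x, x ⬝ᵥ x ∂D.feature = D.H.trace := by
    have h1 : ∀ i, Integrable (fun x : Vec p => x i * x i) D.feature := fun i => hC.data i i
    refine ⟨integrable_finsetSum _ fun i _ => h1 i, ?_⟩
    simp only [dotProduct]
    rw [integral_finsetSum _ fun i _ => h1 i]
    rfl
  have hG0 : 0 ≤ u ⬝ᵥ (sketchCov D S *ᵥ u) := by
    rw [hG]; exact integral_nonneg fun _ => sq_nonneg _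
  have hH0 : 0 ≤ u ⬝ᵥ (Hf D Q S *ᵥ u) := by
    rw [Hf, ← hq2]; exact integral_nonneg fun _ => sq_nonneg _
  have htr0 : 0 ≤ D.H.trace := by
    rw [← htr.2]; exact integral_nonneg fun _ => dotProduct_self_nonneg' _
  constructor
  · rw [← ENNReal.ofReal_le_ofReal_iff hH0, key, hG, ofReal_integral_eq_lintegral_ofReal hx1
      (Filter.Eventually.of_forall fun _ => sq_nonneg _)]
    refine lintegral_mono fun x => ?_
    rw [← hS]
    exact (lintegral_sq_quantFeature hM hp hu ha S x u).1
  · rw [← ENNReal.ofReal_le_ofReal_iff (by positivity), key]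
    have hb : Integrable (fun x : Vec p => (((Matrix.of S)ᵀ *ᵥ u) ⬝ᵥ x) ^ 2 +
          ε.d * (((Matrix.of S)ᵀ *ᵥ u) ⬝ᵥ ((Matrix.of S)ᵀ *ᵥ u)) +
          (ε.s * (x ⬝ᵥ x + ε.d * p) + ε.f) * (u ⬝ᵥ u)) D.feature :=
      (hx1.add (integrable_const _)).add
        ((((htr.1.add (integrable_const _)).const_mul _).add (integrable_const _)).mul_const _)
    calc _ ≤ ∫⁻ x, ENNReal.ofReal ((((Matrix.of S)ᵀ *ᵥ u) ⬝ᵥ x) ^ 2 +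
          ε.d * (((Matrix.of S)ᵀ *ᵥ u) ⬝ᵥ ((Matrix.of S)ᵀ *ᵥ u)) +
          (ε.s * (x ⬝ᵥ x + ε.d * p) + ε.f) * (u ⬝ᵥ u)) ∂D.feature := by
          refine lintegral_mono fun x => ?_
          rw [← hS]
          exact (lintegral_sq_quantFeature hM hp hu ha S x u).2
      _ = _ := by
          rw [← ofReal_integral_eq_lintegral_ofReal hb (Filter.Eventually.of_forall fun x => ?_)]
          · congr 1
            rw [hG, ← htr.2]
            obtain ⟨A, hA⟩ : ∃ A, A = ((Matrix.of S)ᵀ *ᵥ u) ⬝ᵥ ((Matrix.of S)ᵀ *ᵥ u) := ⟨_, rfl⟩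
            rw [← hA]
            have e : ∀ x : Vec p, (((Matrix.of S)ᵀ *ᵥ u) ⬝ᵥ x) ^ 2 + ε.d * A +
                (ε.s * (x ⬝ᵥ x + ε.d * p) + ε.f) * (u ⬝ᵥ u) =
                (((Matrix.of S)ᵀ *ᵥ u) ⬝ᵥ x) ^ 2 + (ε.s * (u ⬝ᵥ u) * (x ⬝ᵥ x) +
                  (ε.d * A + (ε.s * (ε.d * p) + ε.f) * (u ⬝ᵥ u))) := fun x => by ring
            have e1 : Integrable (fun x : Vec p => ε.s * (u ⬝ᵥ u) * (x ⬝ᵥ x)) D.feature :=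
              htr.1.const_mul _
            have e2 : Integrable (fun x : Vec p => ε.s * (u ⬝ᵥ u) * (x ⬝ᵥ x) +
              (ε.d * A + (ε.s * (ε.d * p) + ε.f) * (u ⬝ᵥ u))) D.feature :=
              e1.add (integrable_const _)
            simp_rw [e]
            rw [integral_add hx1 e2, integral_add e1 (integrable_const _), integral_const_mul]
            simp
            ring
          · have := dotProduct_self_nonneg' x
            positivity

end Feature

end QuantSGD

namespace QuantSGD

/-! ### The quantized sample -/

section Sample

variable {p M : ℕ}

theorem lintegral_quantSample (D : DataModel p) (Q : Quantizers p M) (S : Sketch M p) (w : Vec p)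
    {g : Vec M × ℝ → ℝ≥0∞} (hg : Measurable g) :
    ∫⁻ z, g z ∂(quantSample D Q S w) = ∫⁻ xy, ∫⁻ f, ∫⁻ b, g (f, b) ∂(Q.l xy.2)
      ∂(quantFeature Q S xy.1) ∂(D.sample w) := by
  rw [quantSample, Kernel.lintegral_comp _ _ _ hg]
  exact lintegral_congr fun xy => Kernel.lintegral_parallelComp _ hg

theorem lintegral_sample (D : DataModel p) (w : Vec p) {g : Vec p × ℝ → ℝ≥0∞} (hg : Measurable g) :
    ∫⁻ z, g z ∂(D.sample w) = ∫⁻ x, ∫⁻ y, g (x, y) ∂(D.label (w, x)) ∂D.feature := by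
  rw [DataModel.sample, Kernel.lintegral_compProd _ _ _ hg]
  rfl

theorem lintegral_fst_quantSample (D : DataModel p) (Q : Quantizers p M) (S : Sketch M p)
    (w : Vec p) {g : Vec M → ℝ≥0∞} (hg : Measurable g) :
    ∫⁻ z, g z.1 ∂(quantSample D Q S w) = ∫⁻ f, g f ∂(quantFeatureLaw D Q S) := by
  have h1 : Measurable fun x => ∫⁻ f, g f ∂(quantFeature Q S x) := hg.lintegral_kernel
  rw [lintegral_quantSample D Q S w (g := fun z => g z.1) (hg.comp measurable_fst),
    lintegral_quantFeatureLaw D Q S hg]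
  simp only [lintegral_const, measure_univ, mul_one]
  rw [lintegral_sample D w (g := fun xy => ∫⁻ f, g f ∂(quantFeature Q S xy.1))
    (h1.comp measurable_fst)]
  simp

theorem map_fst_quantSample (D : DataModel p) (Q : Quantizers p M) (S : Sketch M p) (w : Vec p) :
    (quantSample D Q S w).map Prod.fst = quantFeatureLaw D Q S := by
  refine Measure.ext_of_lintegral _ fun g hg => ?_
  rw [lintegral_map hg measurable_fst, lintegral_fst_quantSample D Q S w hg]

theorem integrable_fst_quantSample_iff {D : DataModel p} {Q : Quantizers p M} {S : Sketch M p}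
    {w : Vec p} {g : Vec M → ℝ} (hg : Measurable g) :
    Integrable (fun z => g z.1) (quantSample D Q S w) ↔ Integrable g (quantFeatureLaw D Q S) := by
  rw [← map_fst_quantSample D Q S w,
    integrable_map_measure hg.aestronglyMeasurable measurable_fst.aemeasurable]
  rfl

theorem integral_fst_quantSample (D : DataModel p) (Q : Quantizers p M) (S : Sketch M p)
    (w : Vec p) {g : Vec M → ℝ} (hg : Measurable g) :
    ∫ z, g z.1 ∂(quantSample D Q S w) = ∫ f, g f ∂(quantFeatureLaw D Q S) := by
  rw [← map_fst_quantSample D Q S w,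
    integral_map measurable_fst.aemeasurable hg.aestronglyMeasurable]

/-- `E[b ⟨u, f⟩ | w] = ⟨u, S H w⟩` for the quantized label `b` and feature `f`. -/
theorem integral_label_mul_feature {D : DataModel p} {Q : Quantizers p M} {ε : ErrorLevels}
    {σ : ℝ} (hM : 1 ≤ M) (hp : 1 ≤ p) (hu : Q.Unbiased) (ha : Q.Additive ε)
    (hW : D.WellSpecified σ) {S : Sketch M p} (hC : CovarianceCondition D Q S) :
    ∀ᵐ w ∂D.prior, ∀ u : Vec M,
      Integrable (fun z : Vec M × ℝ => z.2 * (u ⬝ᵥ z.1)) (quantSample D Q S w) →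
      ∫ z, z.2 * (u ⬝ᵥ z.1) ∂(quantSample D Q S w) = u ⬝ᵥ (Matrix.of S *ᵥ (D.H *ᵥ w)) := by
  have hmean := Measure.ae_ae_of_ae_prod hW.mean
  filter_upwards [hmean] with w hw u hi
  have hS : ∀ z : Vec p, u ⬝ᵥ (Matrix.of S *ᵥ z) = ((Matrix.of S)ᵀ *ᵥ u) ⬝ᵥ z := fun z => by
    rw [dotProduct_mulVec, mulVec_transpose]
  have hinner : ∀ xy : Vec p × ℝ, ∫ z, z.2 * (u ⬝ᵥ z.1) ∂((quantFeature Q S ∥ₖ Q.l) xy) =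
      xy.2 * (u ⬝ᵥ (Matrix.of S *ᵥ xy.1)) := by
    intro xy
    rw [Kernel.parallelComp_apply]
    simp_rw [mul_comm _ (u ⬝ᵥ _)]
    rw [integral_prod_mul (fun f : Vec M => u ⬝ᵥ f) (fun b : ℝ => b),
      integral_quantFeature hM hp hu ha, (hu.l xy.2).2]
  unfold quantSample at hi ⊢
  have hi2 := hi.integral_comp
  rw [Kernel.integral_comp hi]
  simp_rw [hinner] at hi2 ⊢
  unfold DataModel.sample at hi2 ⊢
  rw [ProbabilityTheory.integral_compProd hi2]
  simp only [Kernel.const_apply, integral_mul_const]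
  rw [hS, DataModel.H, ← (hC.data.integral_mul _ _).2]
  refine integral_congr_ae ?_
  filter_upwards [hw] with x hx
  rw [hx.2, hS, mul_comm, dotProduct_comm w x]

theorem memLp_two_dot_quantSample {D : DataModel p} {Q : Quantizers p M} {S : Sketch M p}
    (hC : CovarianceCondition D Q S) (w : Vec p) (u : Vec M) :
    MemLp (fun z : Vec M × ℝ => u ⬝ᵥ z.1) 2 (quantSample D Q S w) := by
  have hm : Measurable fun z : Vec M × ℝ => u ⬝ᵥ z.1 :=
    (measurable_dotProduct_left u).comp measurable_fst
  rw [memLp_two_iff_integrable_sq hm.aestronglyMeasurable]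
  exact (integrable_fst_quantSample_iff ((measurable_dotProduct_left u).pow_const 2)).mpr
    (hC.quant.integral_sq u).1

theorem integral_dot_mul_dot_quantSample {D : DataModel p} {Q : Quantizers p M} {S : Sketch M p}
    (hC : CovarianceCondition D Q S) (w : Vec p) (u v : Vec M) :
    ∫ z, (u ⬝ᵥ z.1) * (v ⬝ᵥ z.1) ∂(quantSample D Q S w) = u ⬝ᵥ (Hf D Q S *ᵥ v) := by
  rw [integral_fst_quantSample D Q S w (g := fun f => (u ⬝ᵥ f) * (v ⬝ᵥ f))
    ((measurable_dotProduct_left u).mul (measurable_dotProduct_left v)),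
    (hC.quant.integral_mul u v).2, Hf]

/-- No variance bound is imposed on the label quantizer. Square integrability of its output is read
off from finiteness of the risk at one vector `v`, writing the label as prediction minus residual.
-/
theorem memLp_two_label {D : DataModel p} {Q : Quantizers p M} {S : Sketch M p}
    (hC : CovarianceCondition D Q S) {w : Vec p} {v : Vec M} (hv : quantRisk D Q S w v ≠ ∞) :
    MemLp (fun z : Vec M × ℝ => z.2) 2 (quantSample D Q S w) := by
  have hm : Measurable fun z : Vec M × ℝ => v ⬝ᵥ z.1 - z.2 :=
    ((measurable_dotProduct_left v).comp measurable_fst).sub measurable_snd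
  have h1 : MemLp (fun z : Vec M × ℝ => v ⬝ᵥ z.1 - z.2) 2 (quantSample D Q S w) := by
    refine memLp_two_of_lintegral_ne_top hm ?_
    have e : ∀ z : Vec M × ℝ, ENNReal.ofReal ((v ⬝ᵥ z.1 - z.2) ^ 2) =
        2 * ENNReal.ofReal (1 / 2 * (z.1 ⬝ᵥ v - z.2) ^ 2) := by
      intro z
      rw [dotProduct_comm z.1, ← ENNReal.ofReal_ofNat 2, ← ENNReal.ofReal_mul (by norm_num)]
      congr 1; ring
    simp_rw [e]
    rw [lintegral_const_mul' _ _ (by simp)]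
    exact ENNReal.mul_ne_top (by simp) hv
  have h2 := (memLp_two_dot_quantSample hC w v).sub h1
  refine h2.ae_eq (Filter.Eventually.of_forall fun z => ?_)
  simp

theorem eq_zero_of_forall_quadratic_nonneg {c d : ℝ} (h : ∀ t : ℝ, 0 ≤ t * c + t ^ 2 * d) :
    c = 0 := by
  by_contra hc
  -- At this `t` the linear term outweighs the quadratic one, whatever the sign of `d`.
  have h1 := h (-c / (|d| + 1))
  have hd : 0 < |d| + 1 := by positivity
  have h2 : -c / (|d| + 1) * c + (-c / (|d| + 1)) ^ 2 * d =
      -(c ^ 2 / (|d| + 1) ^ 2) * (|d| + 1 - d) := by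
    field_simp
    ring
  rw [h2] at h1
  have h3 : 0 < c ^ 2 / (|d| + 1) ^ 2 := by positivity
  have h4 : 0 < |d| + 1 - d := by linarith [le_abs_self d]
  nlinarith [mul_pos h3 h4]

/-- First-order optimality of a minimizer of the quantized risk. -/
theorem IsQuantOptimum.integral_eq {D : DataModel p} {Q : Quantizers p M} {S : Sketch M p}
    (hC : CovarianceCondition D Q S) {w : Vec p} {v : Vec M} (h : IsQuantOptimum D Q S w v)
    (u : Vec M) :
    ∫ z, z.2 * (u ⬝ᵥ z.1) ∂(quantSample D Q S w) = u ⬝ᵥ (Hf D Q S *ᵥ v) := by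
  have hb := memLp_two_label hC h.1
  have hf := fun u => memLp_two_dot_quantSample hC w u
  have hr : ∀ v, MemLp (fun z : Vec M × ℝ => v ⬝ᵥ z.1 - z.2) 2 (quantSample D Q S w) :=
    fun v => (hf v).sub hb
  have hrisk : ∀ v, quantRisk D Q S w v =
      ENNReal.ofReal (∫ z, 1 / 2 * (v ⬝ᵥ z.1 - z.2) ^ 2 ∂(quantSample D Q S w)) := by
    intro v
    rw [ofReal_integral_eq_lintegral_ofReal ((hr v).integrable_sq.const_mul _)
      (Filter.Eventually.of_forall fun z => by simp only [Pi.zero_apply]; positivity)]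
    unfold quantRisk
    simp_rw [dotProduct_comm _ v]
  have hexp : ∀ t : ℝ, ∫ z, 1 / 2 * ((v + t • u) ⬝ᵥ z.1 - z.2) ^ 2 ∂(quantSample D Q S w) =
      ∫ z, 1 / 2 * (v ⬝ᵥ z.1 - z.2) ^ 2 ∂(quantSample D Q S w) +
        (t * ∫ z, (v ⬝ᵥ z.1 - z.2) * (u ⬝ᵥ z.1) ∂(quantSample D Q S w) +
          t ^ 2 * ∫ z, 1 / 2 * (u ⬝ᵥ z.1) ^ 2 ∂(quantSample D Q S w)) := by
    intro t
    have i1 : Integrable (fun z : Vec M × ℝ => 1 / 2 * (v ⬝ᵥ z.1 - z.2) ^ 2)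
      (quantSample D Q S w) := (hr v).integrable_sq.const_mul _
    have i2 : Integrable (fun z : Vec M × ℝ => t * ((v ⬝ᵥ z.1 - z.2) * (u ⬝ᵥ z.1)))
      (quantSample D Q S w) := ((hr v).integrable_mul (hf u)).const_mul t
    have i3 : Integrable (fun z : Vec M × ℝ => t ^ 2 * (1 / 2 * (u ⬝ᵥ z.1) ^ 2))
      (quantSample D Q S w) := ((hf u).integrable_sq.const_mul _).const_mul _
    have i4 : Integrable (fun z : Vec M × ℝ => t * ((v ⬝ᵥ z.1 - z.2) * (u ⬝ᵥ z.1)) +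
      t ^ 2 * (1 / 2 * (u ⬝ᵥ z.1) ^ 2)) (quantSample D Q S w) := i2.add i3
    have e : ∀ z : Vec M × ℝ, 1 / 2 * ((v + t • u) ⬝ᵥ z.1 - z.2) ^ 2 =
        1 / 2 * (v ⬝ᵥ z.1 - z.2) ^ 2 + (t * ((v ⬝ᵥ z.1 - z.2) * (u ⬝ᵥ z.1)) +
          t ^ 2 * (1 / 2 * (u ⬝ᵥ z.1) ^ 2)) := by
      intro z
      rw [add_dotProduct, smul_dotProduct, smul_eq_mul]
      ring
    simp_rw [e]
    rw [integral_add i1 i4, integral_add i2 i3, integral_const_mul t, integral_const_mul (t ^ 2)]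
  have hc : ∫ z, (v ⬝ᵥ z.1 - z.2) * (u ⬝ᵥ z.1) ∂(quantSample D Q S w) = 0 := by
    refine eq_zero_of_forall_quadratic_nonneg
      (d := ∫ z, 1 / 2 * (u ⬝ᵥ z.1) ^ 2 ∂(quantSample D Q S w)) fun t => ?_
    have ht := h.2 (v + t • u)
    rw [hrisk, hrisk, ENNReal.ofReal_le_ofReal_iff (integral_nonneg fun z => by positivity),
      hexp] at ht
    linarith
  have hsub : ∀ z : Vec M × ℝ, (v ⬝ᵥ z.1 - z.2) * (u ⬝ᵥ z.1) =
      (u ⬝ᵥ z.1) * (v ⬝ᵥ z.1) - z.2 * (u ⬝ᵥ z.1) := fun z => by ring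
  have j1 : Integrable (fun z : Vec M × ℝ => (u ⬝ᵥ z.1) * (v ⬝ᵥ z.1)) (quantSample D Q S w) :=
    (hf u).integrable_mul (hf v)
  have j2 : Integrable (fun z : Vec M × ℝ => z.2 * (u ⬝ᵥ z.1)) (quantSample D Q S w) :=
    hb.integrable_mul (hf u)
  simp_rw [hsub] at hc
  rw [integral_sub j1 j2, integral_dot_mul_dot_quantSample hC] at hc
  linarith

end Sample

end QuantSGD

namespace QuantSGD

/-! ### Fourth moments of the quantized feature -/

section Fourth

variable {p M : ℕ}

theorem integrable_mul_four {μ : Measure (Vec M)} (h : ∀ i, Integrable (fun z : Vec M => z i ^ 4) μ)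
    (i j k l : Fin M) : Integrable (fun z : Vec M => z k * z l * (z i * z j)) μ := by
  refine (((h i).add (h j)).add ((h k).add (h l))).mono' (by fun_prop)
    (Filter.Eventually.of_forall fun z => ?_)
  simp only [Pi.add_apply, Real.norm_eq_abs]
  rw [abs_le]
  constructor <;>
  nlinarith [sq_nonneg (z i ^ 2 - z j ^ 2), sq_nonneg (z k ^ 2 - z l ^ 2),
    sq_nonneg (z k * z l - z i * z j), sq_nonneg (z k * z l + z i * z j),
    sq_nonneg (z i ^ 2 + z j ^ 2), sq_nonneg (z k ^ 2 + z l ^ 2), sq_nonneg (z i ^ 2),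
    sq_nonneg (z j ^ 2), sq_nonneg (z k ^ 2), sq_nonneg (z l ^ 2)]

theorem quadForm_fourthMoment {μ : Measure (Vec M)}
    (h : ∀ i, Integrable (fun z : Vec M => z i ^ 4) μ) (A : Matrix (Fin M) (Fin M) ℝ) (u : Vec M) :
    Integrable (fun z => (z ⬝ᵥ (A *ᵥ z)) * (u ⬝ᵥ z) ^ 2) μ ∧
      ∫ z, (z ⬝ᵥ (A *ᵥ z)) * (u ⬝ᵥ z) ^ 2 ∂μ = u ⬝ᵥ (fourthMoment μ A *ᵥ u) := by
  have hint : ∀ i j, Integrable (fun z : Vec M => (z ⬝ᵥ (A *ᵥ z)) * (z i * z j)) μ := by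
    intro i j
    have e : ∀ z : Vec M, (z ⬝ᵥ (A *ᵥ z)) * (z i * z j) =
        ∑ k, ∑ l, A k l * (z k * z l * (z i * z j)) := by
      intro z
      simp only [dotProduct, mulVec, Finset.mul_sum, Finset.sum_mul]
      exact Finset.sum_congr rfl fun k _ => Finset.sum_congr rfl fun l _ => by ring
    simp_rw [e]
    exact integrable_finsetSum _ fun k _ => integrable_finsetSum _ fun l _ =>
      (integrable_mul_four h i j k l).const_mul _
  have := integral_mul_dotProduct_mul_dotProduct (μ := μ) (g := fun z => z ⬝ᵥ (A *ᵥ z))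
    (φ := fun z => z) hint u u
  simp only [← pow_two] at this
  exact this

/-- The choice `A = y yᵀ`. It controls how the current error feeds back into the gradient variance.
-/
theorem FourthMomentCondition.sq_mul_sq {D : DataModel p} {Q : Quantizers p M} {S : Sketch M p}
    {α β : ℝ} (h : FourthMomentCondition D Q S α β) (y u : Vec M) :
    Integrable (fun z => (y ⬝ᵥ z) ^ 2 * (u ⬝ᵥ z) ^ 2) (quantFeatureLaw D Q S) ∧
      ∫ z, (y ⬝ᵥ z) ^ 2 * (u ⬝ᵥ z) ^ 2 ∂(quantFeatureLaw D Q S) ≤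
        α * (y ⬝ᵥ (Hf D Q S *ᵥ y)) * (u ⬝ᵥ (Hf D Q S *ᵥ u)) := by
  have hP : (vecMulVec y y).PosSemidef := by
    simpa using Matrix.posSemidef_vecMulVec_self_star y
  have e : ∀ z : Vec M, z ⬝ᵥ (vecMulVec y y *ᵥ z) = (y ⬝ᵥ z) ^ 2 := by
    intro z
    rw [vecMulVec_mulVec]
    simp [pow_two, dotProduct_comm]
  have hq := quadForm_fourthMoment h.finite (vecMulVec y y) u
  simp_rw [e] at hq
  refine ⟨hq.1, hq.2.trans_le ((dotProduct_mulVec_le_of_le (h.upper _ hP) u).trans_eq ?_)⟩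
  rw [smul_mulVec, dotProduct_smul, smul_eq_mul, mul_vecMulVec, trace_vecMulVec,
    dotProduct_comm y]

/-- The choice `A = I`. It controls the parameter quantization, whose variance along the feature `z`
is at most `ε_p |z|²`. -/
theorem FourthMomentCondition.self_mul_sq {D : DataModel p} {Q : Quantizers p M} {S : Sketch M p}
    {α β : ℝ} (h : FourthMomentCondition D Q S α β) (u : Vec M) :
    Integrable (fun z => (z ⬝ᵥ z) * (u ⬝ᵥ z) ^ 2) (quantFeatureLaw D Q S) ∧
      ∫ z, (z ⬝ᵥ z) * (u ⬝ᵥ z) ^ 2 ∂(quantFeatureLaw D Q S) ≤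
        α * (Hf D Q S).trace * (u ⬝ᵥ (Hf D Q S *ᵥ u)) := by
  have hq := quadForm_fourthMoment h.finite 1 u
  simp_rw [one_mulVec] at hq
  refine ⟨hq.1, hq.2.trans_le
    ((dotProduct_mulVec_le_of_le (h.upper _ PosSemidef.one) u).trans_eq ?_)⟩
  rw [smul_mulVec, dotProduct_smul, smul_eq_mul, mul_one]

end Fourth

/-! ### One step of quantized SGD -/

section Step

variable {p M : ℕ}

theorem AdditiveVec.lintegral_sub_sq {n : ℕ} {Q : Kernel (Vec n) (Vec n)} [IsMarkovKernel Q]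
    {ε : ℝ} (h : AdditiveVec Q ε) (hu : UnbiasedVec Q) (y u : Vec n) (c : ℝ) :
    ∫⁻ r, ENNReal.ofReal ((c - u ⬝ᵥ r) ^ 2) ∂(Q y) ≤
      ENNReal.ofReal ((c - u ⬝ᵥ y) ^ 2 + ε * (u ⬝ᵥ u)) := by
  obtain ⟨h1, h2⟩ := hu.integral_dotProduct y u
  obtain ⟨h3, h4⟩ := h.integral_dotProduct_sub_sq y u
  have hi : Integrable (fun r => c - u ⬝ᵥ r) (Q y) := (integrable_const c).sub h1
  have hm : ∫ r, (c - u ⬝ᵥ r) ∂(Q y) = c - u ⬝ᵥ y := by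
    rw [integral_sub (integrable_const c) h1, h2]
    simp
  have e : ∀ r, (c - u ⬝ᵥ r - (c - u ⬝ᵥ y)) ^ 2 = (u ⬝ᵥ r - u ⬝ᵥ y) ^ 2 := fun r => by ring
  rw [lintegral_sq_eq_of_mean hi hm (by simp_rw [e]; exact h3)]
  simp_rw [e]
  exact ENNReal.ofReal_le_ofReal (by linarith)

theorem lintegral_stepDraw (D : DataModel p) (Q : Quantizers p M) (S : Sketch M p)
    (wv : Vec p × Vec M) {G : (((Vec M × ℝ) × Vec M) × ℝ) × ℝ → ℝ≥0∞} (hG : Measurable G) :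
    ∫⁻ r, G r ∂(stepDraw D Q S wv) =
      ∫⁻ fb, ∫⁻ v', ∫⁻ act, ∫⁻ g, G (((fb, v'), act), g) ∂(Q.o (fb.2 - act))
        ∂(Q.a (fb.1 ⬝ᵥ v')) ∂(Q.p wv.2) ∂(quantSample D Q S wv.1) := by
  have h1 : Measurable fun z : (Vec p × Vec M) × (((Vec M × ℝ) × Vec M) × ℝ) =>
      z.2.1.1.2 - z.2.2 := by fun_prop
  have hm2 : Measurable fun z : (Vec p × Vec M) × ((Vec M × ℝ) × Vec M) => z.2.1.1 ⬝ᵥ z.2.2 :=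
    measurable_dot.comp (by fun_prop : Measurable
        fun z : (Vec p × Vec M) × ((Vec M × ℝ) × Vec M) => (z.2.1.1, z.2.2))
  have hI : Measurable fun z : ((Vec M × ℝ) × Vec M) × ℝ =>
      ∫⁻ g, G (z, g) ∂(Q.o (z.1.1.2 - z.2)) := by
    have := Measurable.lintegral_kernel_prod_right' (κ := Q.o.comap
      (fun z : ((Vec M × ℝ) × Vec M) × ℝ => z.1.1.2 - z.2) (by fun_prop)) hG
    exact this
  have hJ : Measurable fun z : (Vec M × ℝ) × Vec M =>
      ∫⁻ act, ∫⁻ g, G ((z, act), g) ∂(Q.o (z.1.2 - act)) ∂(Q.a (z.1.1 ⬝ᵥ z.2)) := by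
    have := Measurable.lintegral_kernel_prod_right' (κ := Q.a.comap
      (fun z : (Vec M × ℝ) × Vec M => z.1.1 ⬝ᵥ z.2)
      (measurable_dot.comp (f := fun z : (Vec M × ℝ) × Vec M => (z.1.1, z.2)) (by fun_prop))) hI
    exact this
  rw [stepDraw, Kernel.lintegral_compProd _ _ _ hG]
  simp only [Kernel.comap_apply]
  rw [Kernel.lintegral_compProd _ _ _ hI]
  exact Kernel.lintegral_prod _ _ _ hJ

/-- Second moment of the stochastic gradient in the direction `u`. -/
theorem lintegral_gradient_sq_le {D : DataModel p} {Q : Quantizers p M} {ε : ErrorLevels}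
    (hM : 1 ≤ M) (hu : Q.Unbiased) (ha : Q.Additive ε) (S : Sketch M p) (w : Vec p) (v u : Vec M) :
    ∫⁻ r, ENNReal.ofReal ((r.2 * (u ⬝ᵥ r.1.1.1.1)) ^ 2) ∂(stepDraw D Q S (w, v)) ≤
      ∫⁻ z, ENNReal.ofReal (((z.2 - z.1 ⬝ᵥ v) ^ 2 + ε.p * (z.1 ⬝ᵥ z.1) + ε.a + ε.o) *
        (u ⬝ᵥ z.1) ^ 2) ∂(quantSample D Q S w) := by
  have ha0 := ha.a.nonneg
  have ho0 := ha.o.nonneg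
  have hmu : Measurable fun r : (((Vec M × ℝ) × Vec M) × ℝ) × ℝ => u ⬝ᵥ r.1.1.1.1 :=
    (measurable_dotProduct_left u).comp (by fun_prop)
  have hmg : Measurable fun r : (((Vec M × ℝ) × Vec M) × ℝ) × ℝ =>
      ENNReal.ofReal ((r.2 * (u ⬝ᵥ r.1.1.1.1)) ^ 2) :=
    ((measurable_snd.mul hmu).pow_const 2).ennreal_ofReal
  rw [lintegral_stepDraw D Q S (w, v) hmg]
  refine lintegral_mono fun z => ?_
  obtain ⟨f, b⟩ := z
  simp only
  have c0 : 0 ≤ (u ⬝ᵥ f) ^ 2 := sq_nonneg _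
  have hmul : ∀ x : ℝ, ENNReal.ofReal ((x * (u ⬝ᵥ f)) ^ 2) =
      ENNReal.ofReal ((u ⬝ᵥ f) ^ 2) * ENNReal.ofReal (x ^ 2) := fun x => by
    rw [← ENNReal.ofReal_mul c0, mul_pow, mul_comm]
  -- Integration proceeds from the innermost quantizer outwards. Each stage is unbiased, so it
  -- merely adds its variance: `ε.o`, then `ε.a`, then `ε.p |f|²`.
  have h1 : ∀ act : ℝ, ∫⁻ g, ENNReal.ofReal ((g * (u ⬝ᵥ f)) ^ 2) ∂(Q.o (b - act)) ≤
      ENNReal.ofReal ((u ⬝ᵥ f) ^ 2) *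
        (ENNReal.ofReal ((b - act) ^ 2) + ENNReal.ofReal ε.o) := by
    intro act
    simp_rw [hmul]
    rw [lintegral_const_mul' _ _ ENNReal.ofReal_ne_top]
    gcongr
    have := ha.o.lintegral_sq hu.o (b - act) 0
    simp only [zero_sub, neg_sq] at this
    rwa [ENNReal.ofReal_add (sq_nonneg _) ho0] at this
  have h2 : ∀ v' : Vec M, ∫⁻ act, ∫⁻ g, ENNReal.ofReal ((g * (u ⬝ᵥ f)) ^ 2) ∂(Q.o (b - act))
      ∂(Q.a (f ⬝ᵥ v')) ≤ ENNReal.ofReal ((u ⬝ᵥ f) ^ 2) *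
        (ENNReal.ofReal ((b - f ⬝ᵥ v') ^ 2) + ENNReal.ofReal (ε.a + ε.o)) := by
    intro v'
    refine (lintegral_mono h1).trans ?_
    rw [lintegral_const_mul' _ _ ENNReal.ofReal_ne_top]
    gcongr
    rw [lintegral_add_right _ measurable_const, lintegral_const, measure_univ, mul_one,
      ENNReal.ofReal_add ha0 ho0, ← add_assoc, ← ENNReal.ofReal_add (sq_nonneg _) ha0]
    gcongr
    exact ha.a.lintegral_sq hu.a _ b
  refine (lintegral_mono h2).trans ?_
  rw [lintegral_const_mul' _ _ ENNReal.ofReal_ne_top, lintegral_add_right _ measurable_const,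
    lintegral_const, measure_univ, mul_one, mul_comm _ ((u ⬝ᵥ f) ^ 2), ENNReal.ofReal_mul c0]
  gcongr
  refine (add_le_add_left (ha.p.lintegral_sub_sq hu.p v f b) _).trans ?_
  rw [← ENNReal.ofReal_add (add_nonneg (sq_nonneg _)
    (mul_nonneg (ha.p.nonneg hM) (dotProduct_self_nonneg' f))) (add_nonneg ha0 ho0)]
  exact ENNReal.ofReal_le_ofReal (by linarith)

/-- Mean of the stochastic gradient in the direction `u`. -/
theorem integral_gradient {D : DataModel p} {Q : Quantizers p M}
    (hu : Q.Unbiased) (S : Sketch M p) (w : Vec p) (v u : Vec M)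
    (hi : Integrable (fun r : (((Vec M × ℝ) × Vec M) × ℝ) × ℝ => r.2 * (u ⬝ᵥ r.1.1.1.1))
      (stepDraw D Q S (w, v))) :
    ∫ r, r.2 * (u ⬝ᵥ r.1.1.1.1) ∂(stepDraw D Q S (w, v)) =
      ∫ z, (z.2 - z.1 ⬝ᵥ v) * (u ⬝ᵥ z.1) ∂(quantSample D Q S w) := by
  unfold stepDraw at hi ⊢
  have hi2 := hi.integral_compProd
  rw [ProbabilityTheory.integral_compProd hi]
  simp only [Kernel.comap_apply, integral_mul_const, (hu.o _).2] at hi2 ⊢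
  have hi3 := hi2.integral_compProd
  rw [ProbabilityTheory.integral_compProd hi2]
  have e1 : ∀ (c d : ℝ) (y : ℝ), ∫ act, (c - act) * d ∂(Q.a y) = (c - y) * d := by
    intro c d y
    rw [integral_mul_const, integral_sub (integrable_const c) (hu.a y).1, (hu.a y).2]
    simp
  simp only [Kernel.comap_apply, e1] at hi3 ⊢
  rw [Kernel.prod_apply] at hi3 ⊢
  rw [integral_prod _ hi3]
  refine integral_congr_ae (Filter.Eventually.of_forall fun z => ?_)
  simp only [Kernel.comap_apply, integral_mul_const]
  congr 1
  obtain ⟨j1, j2⟩ := hu.p.integral_dotProduct v z.1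
  rw [integral_sub (integrable_const _) j1, j2]
  simp

end Step

end QuantSGD

namespace QuantSGD

/-! ### Joint diagonalization of commuting symmetric matrices -/

/-- `e` is an orthonormal basis. -/
structure Frame {n : ℕ} (e : Fin n → Vec n) : Prop where
  orth : ∀ i j, e i ⬝ᵥ e j = if i = j then 1 else 0
  dot : ∀ u v : Vec n, u ⬝ᵥ v = ∑ i, (e i ⬝ᵥ u) * (e i ⬝ᵥ v)

/-- The matrix `A` acts diagonally on the orthonormal basis `e`, with eigenvalues `h`. -/
def Diagonal {n : ℕ} (e : Fin n → Vec n) (h : Fin n → ℝ) (A : Matrix (Fin n) (Fin n) ℝ) : Prop :=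
  ∀ u v : Vec n, u ⬝ᵥ (A *ᵥ v) = ∑ i, h i * ((e i ⬝ᵥ u) * (e i ⬝ᵥ v))

theorem Frame.of_orthonormalBasis {n : ℕ}
    (b : OrthonormalBasis (Fin n) ℝ (EuclideanSpace ℝ (Fin n))) :
    Frame fun i => WithLp.ofLp (b i) where
  orth i j := by
    have := orthonormal_iff_ite.mp b.orthonormal i j
    rw [EuclideanSpace.inner_eq_star_dotProduct, star_trivial, dotProduct_comm] at this
    exact this
  dot u v := by
    have := b.sum_inner_mul_inner (WithLp.toLp 2 u) (WithLp.toLp 2 v)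
    simp only [EuclideanSpace.inner_eq_star_dotProduct, star_trivial] at this
    rw [dotProduct_comm, ← this]
    exact Finset.sum_congr rfl fun i _ => by rw [dotProduct_comm v]

theorem Frame.diagonal_of_mulVec {n : ℕ} {e : Fin n → Vec n} (he : Frame e) {h : Fin n → ℝ}
    {A : Matrix (Fin n) (Fin n) ℝ} (hA : A.IsHermitian) (hh : ∀ i, A *ᵥ e i = h i • e i) :
    Diagonal e h A := by
  intro u v
  rw [he.dot u]
  refine Finset.sum_congr rfl fun i _ => ?_
  have hT : Aᵀ = A := by
    have := hA.eq
    rwa [conjTranspose_eq_transpose_of_trivial] at this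
  have : e i ⬝ᵥ (A *ᵥ v) = h i * (e i ⬝ᵥ v) := by
    rw [dotProduct_mulVec, ← mulVec_transpose, hT, hh, smul_dotProduct, smul_eq_mul]
  rw [this]
  ring

/-- Commuting symmetric operators split the space orthogonally into joint eigenspaces, and an
orthonormal basis is chosen inside these. -/
theorem exists_frame_of_commute {n : ℕ} {A B : Matrix (Fin n) (Fin n) ℝ} (hA : A.IsHermitian)
    (hB : B.IsHermitian) (hAB : Commute A B) :
    ∃ (e : Fin n → Vec n) (h g : Fin n → ℝ), Frame e ∧ Diagonal e h A ∧ Diagonal e g B := by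
  classical
  have hAs := Matrix.isSymmetric_toEuclideanLin_iff.mpr hA
  have hBs := Matrix.isSymmetric_toEuclideanLin_iff.mpr hB
  have hc : Commute (Matrix.toEuclideanLin A) (Matrix.toEuclideanLin B) := by
    unfold Commute SemiconjBy
    have h1 := Matrix.toLpLin_mul_same 2 A B
    have h2 := Matrix.toLpLin_mul_same 2 B A
    rw [hAB.eq] at h1
    exact h1.symm.trans h2
  have hint := LinearMap.IsSymmetric.directSum_isInternal_of_commute hAs hBs hc
  have hort := LinearMap.IsSymmetric.orthogonalFamily_eigenspace_inf_eigenspace hAs hBs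
  have hint' := DirectSum.isInternal_ne_bot_iff.mpr hint
  let _ := iSupIndep.fintypeNeBotOfFiniteDimensional hint.submodule_iSupIndep
  have hort' := hort.comp (γ := {i : ℝ × ℝ // Module.End.eigenspace (Matrix.toEuclideanLin A) i.2 ⊓
    Module.End.eigenspace (Matrix.toEuclideanLin B) i.1 ≠ ⊥}) Subtype.val_injective
  have hn : Module.finrank ℝ (EuclideanSpace ℝ (Fin n)) = n := finrank_euclideanSpace_fin
  set b := hint'.subordinateOrthonormalBasis hn hort' with hb
  have hmem := fun i => hint'.subordinateOrthonormalBasis_subordinate hn i hort'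
  have hF := Frame.of_orthonormalBasis b
  -- Joint eigenspaces are indexed by pairs whose second entry is the eigenvalue of `A` and whose
  -- first is that of `B`.
  refine ⟨_, fun i => (hint'.subordinateOrthonormalBasisIndex hn i hort').1.2,
    fun i => (hint'.subordinateOrthonormalBasisIndex hn i hort').1.1, hF,
    hF.diagonal_of_mulVec hA fun i => ?_, hF.diagonal_of_mulVec hB fun i => ?_⟩
  · have := Module.End.mem_eigenspace_iff.mp (Submodule.mem_inf.mp (hmem i)).1
    simpa using congrArg WithLp.ofLp this
  · have := Module.End.mem_eigenspace_iff.mp (Submodule.mem_inf.mp (hmem i)).2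
    simpa using congrArg WithLp.ofLp this

theorem Frame.dot_sum {n : ℕ} {e : Fin n → Vec n} (he : Frame e) (c : Fin n → ℝ) (j : Fin n) :
    e j ⬝ᵥ (∑ i, c i • e i) = c j := by
  simp [dotProduct_sum, he.orth]

theorem Diagonal.apply_self {n : ℕ} {e : Fin n → Vec n} (he : Frame e) {h : Fin n → ℝ}
    {A : Matrix (Fin n) (Fin n) ℝ} (hA : Diagonal e h A) (i : Fin n) :
    e i ⬝ᵥ (A *ᵥ e i) = h i := by
  rw [hA]
  simp [he.orth]

theorem Diagonal.trace_eq {n : ℕ} {e : Fin n → Vec n} (he : Frame e) {h : Fin n → ℝ}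
    {A : Matrix (Fin n) (Fin n) ℝ} (hA : Diagonal e h A) : A.trace = ∑ i, h i := by
  have h1 : ∀ k, A k k = ∑ i, h i * (e i k * e i k) := by
    intro k
    have := hA (Pi.single k 1) (Pi.single k 1)
    simpa using this
  have h2 : ∀ i, ∑ k, e i k * e i k = 1 := fun i => by
    have := he.orth i i
    simpa [dotProduct] using this
  simp only [Matrix.trace, Matrix.diag_apply, h1]
  rw [Finset.sum_comm]
  exact Finset.sum_congr rfl fun i _ => by rw [← Finset.mul_sum, h2, mul_one]

end QuantSGD

namespace QuantSGD

/-! ### The optimum in the quantized feature space -/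

section Setting

variable {p M : ℕ}

/-- The assumptions on the model, the quantizers and the sketch, with a joint eigenbasis `e` of
`H_f` (eigenvalues `h`) and `S H Sᵀ` (eigenvalues `g`). -/
structure Setting (D : DataModel p) (Q : Quantizers p M) (ε : ErrorLevels) (S : Sketch M p)
    (α β σ σmin σmax : ℝ) (e : Fin M → Vec M) (h g : Fin M → ℝ) : Prop where
  one_le_M : 1 ≤ M
  one_le_p : 1 ≤ p
  unbiased : Q.Unbiased
  additive : Q.Additive ε
  wellSpecified : D.WellSpecified σ
  isotropic : D.IsotropicPrior
  cov : CovarianceCondition D Q S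
  fourth : FourthMomentCondition D Q S α β
  noise : NoiseCondition D Q S σmin σmax
  alpha_pos : 0 < α
  beta_pos : 0 < β
  frame : Frame e
  diag_h : Diagonal e h (Hf D Q S)
  diag_g : Diagonal e g (sketchCov D S)

/-- The vector `S H w`, the covariance of feature and response. -/
noncomputable def crossCov (D : DataModel p) (S : Sketch M p) (w : Vec p) : Vec M :=
  Matrix.of S *ᵥ (D.H *ᵥ w)

/-- The minimum norm minimizer of the quantized risk, in the eigenbasis `e`. -/
noncomputable def optVec (D : DataModel p) (S : Sketch M p) (e : Fin M → Vec M) (h : Fin M → ℝ)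
    (w : Vec p) : Vec M :=
  ∑ i, ((h i)⁻¹ * (e i ⬝ᵥ crossCov D S w)) • e i

theorem measurable_crossCov (D : DataModel p) (S : Sketch M p) (u : Vec M) :
    Measurable fun w => u ⬝ᵥ crossCov D S w := by
  simp only [crossCov, dotProduct, mulVec]
  fun_prop

theorem measurable_optVec (D : DataModel p) (S : Sketch M p) (e : Fin M → Vec M) (h : Fin M → ℝ) :
    Measurable (optVec D S e h) := by
  refine measurable_pi_lambda _ fun k => ?_
  simp only [optVec, Finset.sum_apply, Pi.smul_apply, smul_eq_mul]
  exact Finset.measurable_sum _ fun i _ =>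
    ((measurable_crossCov D S (e i)).const_mul _).mul_const _

namespace Setting

variable {D : DataModel p} {Q : Quantizers p M} {ε : ErrorLevels} {S : Sketch M p}
  {α β σ σmin σmax : ℝ} {e : Fin M → Vec M} {h g : Fin M → ℝ}

theorem g_nonneg (X : Setting D Q ε S α β σ σmin σmax e h g) (i : Fin M) : 0 ≤ g i := by
  rw [← X.diag_g.apply_self X.frame, dotProduct_sketchCov]
  have := X.cov.posDef.posSemidef.dotProduct_mulVec_nonneg ((Matrix.of S)ᵀ *ᵥ e i)
  simpa using this

theorem g_le_h (X : Setting D Q ε S α β σ σmin σmax e h g) (i : Fin M) : g i ≤ h i := by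
  rw [← X.diag_g.apply_self X.frame, ← X.diag_h.apply_self X.frame]
  exact (quadForm_Hf X.one_le_M X.one_le_p X.unbiased X.additive X.cov (e i)).1

theorem h_nonneg (X : Setting D Q ε S α β σ σmin σmax e h g) (i : Fin M) : 0 ≤ h i :=
  (X.g_nonneg i).trans (X.g_le_h i)

/-- `0 ≤ g i ≤ h i = 0` forces the quadratic form of `H` to vanish at `Sᵀ e_i`, so `H Sᵀ e_i = 0`.
This makes the convention `0⁻¹ = 0` in `optVec` harmless: the normal equations hold in degenerate
directions too. -/
theorem dot_crossCov_eq_zero (X : Setting D Q ε S α β σ σmin σmax e h g) {i : Fin M}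
    (hi : h i = 0) (w : Vec p) : e i ⬝ᵥ crossCov D S w = 0 := by
  have hg : g i = 0 := le_antisymm (hi ▸ X.g_le_h i) (X.g_nonneg i)
  rw [← X.diag_g.apply_self X.frame, dotProduct_sketchCov] at hg
  have h0 := (X.cov.posDef.posSemidef.dotProduct_mulVec_zero_iff ((Matrix.of S)ᵀ *ᵥ e i)).mp
    (by simpa using hg)
  have hH : D.Hᵀ = D.H := by
    have := X.cov.posDef.isHermitian.eq
    rwa [conjTranspose_eq_transpose_of_trivial] at this
  rw [crossCov, dotProduct_mulVec, ← mulVec_transpose, dotProduct_mulVec, ← mulVec_transpose, hH,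
    h0, zero_dotProduct]

theorem dot_optVec (X : Setting D Q ε S α β σ σmin σmax e h g) (i : Fin M) (w : Vec p) :
    e i ⬝ᵥ optVec D S e h w = (h i)⁻¹ * (e i ⬝ᵥ crossCov D S w) :=
  X.frame.dot_sum _ i

theorem mul_dot_optVec (X : Setting D Q ε S α β σ σmin σmax e h g) (i : Fin M) (w : Vec p) :
    h i * (e i ⬝ᵥ optVec D S e h w) = e i ⬝ᵥ crossCov D S w := by
  rw [X.dot_optVec]
  by_cases hi : h i = 0
  · rw [hi, X.dot_crossCov_eq_zero hi, zero_mul]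
  · field_simp

theorem Hf_optVec (X : Setting D Q ε S α β σ σmin σmax e h g) (u : Vec M) (w : Vec p) :
    u ⬝ᵥ (Hf D Q S *ᵥ optVec D S e h w) = u ⬝ᵥ crossCov D S w := by
  rw [X.diag_h, X.frame.dot u]
  exact Finset.sum_congr rfl fun i _ => by rw [← X.mul_dot_optVec i w]; ring

theorem ae_integral_label (X : Setting D Q ε S α β σ σmin σmax e h g) :
    ∀ᵐ w ∂D.prior, MemLp (fun z : Vec M × ℝ => z.2) 2 (quantSample D Q S w) ∧
      ∀ u, ∫ z, z.2 * (u ⬝ᵥ z.1) ∂(quantSample D Q S w) = u ⬝ᵥ crossCov D S w := by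
  obtain ⟨vq, -, hopt, -⟩ := X.noise
  filter_upwards [hopt, integral_label_mul_feature X.one_le_M X.one_le_p X.unbiased X.additive
    X.wellSpecified X.cov] with w h1 h2
  have hb := memLp_two_label X.cov h1.1
  exact ⟨hb, fun u => h2 u (hb.integrable_mul (memLp_two_dot_quantSample X.cov w u))⟩

/-- The noise bound, for the minimum norm minimizer. -/
theorem noise_optVec (X : Setting D Q ε S α β σ σmin σmax e h g) (u : Vec M) :
    Integrable (fun z : Vec p × (Vec M × ℝ) =>
        (z.2.2 - optVec D S e h z.1 ⬝ᵥ z.2.1) ^ 2 * (u ⬝ᵥ z.2.1) ^ 2)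
        (D.prior ⊗ₘ quantSample D Q S) ∧
      ∫ z, (z.2.2 - optVec D S e h z.1 ⬝ᵥ z.2.1) ^ 2 * (u ⬝ᵥ z.2.1) ^ 2
        ∂(D.prior ⊗ₘ quantSample D Q S) ≤ σmax ^ 2 * (u ⬝ᵥ (Hf D Q S *ᵥ u)) := by
  obtain ⟨vq, hvm, hopt, hint, -, hup⟩ := X.noise
  -- The minimizer need not be unique. The difference `y` of two solutions of the normal equations
  -- has `y ⬝ᵥ H_f y = 0`, that is, zero second moment of `⟨y, f⟩`. Hence predictions, and with them
  -- the residual, agree almost surely.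
  have hae : ∀ᵐ w ∂D.prior, ∀ᵐ z ∂(quantSample D Q S w),
      vq w ⬝ᵥ z.1 = optVec D S e h w ⬝ᵥ z.1 := by
    filter_upwards [hopt, X.ae_integral_label] with w h1 h2
    set y := vq w - optVec D S e h w with hy
    have h3 : y ⬝ᵥ (Hf D Q S *ᵥ y) = 0 := by
      rw [hy, mulVec_sub, dotProduct_sub, ← h1.integral_eq X.cov, X.Hf_optVec, h2.2, sub_self]
    rw [← integral_dot_mul_dot_quantSample X.cov w] at h3
    simp only [← pow_two] at h3
    rw [integral_eq_zero_iff_of_nonneg (fun z => sq_nonneg _)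
      (memLp_two_dot_quantSample X.cov w y).integrable_sq] at h3
    filter_upwards [h3] with z hz
    have : y ⬝ᵥ z.1 = 0 := by simpa using hz
    rw [hy, sub_dotProduct] at this
    linarith
  have hm1 : Measurable fun z : Vec p × (Vec M × ℝ) => vq z.1 ⬝ᵥ z.2.1 :=
    measurable_dot.comp ((hvm.comp measurable_fst).prodMk (measurable_fst.comp measurable_snd))
  have hm2 : Measurable fun z : Vec p × (Vec M × ℝ) => optVec D S e h z.1 ⬝ᵥ z.2.1 :=
    measurable_dot.comp (((measurable_optVec D S e h).comp measurable_fst).prodMk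
      (measurable_fst.comp measurable_snd))
  have hae2 : ∀ᵐ z ∂(D.prior ⊗ₘ quantSample D Q S),
      (z.2.2 - vq z.1 ⬝ᵥ z.2.1) ^ 2 * (u ⬝ᵥ z.2.1) ^ 2 =
        (z.2.2 - optVec D S e h z.1 ⬝ᵥ z.2.1) ^ 2 * (u ⬝ᵥ z.2.1) ^ 2 := by
    have := Measure.ae_compProd_of_ae_ae (measurableSet_eq_fun hm1 hm2) hae
    filter_upwards [this] with z hz
    rw [hz]
  have hq := integral_mul_dotProduct_mul_dotProduct (g := fun z : Vec p × (Vec M × ℝ) =>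
    (z.2.2 - vq z.1 ⬝ᵥ z.2.1) ^ 2) (φ := fun z => z.2.1) hint u u
  simp only [← pow_two (u ⬝ᵥ _)] at hq
  refine ⟨hq.1.congr hae2, ?_⟩
  rw [← integral_congr_ae hae2, hq.2]
  refine (dotProduct_mulVec_le_of_le hup u).trans_eq ?_
  rw [smul_mulVec, dotProduct_smul, smul_eq_mul]

/-- The conditional noise level in the direction `u` given `w`. -/
noncomputable def noiseLevel (D : DataModel p) (Q : Quantizers p M) (S : Sketch M p)
    (e : Fin M → Vec M) (h : Fin M → ℝ) (u : Vec M) (w : Vec p) : ℝ :=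
  ∫ z, (z.2 - optVec D S e h w ⬝ᵥ z.1) ^ 2 * (u ⬝ᵥ z.1) ^ 2 ∂(quantSample D Q S w)

theorem integral_noiseLevel (X : Setting D Q ε S α β σ σmin σmax e h g) (i : Fin M) :
    Integrable (noiseLevel D Q S e h (e i)) D.prior ∧
      ∫ w, noiseLevel D Q S e h (e i) w ∂D.prior ≤ σmax ^ 2 * h i := by
  obtain ⟨h1, h2⟩ := X.noise_optVec (e i)
  rw [Measure.integral_compProd h1, X.diag_h.apply_self X.frame] at h2
  have h3 := ((Measure.integrable_compProd_iff h1.aestronglyMeasurable).mp h1).2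
  refine ⟨h3.congr (Filter.Eventually.of_forall fun w => ?_), h2⟩
  exact integral_congr_ae (Filter.Eventually.of_forall fun z =>
    Real.norm_of_nonneg (mul_nonneg (sq_nonneg _) (sq_nonneg _)))

/-- First and second moments of a stochastic gradient. -/
theorem ae_gradient (X : Setting D Q ε S α β σ σmin σmax e h g) :
    ∀ᵐ w ∂D.prior, ∀ (v : Vec M) (i : Fin M),
      Integrable (fun r : (((Vec M × ℝ) × Vec M) × ℝ) × ℝ => (r.2 * (e i ⬝ᵥ r.1.1.1.1)) ^ 2)
        (stepDraw D Q S (w, v)) ∧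
      Integrable (fun r : (((Vec M × ℝ) × Vec M) × ℝ) × ℝ => r.2 * (e i ⬝ᵥ r.1.1.1.1))
        (stepDraw D Q S (w, v)) ∧
      ∫ r, r.2 * (e i ⬝ᵥ r.1.1.1.1) ∂(stepDraw D Q S (w, v)) =
        -(h i * (e i ⬝ᵥ v - e i ⬝ᵥ optVec D S e h w)) ∧
      ∫ r, (r.2 * (e i ⬝ᵥ r.1.1.1.1)) ^ 2 ∂(stepDraw D Q S (w, v)) ≤
        3 * noiseLevel D Q S e h (e i) w +
          3 / 2 * α * h i * ∑ j, h j * (e j ⬝ᵥ v - e j ⬝ᵥ optVec D S e h w) ^ 2 +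
          (ε.p * (α * (Hf D Q S).trace) + ε.a + ε.o) * h i := by
  have hN : ∀ᵐ w ∂D.prior, ∀ i, Integrable (fun z : Vec M × ℝ =>
      (z.2 - optVec D S e h w ⬝ᵥ z.1) ^ 2 * (e i ⬝ᵥ z.1) ^ 2) (quantSample D Q S w) := by
    rw [ae_all_iff]
    intro i
    have := (X.noise_optVec (e i)).1
    rw [Measure.integrable_compProd_iff this.aestronglyMeasurable] at this
    exact this.1
  have hp0 := X.additive.p.nonneg X.one_le_M
  filter_upwards [hN, X.ae_integral_label] with w hNw hlab v i
  set y := v - optVec D S e h w with hy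
  have hyj : ∀ j, e j ⬝ᵥ v - e j ⬝ᵥ optVec D S e h w = e j ⬝ᵥ y := fun j => by
    rw [hy, dotProduct_sub]
  simp_rw [hyj]
  have hme : Measurable fun f : Vec M => e i ⬝ᵥ f := measurable_dotProduct_left _
  have hmy : Measurable fun f : Vec M => y ⬝ᵥ f := measurable_dotProduct_left _
  have hmff : Measurable fun f : Vec M => f ⬝ᵥ f := by
    simp only [dotProduct]; fun_prop
  -- the dominating function
  have i1 : Integrable (fun z : Vec M × ℝ =>
      3 * ((z.2 - optVec D S e h w ⬝ᵥ z.1) ^ 2 * (e i ⬝ᵥ z.1) ^ 2)) (quantSample D Q S w) :=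
    (hNw i).const_mul 3
  have i2 : Integrable (fun z : Vec M × ℝ =>
      3 / 2 * ((y ⬝ᵥ z.1) ^ 2 * (e i ⬝ᵥ z.1) ^ 2)) (quantSample D Q S w) :=
    ((integrable_fst_quantSample_iff (g := fun f => (y ⬝ᵥ f) ^ 2 * (e i ⬝ᵥ f) ^ 2)
      ((hmy.pow_const 2).mul (hme.pow_const 2))).mpr (X.fourth.sq_mul_sq y (e i)).1).const_mul _
  have i3 : Integrable (fun z : Vec M × ℝ =>
      ε.p * ((z.1 ⬝ᵥ z.1) * (e i ⬝ᵥ z.1) ^ 2)) (quantSample D Q S w) :=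
    ((integrable_fst_quantSample_iff (g := fun f => (f ⬝ᵥ f) * (e i ⬝ᵥ f) ^ 2)
      (hmff.mul (hme.pow_const 2))).mpr (X.fourth.self_mul_sq (e i)).1).const_mul _
  have i4 : Integrable (fun z : Vec M × ℝ => (ε.a + ε.o) * (e i ⬝ᵥ z.1) ^ 2)
      (quantSample D Q S w) := (memLp_two_dot_quantSample X.cov w (e i)).integrable_sq.const_mul _
  have i12 : Integrable (fun z : Vec M × ℝ =>
      3 * ((z.2 - optVec D S e h w ⬝ᵥ z.1) ^ 2 * (e i ⬝ᵥ z.1) ^ 2) +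
      3 / 2 * ((y ⬝ᵥ z.1) ^ 2 * (e i ⬝ᵥ z.1) ^ 2)) (quantSample D Q S w) := i1.add i2
  have i34 : Integrable (fun z : Vec M × ℝ => ε.p * ((z.1 ⬝ᵥ z.1) * (e i ⬝ᵥ z.1) ^ 2) +
      (ε.a + ε.o) * (e i ⬝ᵥ z.1) ^ 2) (quantSample D Q S w) := i3.add i4
  have iall : Integrable (fun z : Vec M × ℝ =>
      (3 * ((z.2 - optVec D S e h w ⬝ᵥ z.1) ^ 2 * (e i ⬝ᵥ z.1) ^ 2) +
      3 / 2 * ((y ⬝ᵥ z.1) ^ 2 * (e i ⬝ᵥ z.1) ^ 2)) +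
      (ε.p * ((z.1 ⬝ᵥ z.1) * (e i ⬝ᵥ z.1) ^ 2) + (ε.a + ε.o) * (e i ⬝ᵥ z.1) ^ 2))
      (quantSample D Q S w) := i12.add i34
  have hbound : ∫⁻ r, ENNReal.ofReal ((r.2 * (e i ⬝ᵥ r.1.1.1.1)) ^ 2) ∂(stepDraw D Q S (w, v)) ≤
      ENNReal.ofReal (3 * noiseLevel D Q S e h (e i) w +
          3 / 2 * α * h i * ∑ j, h j * (e j ⬝ᵥ y) ^ 2 +
          (ε.p * (α * (Hf D Q S).trace) + ε.a + ε.o) * h i) := by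
    refine (lintegral_gradient_sq_le X.one_le_M X.unbiased X.additive S w v (e i)).trans ?_
    calc _ ≤ ∫⁻ z, ENNReal.ofReal ((3 * ((z.2 - optVec D S e h w ⬝ᵥ z.1) ^ 2 * (e i ⬝ᵥ z.1) ^ 2) +
          3 / 2 * ((y ⬝ᵥ z.1) ^ 2 * (e i ⬝ᵥ z.1) ^ 2)) +
          (ε.p * ((z.1 ⬝ᵥ z.1) * (e i ⬝ᵥ z.1) ^ 2) + (ε.a + ε.o) * (e i ⬝ᵥ z.1) ^ 2))
          ∂(quantSample D Q S w) := by
          refine lintegral_mono fun z => ENNReal.ofReal_le_ofReal ?_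
          have hv : z.1 ⬝ᵥ v = optVec D S e h w ⬝ᵥ z.1 + y ⬝ᵥ z.1 := by
            rw [hy, sub_dotProduct, dotProduct_comm]; ring
          -- Weights `3` and `3/2` instead of `2` and `2`: the weight on the current error is the
          -- strength of the feedback in the recursion. With `3/2` the loop gain is at most `3/4`,
          -- whereas `2` would only give a gain below `1` with no uniform margin.
          have hsq : (z.2 - z.1 ⬝ᵥ v) ^ 2 ≤ 3 * (z.2 - optVec D S e h w ⬝ᵥ z.1) ^ 2 +
              3 / 2 * (y ⬝ᵥ z.1) ^ 2 := by
            rw [hv]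
            nlinarith [sq_nonneg (2 * (z.2 - optVec D S e h w ⬝ᵥ z.1) + y ⬝ᵥ z.1)]
          nlinarith [mul_le_mul_of_nonneg_right hsq (sq_nonneg (e i ⬝ᵥ z.1))]
      _ ≤ _ := by
          rw [← ofReal_integral_eq_lintegral_ofReal iall (Filter.Eventually.of_forall fun z => ?_)]
          · refine ENNReal.ofReal_le_ofReal ?_
            rw [integral_add i12 i34, integral_add i1 i2, integral_add i3 i4, integral_const_mul,
              integral_const_mul (3 / 2), integral_const_mul ε.p, integral_const_mul (ε.a + ε.o),
              integral_fst_quantSample D Q S w (g := fun f => (y ⬝ᵥ f) ^ 2 * (e i ⬝ᵥ f) ^ 2)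
                ((hmy.pow_const 2).mul (hme.pow_const 2)),
              integral_fst_quantSample D Q S w (g := fun f => (f ⬝ᵥ f) * (e i ⬝ᵥ f) ^ 2)
                (hmff.mul (hme.pow_const 2)),
              integral_fst_quantSample D Q S w (g := fun f => (e i ⬝ᵥ f) ^ 2) (hme.pow_const 2),
              (X.cov.quant.integral_sq (e i)).2]
            have b2 := (X.fourth.sq_mul_sq y (e i)).2
            have b3 := mul_le_mul_of_nonneg_left (X.fourth.self_mul_sq (e i)).2 hp0
            have hyy : y ⬝ᵥ (Hf D Q S *ᵥ y) = ∑ j, h j * (e j ⬝ᵥ y) ^ 2 := by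
              rw [X.diag_h]
              exact Finset.sum_congr rfl fun j _ => by ring
            have hii := X.diag_h.apply_self X.frame i
            rw [hyy, hii] at b2
            rw [hii] at b3
            change 3 * noiseLevel D Q S e h (e i) w + _ + (_ + (ε.a + ε.o) *
              (e i ⬝ᵥ (Hf D Q S *ᵥ e i))) ≤ _
            rw [hii]
            linarith
          · have := dotProduct_self_nonneg' z.1
            have ha0 := X.additive.a.nonneg
            have ho0 := X.additive.o.nonneg
            simp only [Pi.zero_apply]
            positivity
  have hmr : Measurable fun r : (((Vec M × ℝ) × Vec M) × ℝ) × ℝ => r.2 * (e i ⬝ᵥ r.1.1.1.1) :=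
    measurable_snd.mul (hme.comp (by fun_prop))
  have htop := (hbound.trans_lt ENNReal.ofReal_lt_top).ne
  have hisq := integrable_sq_of_lintegral_ne_top hmr htop
  have hi1 := (memLp_two_of_lintegral_ne_top hmr htop).integrable (by norm_num)
  refine ⟨hisq, hi1, ?_, ?_⟩
  · rw [integral_gradient X.unbiased S w v (e i) hi1]
    have hsub : ∀ z : Vec M × ℝ, (z.2 - z.1 ⬝ᵥ v) * (e i ⬝ᵥ z.1) =
        z.2 * (e i ⬝ᵥ z.1) - (e i ⬝ᵥ z.1) * (v ⬝ᵥ z.1) := fun z => by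
      rw [dotProduct_comm z.1 v]; ring
    have j1 : Integrable (fun z : Vec M × ℝ => z.2 * (e i ⬝ᵥ z.1)) (quantSample D Q S w) :=
      hlab.1.integrable_mul (memLp_two_dot_quantSample X.cov w (e i))
    have j2 : Integrable (fun z : Vec M × ℝ => (e i ⬝ᵥ z.1) * (v ⬝ᵥ z.1)) (quantSample D Q S w) :=
      (memLp_two_dot_quantSample X.cov w (e i)).integrable_mul
        (memLp_two_dot_quantSample X.cov w v)
    simp_rw [hsub]
    rw [integral_sub j1 j2, hlab.2, integral_dot_mul_dot_quantSample X.cov, ← X.Hf_optVec]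
    have : ∀ x : Vec M, e i ⬝ᵥ (Hf D Q S *ᵥ x) = h i * (e i ⬝ᵥ x) := fun x => by
      rw [X.diag_h]
      simp [X.frame.orth]
    rw [this, this, hy, dotProduct_sub]
    ring
  · have hnn : 0 ≤ 3 * noiseLevel D Q S e h (e i) w +
          3 / 2 * α * h i * ∑ j, h j * (e j ⬝ᵥ y) ^ 2 +
          (ε.p * (α * (Hf D Q S).trace) + ε.a + ε.o) * h i := by
      have n1 : 0 ≤ noiseLevel D Q S e h (e i) w := integral_nonneg fun z => by positivity
      have n2 := X.h_nonneg i
      have n3 : 0 ≤ ∑ j, h j * (e j ⬝ᵥ y) ^ 2 :=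
        Finset.sum_nonneg fun j _ => mul_nonneg (X.h_nonneg j) (sq_nonneg _)
      have n4 := X.alpha_pos
      have n5 : 0 ≤ (Hf D Q S).trace := by
        rw [X.diag_h.trace_eq X.frame]
        exact Finset.sum_nonneg fun j _ => X.h_nonneg j
      have ha0 := X.additive.a.nonneg
      have ho0 := X.additive.o.nonneg
      positivity
    rw [← ENNReal.ofReal_le_ofReal_iff hnn, ofReal_integral_eq_lintegral_ofReal hisq
      (Filter.Eventually.of_forall fun _ => sq_nonneg _)]
    exact hbound

end Setting

end Setting

end QuantSGD

namespace QuantSGD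

/-! ### One step of quantized SGD -/

section Step

variable {p M : ℕ}

/-- The randomness of one step, from the state `(w, (v, s))`. -/
noncomputable def stateDraw (D : DataModel p) (Q : Quantizers p M) (S : Sketch M p) :
    Kernel (Vec p × (Vec M × Vec M)) ((((Vec M × ℝ) × Vec M) × ℝ) × ℝ) :=
  (stepDraw D Q S).comap (fun z : Vec p × (Vec M × Vec M) => (z.1, z.2.1)) (by fun_prop)

instance (D : DataModel p) (Q : Quantizers p M) (S : Sketch M p) :
    IsMarkovKernel (stateDraw D Q S) := by
  unfold stateDraw
  infer_instance

/-- The new state `(w, (v + γ g f, s + v))`. -/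
noncomputable def nextState (γ : ℝ)
    (z : (Vec p × (Vec M × Vec M)) × ((((Vec M × ℝ) × Vec M) × ℝ) × ℝ)) :
    Vec p × (Vec M × Vec M) :=
  (z.1.1, (z.1.2.1 + (γ * z.2.2) • z.2.1.1.1.1, z.1.2.2 + z.1.2.1))

theorem measurable_nextState (γ : ℝ) : Measurable (nextState (p := p) (M := M) γ) := by
  unfold nextState
  fun_prop

/-- This keeps the draw of a step next to the state before it, so that gradients can be integrated
conditionally on the state. -/
theorem sgdLaw_succ (D : DataModel p) (Q : Quantizers p M) (S : Sketch M p) (γ : ℝ) (t : ℕ) :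
    sgdLaw D Q S γ (t + 1) = (sgdLaw D Q S γ t ⊗ₘ stateDraw D Q S).map (nextState γ) := by
  refine Measure.ext_of_lintegral _ fun F hF => ?_
  have hm : Measurable fun z : (Vec p × (Vec M × Vec M)) × Vec M =>
      (z.1.1, (z.2, z.1.2.2 + z.1.2.1)) := by fun_prop
  have hm2 : Measurable fun z : (Vec p × Vec M) × ((((Vec M × ℝ) × Vec M) × ℝ) × ℝ) =>
      z.1.2 + (γ * z.2.2) • z.2.1.1.1.1 := by fun_prop
  rw [lintegral_map hF (measurable_nextState γ),
    Measure.lintegral_compProd (f := fun z => F (nextState γ z))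
      (hF.comp (measurable_nextState γ)), sgdLaw,
    Measure.lintegral_bind (Kernel.aemeasurable _) hF.aemeasurable]
  refine lintegral_congr fun z => ?_
  rw [Kernel.lintegral_map _ hm _ hF,
    Kernel.lintegral_id_prod (f := fun z : (Vec p × (Vec M × Vec M)) × Vec M =>
      F (z.1.1, (z.2, z.1.2.2 + z.1.2.1))) (hF.comp hm),
    Kernel.lintegral_comap, sgdStep, Kernel.lintegral_map _ hm2 _ (by fun_prop),
    Kernel.lintegral_id_prod (by fun_prop)]
  rfl

/-- A step never touches the target. Statements that hold for almost every target thus transfer to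
the state at every time. -/
theorem map_fst_sgdLaw (D : DataModel p) (Q : Quantizers p M) (S : Sketch M p) (γ : ℝ) (t : ℕ) :
    (sgdLaw D Q S γ t).map Prod.fst = D.prior := by
  induction t with
  | zero =>
    rw [sgdLaw, Measure.map_map measurable_fst (by fun_prop)]
    exact Measure.map_id
  | succ t ih =>
    rw [sgdLaw_succ, Measure.map_map measurable_fst (measurable_nextState γ)]
    have : (Prod.fst ∘ nextState (p := p) (M := M) γ) = Prod.fst ∘ Prod.fst := rfl
    rw [this, ← Measure.map_map measurable_fst measurable_fst]
    change Measure.map Prod.fst (Measure.fst _) = _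
    rw [Measure.fst_compProd, ih]

theorem ae_sgdLaw_of_ae {D : DataModel p} (Q : Quantizers p M) (S : Sketch M p) (γ : ℝ) (t : ℕ)
    {P : Vec p → Prop} (hP : ∀ᵐ w ∂D.prior, P w) : ∀ᵐ z ∂sgdLaw D Q S γ t, P z.1 := by
  rw [← map_fst_sgdLaw D Q S γ t] at hP
  exact ae_of_ae_map measurable_fst.aemeasurable hP

/-- The error of the iterate in the direction `e i`. -/
noncomputable def stepErr (D : DataModel p) (S : Sketch M p) (e : Fin M → Vec M) (h : Fin M → ℝ)
    (i : Fin M) (z : Vec p × (Vec M × Vec M)) : ℝ :=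
  e i ⬝ᵥ z.2.1 - e i ⬝ᵥ optVec D S e h z.1

/-- The accumulated error of `t` iterates in the direction `e i`. -/
noncomputable def cumErr (D : DataModel p) (S : Sketch M p) (e : Fin M → Vec M) (h : Fin M → ℝ)
    (t : ℕ) (i : Fin M) (z : Vec p × (Vec M × Vec M)) : ℝ :=
  e i ⬝ᵥ z.2.2 - t * (e i ⬝ᵥ optVec D S e h z.1)

theorem measurable_stepErr (D : DataModel p) (S : Sketch M p) (e : Fin M → Vec M) (h : Fin M → ℝ)
    (i : Fin M) : Measurable (stepErr D S e h i) :=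
  ((measurable_dotProduct_left (e i)).comp (measurable_fst.comp measurable_snd)).sub
    ((measurable_dotProduct_left (e i)).comp ((measurable_optVec D S e h).comp measurable_fst))

theorem measurable_cumErr (D : DataModel p) (S : Sketch M p) (e : Fin M → Vec M) (h : Fin M → ℝ)
    (t : ℕ) (i : Fin M) : Measurable (cumErr D S e h t i) :=
  ((measurable_dotProduct_left (e i)).comp (measurable_snd.comp measurable_snd)).sub
    (((measurable_dotProduct_left (e i)).comp
      ((measurable_optVec D S e h).comp measurable_fst)).const_mul _)

/-- The component of the stochastic gradient in the direction `u`. -/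
def gradDot (u : Vec M) (r : (((Vec M × ℝ) × Vec M) × ℝ) × ℝ) : ℝ := r.2 * (u ⬝ᵥ r.1.1.1.1)

theorem measurable_gradDot (u : Vec M) : Measurable (gradDot u) :=
  measurable_snd.mul ((measurable_dotProduct_left u).comp (by fun_prop))

theorem stepErr_nextState (D : DataModel p) (S : Sketch M p) (e : Fin M → Vec M) (h : Fin M → ℝ)
    (γ : ℝ) (i : Fin M) (z : (Vec p × (Vec M × Vec M)) × ((((Vec M × ℝ) × Vec M) × ℝ) × ℝ)) :
    stepErr D S e h i (nextState γ z) = stepErr D S e h i z.1 + γ * gradDot (e i) z.2 := by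
  simp only [stepErr, nextState, gradDot, dotProduct_add, dotProduct_smul, smul_eq_mul]
  ring

theorem cumErr_nextState (D : DataModel p) (S : Sketch M p) (e : Fin M → Vec M) (h : Fin M → ℝ)
    (γ : ℝ) (t : ℕ) (i : Fin M)
    (z : (Vec p × (Vec M × Vec M)) × ((((Vec M × ℝ) × Vec M) × ℝ) × ℝ)) :
    cumErr D S e h (t + 1) i (nextState γ z) = cumErr D S e h t i z.1 + stepErr D S e h i z.1 := by
  simp only [stepErr, cumErr, nextState, dotProduct_add]
  push_cast
  ring

/-- Here `A` is the current error, `C` the accumulated one and `G` the gradient component. The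
hypotheses `h1` and `h2` retain all that is needed of `E[G | state] = -κ A`. Only the recursion for
`A²` sees the second moment of `G`; the other two are exact. -/
theorem moment_algebra {Ω : Type*} [MeasurableSpace Ω] {μ : Measure Ω} {A C G : Ω → ℝ}
    {γ κ B : ℝ} (hA : MemLp A 2 μ) (hC : MemLp C 2 μ) (hG : MemLp G 2 μ)
    (hB : ∫ z, G z ^ 2 ∂μ ≤ B) (h1 : ∫ z, A z * G z ∂μ = -κ * ∫ z, A z * A z ∂μ)
    (h2 : ∫ z, C z * G z ∂μ = -κ * ∫ z, C z * A z ∂μ) :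
    (∫ z, (A z + γ * G z) ^ 2 ∂μ ≤ (1 - 2 * γ * κ) * ∫ z, A z ^ 2 ∂μ + γ ^ 2 * B) ∧
    (∫ z, (C z + A z) * (A z + γ * G z) ∂μ =
      (1 - γ * κ) * (∫ z, C z * A z ∂μ + ∫ z, A z ^ 2 ∂μ)) ∧
    (∫ z, (C z + A z) ^ 2 ∂μ =
      ∫ z, C z ^ 2 ∂μ + 2 * ∫ z, C z * A z ∂μ + ∫ z, A z ^ 2 ∂μ) := by
  have iAA : Integrable (fun z => A z ^ 2) μ := hA.integrable_sq
  have iCC : Integrable (fun z => C z ^ 2) μ := hC.integrable_sq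
  have iGG : Integrable (fun z => γ ^ 2 * G z ^ 2) μ := hG.integrable_sq.const_mul _
  have iAG : Integrable (fun z => 2 * γ * (A z * G z)) μ := (hA.integrable_mul hG).const_mul _
  have iAG' : Integrable (fun z => γ * (A z * G z)) μ := (hA.integrable_mul hG).const_mul _
  have iCG : Integrable (fun z => γ * (C z * G z)) μ := (hC.integrable_mul hG).const_mul _
  have iCA : Integrable (fun z => C z * A z) μ := hC.integrable_mul hA
  have iCA2 : Integrable (fun z => 2 * (C z * A z)) μ := iCA.const_mul _
  have hAA : ∫ z, A z * A z ∂μ = ∫ z, A z ^ 2 ∂μ := by simp only [pow_two]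
  rw [hAA] at h1
  have j1 : Integrable (fun z => A z ^ 2 + 2 * γ * (A z * G z)) μ := iAA.add iAG
  have j2 : Integrable (fun z => C z * A z + A z ^ 2) μ := iCA.add iAA
  have j3 : Integrable (fun z => γ * (C z * G z) + γ * (A z * G z)) μ := iCG.add iAG'
  have j4 : Integrable (fun z => C z ^ 2 + 2 * (C z * A z)) μ := iCC.add iCA2
  refine ⟨?_, ?_, ?_⟩
  · have : ∀ z, (A z + γ * G z) ^ 2 = A z ^ 2 + 2 * γ * (A z * G z) + γ ^ 2 * G z ^ 2 :=
      fun z => by ring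
    simp_rw [this]
    rw [integral_add j1 iGG, integral_add iAA iAG, integral_const_mul (2 * γ),
      integral_const_mul (γ ^ 2), h1]
    nlinarith [mul_le_mul_of_nonneg_left hB (sq_nonneg γ)]
  · have : ∀ z, (C z + A z) * (A z + γ * G z) =
        C z * A z + A z ^ 2 + (γ * (C z * G z) + γ * (A z * G z)) := fun z => by ring
    simp_rw [this]
    rw [integral_add j2 j3, integral_add iCA iAA, integral_add iCG iAG', integral_const_mul γ,
      integral_const_mul γ, h1, h2]
    ring
  · have : ∀ z, (C z + A z) ^ 2 = C z ^ 2 + 2 * (C z * A z) + A z ^ 2 := fun z => by ring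
    simp_rw [this]
    rw [integral_add j4 iAA, integral_add iCC iCA2, integral_const_mul 2]

namespace Setting

variable {D : DataModel p} {Q : Quantizers p M} {ε : ErrorLevels} {S : Sketch M p}
  {α β σ σmin σmax : ℝ} {e : Fin M → Vec M} {h g : Fin M → ℝ}

/-- The noise is bounded only on average over the target, not for each one. This suffices, because
`noiseLevel` depends on the state through the target alone and the target keeps its prior law. -/
theorem memLp_gradDot (X : Setting D Q ε S α β σ σmin σmax e h g) (γ : ℝ) (t : ℕ)
    (hL : ∀ j, MemLp (stepErr D S e h j) 2 (sgdLaw D Q S γ t)) (i : Fin M) :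
    MemLp (fun z : (Vec p × (Vec M × Vec M)) × ((((Vec M × ℝ) × Vec M) × ℝ) × ℝ) =>
      gradDot (e i) z.2) 2 (sgdLaw D Q S γ t ⊗ₘ stateDraw D Q S) ∧
    ∫ z, gradDot (e i) z.2 ^ 2 ∂(sgdLaw D Q S γ t ⊗ₘ stateDraw D Q S) ≤
      3 * (σmax ^ 2 * h i) +
        3 / 2 * α * h i * ∑ j, h j * ∫ z, stepErr D S e h j z ^ 2 ∂(sgdLaw D Q S γ t) +
        (ε.p * (α * (Hf D Q S).trace) + ε.a + ε.o) * h i := by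
  have hae := ae_sgdLaw_of_ae Q S γ t X.ae_gradient
  obtain ⟨n1, n2⟩ := X.integral_noiseLevel i
  have hmap := map_fst_sgdLaw D Q S γ t
  have i1 : Integrable (fun z : Vec p × (Vec M × Vec M) => 3 * noiseLevel D Q S e h (e i) z.1)
      (sgdLaw D Q S γ t) := by
    rw [← hmap] at n1
    exact (n1.comp_measurable measurable_fst).const_mul 3
  have n3 : ∫ z, noiseLevel D Q S e h (e i) z.1 ∂(sgdLaw D Q S γ t) ≤ σmax ^ 2 * h i := by
    rw [← hmap] at n1 n2
    rwa [integral_map measurable_fst.aemeasurable n1.aestronglyMeasurable] at n2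
  have i2 : ∀ j ∈ Finset.univ, Integrable (fun z => h j * stepErr D S e h j z ^ 2)
      (sgdLaw D Q S γ t) := fun j _ => (hL j).integrable_sq.const_mul _
  have i3 : Integrable (fun z => 3 / 2 * α * h i * ∑ j, h j * stepErr D S e h j z ^ 2)
      (sgdLaw D Q S γ t) := (integrable_finsetSum _ i2).const_mul _
  have i4 : Integrable (fun _ : Vec p × (Vec M × Vec M) =>
      (ε.p * (α * (Hf D Q S).trace) + ε.a + ε.o) * h i) (sgdLaw D Q S γ t) :=
    integrable_const _
  have i13 : Integrable (fun z : Vec p × (Vec M × Vec M) =>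
      3 * noiseLevel D Q S e h (e i) z.1 +
        3 / 2 * α * h i * ∑ j, h j * stepErr D S e h j z ^ 2) (sgdLaw D Q S γ t) := i1.add i3
  have iall : Integrable (fun z : Vec p × (Vec M × Vec M) =>
      3 * noiseLevel D Q S e h (e i) z.1 +
        3 / 2 * α * h i * ∑ j, h j * stepErr D S e h j z ^ 2 +
        (ε.p * (α * (Hf D Q S).trace) + ε.a + ε.o) * h i) (sgdLaw D Q S γ t) := i13.add i4
  have hm : Measurable fun z : (Vec p × (Vec M × Vec M)) × ((((Vec M × ℝ) × Vec M) × ℝ) × ℝ) =>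
      gradDot (e i) z.2 := (measurable_gradDot _).comp measurable_snd
  have hsq : Integrable (fun z : (Vec p × (Vec M × Vec M)) × ((((Vec M × ℝ) × Vec M) × ℝ) × ℝ) =>
      gradDot (e i) z.2 ^ 2) (sgdLaw D Q S γ t ⊗ₘ stateDraw D Q S) := by
    rw [Measure.integrable_compProd_iff (hm.pow_const 2).aestronglyMeasurable]
    constructor
    · filter_upwards [hae] with z hz
      exact (hz z.2.1 i).1
    · refine iall.mono' ((hm.pow_const 2).norm.stronglyMeasurable.integral_kernel_prod_right'
        (κ := stateDraw D Q S)).aestronglyMeasurable ?_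
      filter_upwards [hae] with z hz
      rw [Real.norm_of_nonneg (integral_nonneg fun _ => norm_nonneg _)]
      simp only [norm_pow, Real.norm_eq_abs, sq_abs]
      exact (hz z.2.1 i).2.2.2
  refine ⟨(memLp_two_iff_integrable_sq hm.aestronglyMeasurable).mpr hsq, ?_⟩
  rw [Measure.integral_compProd hsq]
  calc _ ≤ ∫ z, (3 * noiseLevel D Q S e h (e i) z.1 +
        3 / 2 * α * h i * ∑ j, h j * stepErr D S e h j z ^ 2 +
        (ε.p * (α * (Hf D Q S).trace) + ε.a + ε.o) * h i) ∂(sgdLaw D Q S γ t) := by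
        refine integral_mono_of_nonneg (Filter.Eventually.of_forall fun z =>
          integral_nonneg fun _ => sq_nonneg _) iall ?_
        filter_upwards [hae] with z hz
        exact (hz z.2.1 i).2.2.2
    _ ≤ _ := by
        rw [integral_add i13 i4, integral_add i1 i3, integral_const_mul 3,
          integral_const_mul (3 / 2 * α * h i), integral_finsetSum _ i2, integral_const]
        simp only [integral_const_mul, probReal_univ, one_smul]
        linarith

theorem integral_mul_gradDot (X : Setting D Q ε S α β σ σmin σmax e h g) (γ : ℝ) (t : ℕ)
    (hL : ∀ j, MemLp (stepErr D S e h j) 2 (sgdLaw D Q S γ t)) (i : Fin M)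
    {Z : Vec p × (Vec M × Vec M) → ℝ} (hZ : MemLp Z 2 (sgdLaw D Q S γ t)) :
    ∫ z, Z z.1 * gradDot (e i) z.2 ∂(sgdLaw D Q S γ t ⊗ₘ stateDraw D Q S) =
      -h i * ∫ z, Z z * stepErr D S e h i z ∂(sgdLaw D Q S γ t) := by
  have hZ2 : MemLp (fun z : (Vec p × (Vec M × Vec M)) × ((((Vec M × ℝ) × Vec M) × ℝ) × ℝ) =>
      Z z.1) 2 (sgdLaw D Q S γ t ⊗ₘ stateDraw D Q S) := by
    have : (sgdLaw D Q S γ t ⊗ₘ stateDraw D Q S).map Prod.fst = sgdLaw D Q S γ t :=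
      Measure.fst_compProd _ _
    rw [← this] at hZ
    exact hZ.comp_of_map measurable_fst.aemeasurable
  have hi : Integrable (fun z : (Vec p × (Vec M × Vec M)) × ((((Vec M × ℝ) × Vec M) × ℝ) × ℝ) =>
      Z z.1 * gradDot (e i) z.2) (sgdLaw D Q S γ t ⊗ₘ stateDraw D Q S) :=
    hZ2.integrable_mul (X.memLp_gradDot γ t hL i).1
  rw [Measure.integral_compProd hi, ← integral_const_mul]
  refine integral_congr_ae ?_
  filter_upwards [ae_sgdLaw_of_ae Q S γ t X.ae_gradient] with z hz
  rw [integral_const_mul (Z z)]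
  have := (hz z.2.1 i).2.2.1
  change ∫ r, gradDot (e i) r ∂(stateDraw D Q S z) = _ at this
  rw [this, stepErr]
  ring

theorem dot_crossCov_eq (X : Setting D Q ε S α β σ σmin σmax e h g) (u : Vec M) (w : Vec p) :
    u ⬝ᵥ crossCov D S w = (D.H *ᵥ ((Matrix.of S)ᵀ *ᵥ u)) ⬝ᵥ w := by
  have hH : D.Hᵀ = D.H := by
    have := X.cov.posDef.isHermitian.eq
    rwa [conjTranspose_eq_transpose_of_trivial] at this
  rw [crossCov, dotProduct_mulVec, ← mulVec_transpose, dotProduct_mulVec, ← mulVec_transpose, hH]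

theorem memLp_optVec (X : Setting D Q ε S α β σ σmin σmax e h g) (i : Fin M) :
    MemLp (fun w => e i ⬝ᵥ optVec D S e h w) 2 D.prior := by
  have : ∀ w, e i ⬝ᵥ optVec D S e h w =
      (h i)⁻¹ * ((D.H *ᵥ ((Matrix.of S)ᵀ *ᵥ e i)) ⬝ᵥ w) := fun w => by
    rw [X.dot_optVec, X.dot_crossCov_eq]
  simp_rw [this]
  exact ((memLp_two_iff_integrable_sq (measurable_dotProduct_left _).aestronglyMeasurable).mpr
    (X.isotropic.1.integral_sq _).1).const_mul _

/-- All directions are carried through the induction at once, since the gradient in one direction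
depends on the errors in all of them. -/
theorem memLp_state (X : Setting D Q ε S α β σ σmin σmax e h g) (γ : ℝ) (t : ℕ) :
    ∀ i, MemLp (stepErr D S e h i) 2 (sgdLaw D Q S γ t) ∧
      MemLp (cumErr D S e h t i) 2 (sgdLaw D Q S γ t) := by
  induction t with
  | zero =>
    intro i
    have hm : Measurable fun w : Vec p => (w, ((0 : Vec M), (0 : Vec M))) := by fun_prop
    rw [sgdLaw]
    refine ⟨?_, ?_⟩
    · rw [memLp_map_measure_iff (measurable_stepErr D S e h i).aestronglyMeasurable
        hm.aemeasurable]
      refine (X.memLp_optVec i).neg.ae_eq (Filter.Eventually.of_forall fun w => ?_)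
      simp [stepErr]
    · rw [memLp_map_measure_iff (measurable_cumErr D S e h 0 i).aestronglyMeasurable
        hm.aemeasurable]
      refine (MemLp.zero' (p := 2) (μ := D.prior) (ε := ℝ)).ae_eq
        (Filter.Eventually.of_forall fun w => ?_)
      simp [cumErr]
  | succ t ih =>
    intro i
    have hfst : (sgdLaw D Q S γ t ⊗ₘ stateDraw D Q S).map Prod.fst = sgdLaw D Q S γ t :=
      Measure.fst_compProd _ _
    have h1 := (ih i).1
    have h2 := (ih i).2
    rw [← hfst] at h1 h2
    have h1 := h1.comp_of_map measurable_fst.aemeasurable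
    have h2 := h2.comp_of_map measurable_fst.aemeasurable
    rw [sgdLaw_succ]
    refine ⟨?_, ?_⟩
    · rw [memLp_map_measure_iff (measurable_stepErr D S e h i).aestronglyMeasurable
        (measurable_nextState γ).aemeasurable]
      refine (h1.add ((X.memLp_gradDot γ t (fun j => (ih j).1) i).1.const_mul γ)).ae_eq
        (Filter.Eventually.of_forall fun z => ?_)
      exact (stepErr_nextState D S e h γ i z).symm
    · rw [memLp_map_measure_iff (measurable_cumErr D S e h (t + 1) i).aestronglyMeasurable
        (measurable_nextState γ).aemeasurable]
      refine (h2.add h1).ae_eq (Filter.Eventually.of_forall fun z => ?_)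
      exact (cumErr_nextState D S e h γ t i z).symm

/-- The recursions for the second moments of the errors. -/
theorem moment_recursion (X : Setting D Q ε S α β σ σmin σmax e h g) (γ : ℝ) (t : ℕ) (i : Fin M) :
    (∫ z, stepErr D S e h i z ^ 2 ∂(sgdLaw D Q S γ (t + 1)) ≤
      (1 - 2 * γ * h i) * ∫ z, stepErr D S e h i z ^ 2 ∂(sgdLaw D Q S γ t) +
        γ ^ 2 * (3 * (σmax ^ 2 * h i) +
        3 / 2 * α * h i * ∑ j, h j * ∫ z, stepErr D S e h j z ^ 2 ∂(sgdLaw D Q S γ t) +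
        (ε.p * (α * (Hf D Q S).trace) + ε.a + ε.o) * h i)) ∧
    (∫ z, cumErr D S e h (t + 1) i z * stepErr D S e h i z ∂(sgdLaw D Q S γ (t + 1)) =
      (1 - γ * h i) * (∫ z, cumErr D S e h t i z * stepErr D S e h i z ∂(sgdLaw D Q S γ t) +
        ∫ z, stepErr D S e h i z ^ 2 ∂(sgdLaw D Q S γ t))) ∧
    (∫ z, cumErr D S e h (t + 1) i z ^ 2 ∂(sgdLaw D Q S γ (t + 1)) =
      ∫ z, cumErr D S e h t i z ^ 2 ∂(sgdLaw D Q S γ t) +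
      2 * ∫ z, cumErr D S e h t i z * stepErr D S e h i z ∂(sgdLaw D Q S γ t) +
        ∫ z, stepErr D S e h i z ^ 2 ∂(sgdLaw D Q S γ t)) := by
  have hL := X.memLp_state γ t
  obtain ⟨hG, hG2⟩ := X.memLp_gradDot γ t (fun j => (hL j).1) i
  have e1 := X.integral_mul_gradDot γ t (fun j => (hL j).1) i (hL i).1
  have e2 := X.integral_mul_gradDot γ t (fun j => (hL j).1) i (hL i).2
  have hms := measurable_stepErr D S e h i
  have hmc := measurable_cumErr D S e h t i
  have hmc' := measurable_cumErr D S e h (t + 1) i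
  have hfst : (sgdLaw D Q S γ t ⊗ₘ stateDraw D Q S).map Prod.fst = sgdLaw D Q S γ t :=
    Measure.fst_compProd _ _
  obtain ⟨π, hπ⟩ : ∃ π, π = sgdLaw D Q S γ t ⊗ₘ stateDraw D Q S := ⟨_, rfl⟩
  have hφ := (measurable_nextState (p := p) (M := M) γ).aemeasurable (μ := π)
  have ha : MemLp (fun z : (Vec p × (Vec M × Vec M)) × ((((Vec M × ℝ) × Vec M) × ℝ) × ℝ) =>
      stepErr D S e h i z.1) 2 π := by
    have := (hL i).1
    rw [← hfst, ← hπ] at this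
    exact this.comp_of_map measurable_fst.aemeasurable
  have hc : MemLp (fun z : (Vec p × (Vec M × Vec M)) × ((((Vec M × ℝ) × Vec M) × ℝ) × ℝ) =>
      cumErr D S e h t i z.1) 2 π := by
    have := (hL i).2
    rw [← hfst, ← hπ] at this
    exact this.comp_of_map measurable_fst.aemeasurable
  have tr : ∀ F : Vec p × (Vec M × Vec M) → ℝ, Measurable F →
      ∫ z, F z ∂(sgdLaw D Q S γ t) = ∫ z, F z.1 ∂π := fun F hF => by
    rw [← hfst, ← hπ, integral_map measurable_fst.aemeasurable hF.aestronglyMeasurable]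
  have hm1 : Measurable fun z => cumErr D S e h (t + 1) i z * stepErr D S e h i z := hmc'.mul hms
  have hm2 : Measurable fun z => cumErr D S e h t i z * stepErr D S e h i z := hmc.mul hms
  have hm3 : Measurable fun z => stepErr D S e h i z * stepErr D S e h i z := hms.mul hms
  rw [sgdLaw_succ, ← hπ, integral_map hφ (hms.pow_const 2).aestronglyMeasurable,
    integral_map hφ hm1.aestronglyMeasurable,
    integral_map hφ (hmc'.pow_const 2).aestronglyMeasurable]
  simp_rw [stepErr_nextState, cumErr_nextState]
  rw [← hπ] at hG hG2 e1 e2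
  rw [tr _ hm3] at e1
  rw [tr _ hm2] at e2
  rw [tr _ (hms.pow_const 2), tr _ hm2, tr _ (hmc.pow_const 2)]
  exact moment_algebra ha hc hG hG2 e1 e2

end Setting

end Step

end QuantSGD

namespace QuantSGD

/-! ### Solving the moment recursions -/

/-- Telescoping. The first bound exploits the contraction and is useful for large `h`; the second
only uses that `a` stays bounded and serves small `h`. -/
theorem sum_le_of_contraction {a B : ℕ → ℝ} {γ h : ℝ} (hγ : 0 ≤ γ) (hh : 0 ≤ h)
    (ha : ∀ t, 0 ≤ a t) (hB : ∀ t, 0 ≤ B t)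
    (hrec : ∀ t, a (t + 1) ≤ (1 - 2 * γ * h) * a t + γ ^ 2 * h * B t) (N : ℕ) :
    2 * γ * h * ∑ t ∈ Finset.range N, a t ≤ a 0 + γ ^ 2 * h * ∑ t ∈ Finset.range N, B t ∧
      ∑ t ∈ Finset.range N, a t ≤ N * (a 0 + γ ^ 2 * h * ∑ t ∈ Finset.range N, B t) := by
  have k1 : ∀ n : ℕ, a n + 2 * γ * h * ∑ t ∈ Finset.range n, a t ≤
      a 0 + γ ^ 2 * h * ∑ t ∈ Finset.range n, B t := by
    intro n
    induction n with
    | zero => simp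
    | succ n ih =>
      rw [Finset.sum_range_succ, Finset.sum_range_succ]
      nlinarith [hrec n]
  have hc : 0 ≤ 2 * γ * h := by positivity
  have hc2 : 0 ≤ γ ^ 2 * h := by positivity
  refine ⟨by linarith [k1 N, ha N], ?_⟩
  rw [← nsmul_eq_mul]
  refine (Finset.sum_le_card_nsmul _ _ _ fun t ht => ?_).trans_eq (by rw [Finset.card_range])
  have h1 := k1 t
  have h2 : 0 ≤ 2 * γ * h * ∑ s ∈ Finset.range t, a s :=
    mul_nonneg hc (Finset.sum_nonneg fun s _ => ha s)
  have h3 : ∑ s ∈ Finset.range t, B s ≤ ∑ s ∈ Finset.range N, B s :=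
    Finset.sum_le_sum_of_subset_of_nonneg
      (Finset.range_subset_range.mpr (Finset.mem_range.mp ht).le) fun s _ _ => hB s
  nlinarith [mul_le_mul_of_nonneg_left h3 hc2]

/-- The correlations `q` are nonnegative and satisfy `q n + κ ∑ (q + a) = ∑ a`. So `∑ (q + a)` is at
most `∑ a` times either `1/κ` or `N`, and `r` is at most twice that sum. -/
theorem cum_le_of_contraction {a q r : ℕ → ℝ} {κ : ℝ} (hκ : 0 ≤ κ) (hκ1 : κ ≤ 1)
    (ha : ∀ t, 0 ≤ a t) (hq0 : q 0 = 0) (hr0 : r 0 = 0)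
    (hq : ∀ t, q (t + 1) = (1 - κ) * (q t + a t))
    (hr : ∀ t, r (t + 1) = r t + 2 * q t + a t) (N : ℕ) :
    κ * r N ≤ 2 * ∑ t ∈ Finset.range N, a t ∧
      r N ≤ 2 * (N * ∑ t ∈ Finset.range N, a t) := by
  have q0 : ∀ t, 0 ≤ q t := by
    intro t
    induction t with
    | zero => rw [hq0]
    | succ t ih => rw [hq]; exact mul_nonneg (by linarith) (add_nonneg ih (ha t))
  have k1 : ∀ n : ℕ, q n + κ * ∑ t ∈ Finset.range n, (q t + a t) =
      ∑ t ∈ Finset.range n, a t := by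
    intro n
    induction n with
    | zero => simp [hq0]
    | succ n ih =>
      rw [Finset.sum_range_succ, Finset.sum_range_succ, ← ih, hq]
      ring
  have k2 : ∀ n : ℕ, r n ≤ 2 * ∑ t ∈ Finset.range n, (q t + a t) := by
    intro n
    induction n with
    | zero => simp [hr0]
    | succ n ih =>
      rw [Finset.sum_range_succ, hr]
      linarith [ha n]
  have hnn : ∀ n : ℕ, 0 ≤ ∑ t ∈ Finset.range n, (q t + a t) := fun n =>
    Finset.sum_nonneg fun t _ => add_nonneg (q0 t) (ha t)
  constructor
  · nlinarith [k1 N, q0 N, mul_le_mul_of_nonneg_left (k2 N) hκ]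
  · refine (k2 N).trans (mul_le_mul_of_nonneg_left ?_ zero_le_two)
    rw [← nsmul_eq_mul]
    refine (Finset.sum_le_card_nsmul _ _ _ fun t ht => ?_).trans_eq (by rw [Finset.card_range])
    have h1 := k1 t
    have h2 := mul_nonneg hκ (hnn t)
    have h3 : ∑ s ∈ Finset.range (t + 1), a s ≤ ∑ s ∈ Finset.range N, a s :=
      Finset.sum_le_sum_of_subset_of_nonneg
        (Finset.range_subset_range.mpr (Finset.mem_range.mp ht)) fun s _ _ => ha s
    rw [Finset.sum_range_succ] at h3
    linarith

theorem weighted_cum_le {A r a₀ P γ h g n : ℝ} (hγ : 0 < γ) (hg : 0 ≤ g) (hgh : g ≤ h)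
    (hn : 0 < n) (ha : 0 ≤ a₀) (hP : 0 ≤ P)
    (h1 : 2 * γ * h * A ≤ a₀ + γ ^ 2 * h * P) (h2 : A ≤ n * (a₀ + γ ^ 2 * h * P))
    (h3 : γ * h * r ≤ 2 * A) (h4 : r ≤ 2 * (n * A)) :
    g * r / n ^ 2 ≤ 4 * (h * (1 / (n * γ)) / (h + 1 / (n * γ)) * a₀) +
      2 * P / n ^ 2 * min 1 (n * γ * g) := by
  have hh : 0 ≤ h := hg.trans hgh
  have hψ : h * (1 / (n * γ)) / (h + 1 / (n * γ)) = h / (n * γ * h + 1) := by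
    field_simp
  rw [hψ, div_le_iff₀ (by positivity)]
  have hnγ : 0 < n * γ := mul_pos hn hγ
  have hrhs : (4 * (h / (n * γ * h + 1) * a₀) + 2 * P / n ^ 2 * min 1 (n * γ * g)) * n ^ 2 =
      4 * n ^ 2 * (h / (n * γ * h + 1)) * a₀ + 2 * P * min 1 (n * γ * g) := by
    field_simp
  rw [hrhs]
  -- The learning threshold. Directions below it have barely moved, and the bounds growing with `n`
  -- are used. Above it the bounds with `1 / (γ h)` are used, and `g / h ≤ min 1 (n γ g)`.
  rcases le_or_gt (n * γ * h) 1 with hc | hc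
  · have e1 : r ≤ 2 * (n * (n * (a₀ + γ ^ 2 * h * P))) := by
      nlinarith [mul_le_mul_of_nonneg_left h2 hn.le]
    have e2 : h / 2 ≤ h / (n * γ * h + 1) := by
      apply div_le_div_of_nonneg_left hh (by positivity) (by linarith)
    have e3 : min 1 (n * γ * g) = n * γ * g := by
      apply min_eq_right
      exact (mul_le_mul_of_nonneg_left hgh hnγ.le).trans hc
    rw [e3]
    calc g * r ≤ g * (2 * (n * (n * (a₀ + γ ^ 2 * h * P)))) := mul_le_mul_of_nonneg_left e1 hg
      _ = 2 * n ^ 2 * g * a₀ + 2 * P * (n * γ * g) * (n * γ * h) := by ring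
      _ ≤ 4 * n ^ 2 * (h / 2) * a₀ + 2 * P * (n * γ * g) * 1 := by
          gcongr ?_ * _ + _ * ?_
          nlinarith [mul_le_mul_of_nonneg_left hgh (sq_nonneg n)]
      _ ≤ _ := by
          rw [mul_one]
          gcongr
  · have hh0 : 0 < h := by
      by_contra hcon
      have : h = 0 := le_antisymm (not_lt.mp hcon) hh
      rw [this] at hc
      norm_num at hc
    have hk : 0 < γ * h := mul_pos hγ hh0
    have e1 : (γ * h) ^ 2 * r ≤ a₀ + γ ^ 2 * h * P := by
      nlinarith [mul_le_mul_of_nonneg_left h3 hk.le]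
    have e2 : r ≤ (a₀ + γ ^ 2 * h * P) / (γ * h) ^ 2 := by
      rw [le_div_iff₀ (by positivity)]
      linarith
    have e3 : g / h ≤ min 1 (n * γ * g) := by
      apply le_min
      · rwa [div_le_one hh0]
      · rw [div_le_iff₀ hh0]
        nlinarith [mul_le_mul_of_nonneg_left hc.le hg]
    have e4 : n ^ 2 * (1 / (2 * (n * γ))) ≤ n ^ 2 * (h / (n * γ * h + 1)) := by
      gcongr ?_ * ?_
      rw [div_le_div_iff₀ (by positivity) (by positivity)]
      nlinarith
    calc g * r ≤ g * ((a₀ + γ ^ 2 * h * P) / (γ * h) ^ 2) := mul_le_mul_of_nonneg_left e2 hg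
      _ = g / (γ * h) ^ 2 * a₀ + g / h * P := by field_simp
      _ ≤ 4 * (n ^ 2 * (1 / (2 * (n * γ)))) * a₀ + min 1 (n * γ * g) * P := by
          gcongr
          calc g / (γ * h) ^ 2 ≤ h / (γ * h) ^ 2 := by gcongr
            _ = 1 / (γ * (γ * h)) := by field_simp
            _ ≤ 4 * (n ^ 2 * (1 / (2 * (n * γ)))) := by
                have : 4 * (n ^ 2 * (1 / (2 * (n * γ)))) = 2 * n / γ := by field_simp; ring
                rw [this, div_le_div_iff₀ (by positivity) hγ]
                nlinarith
      _ ≤ 4 * (n ^ 2 * (h / (n * γ * h + 1))) * a₀ + 2 * P * min 1 (n * γ * g) := by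
          have : 0 ≤ min 1 (n * γ * g) * P := mul_nonneg (le_min zero_le_one (by positivity)) hP
          nlinarith [mul_le_mul_of_nonneg_right e4 ha]
      _ = _ := by ring

/-- The averaged error of a system of coupled contractions. -/
theorem averaged_error_le {ι : Type*} [Fintype ι] {h g : ι → ℝ} {a q r : ℕ → ι → ℝ}
    {γ α V : ℝ} (hγ : 0 < γ) (hα : 0 < α) (hV : 0 ≤ V) (hg : ∀ i, 0 ≤ g i) (hgh : ∀ i, g i ≤ h i)
    (hγh : ∀ i, γ * h i ≤ 1) (htr : γ * α * ∑ i, h i < 1) (ha : ∀ t i, 0 ≤ a t i)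
    (hrec : ∀ t i, a (t + 1) i ≤ (1 - 2 * γ * h i) * a t i +
      γ ^ 2 * h i * (3 / 2 * α * ∑ j, h j * a t j + V))
    (hq0 : ∀ i, q 0 i = 0) (hr0 : ∀ i, r 0 i = 0)
    (hq : ∀ t i, q (t + 1) i = (1 - γ * h i) * (q t i + a t i))
    (hr : ∀ t i, r (t + 1) i = r t i + 2 * q t i + a t i) {N : ℕ} (hN : 1 ≤ N) :
    (∑ i, g i * r N i) / (N : ℝ) ^ 2 ≤
      4 * ∑ i, h i * (1 / (N * γ)) / (h i + 1 / (N * γ)) * a 0 i +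
        (12 * α * ∑ i, h i * a 0 i + 8 * V) / N * ∑ i, min 1 (N * γ * g i) := by
  have hn : (0 : ℝ) < N := by exact_mod_cast hN
  have hh : ∀ i, 0 ≤ h i := fun i => (hg i).trans (hgh i)
  have hL : ∀ t, 0 ≤ ∑ j, h j * a t j := fun t =>
    Finset.sum_nonneg fun j _ => mul_nonneg (hh j) (ha t j)
  have hB : ∀ t, 0 ≤ 3 / 2 * α * ∑ j, h j * a t j + V := fun t => by
    have := hL t
    positivity
  obtain ⟨P, hP⟩ : ∃ P, P = ∑ t ∈ Finset.range N, (3 / 2 * α * ∑ j, h j * a t j + V) := ⟨_, rfl⟩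
  have hP0 : 0 ≤ P := hP ▸ Finset.sum_nonneg fun t _ => hB t
  have k1 := fun i => sum_le_of_contraction (a := fun t => a t i) hγ.le (hh i)
    (fun t => ha t i) hB (fun t => hrec t i) N
  rw [← hP] at k1
  have k2 := fun i => cum_le_of_contraction (a := fun t => a t i) (q := fun t => q t i)
    (r := fun t => r t i) (mul_nonneg hγ.le (hh i)) (hγh i) (fun t => ha t i) (hq0 i) (hr0 i)
    (fun t => hq t i) (fun t => hr t i) N
  -- One estimate for both regimes, split at `2 N γ h = 1`. The coefficient `γ/2` of `P` comes from
  -- the full contraction rate `2 γ h`.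
  have hA : ∀ i, h i * ∑ t ∈ Finset.range N, a t i ≤ N * (h i * a 0 i) + h i * (γ / 2 * P) := by
    intro i
    obtain ⟨c1, c2⟩ := k1 i
    rcases (hh i).eq_or_lt with h0 | h0
    · simp [← h0]
    rcases le_or_gt (2 * (N * (γ * h i))) 1 with hc | hc
    · calc _ ≤ h i * (N * (a 0 i + γ ^ 2 * h i * P)) := mul_le_mul_of_nonneg_left c2 (hh i)
        _ = N * (h i * a 0 i) + h i * (γ / 2 * P) * (2 * (N * (γ * h i))) := by ring
        _ ≤ _ := by
          have : 0 ≤ h i * (γ / 2 * P) := by positivity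
          nlinarith
    · have c3 : h i * ∑ t ∈ Finset.range N, a t i ≤ (a 0 i + γ ^ 2 * h i * P) / (2 * γ) := by
        rw [le_div_iff₀ (by positivity)]
        linarith
      refine c3.trans ?_
      have : (a 0 i + γ ^ 2 * h i * P) / (2 * γ) = a 0 i / (2 * γ) + h i * (γ / 2 * P) := by
        field_simp
      rw [this]
      gcongr
      rw [div_le_iff₀ (by positivity)]
      nlinarith [mul_le_mul_of_nonneg_left hc.le (ha 0 i)]
  have hPeq : P = 3 / 2 * α * ∑ i, h i * ∑ t ∈ Finset.range N, a t i + N * V := by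
    rw [hP, Finset.sum_add_distrib, ← Finset.mul_sum, Finset.sum_comm]
    simp [Finset.mul_sum]
  -- Closing the feedback loop: summing `hA` over directions makes the coefficient of `P` on the
  -- right `(3/4) γ α ∑ h`, at most `3/4`. Absorbing it costs a factor `4`.
  have hPle : P ≤ N * (6 * α * ∑ i, h i * a 0 i + 4 * V) := by
    have s1 := Finset.sum_le_sum fun i (_ : i ∈ Finset.univ) => hA i
    rw [Finset.sum_add_distrib, ← Finset.mul_sum, ← Finset.sum_mul] at s1
    have s2 := mul_le_mul_of_nonneg_left s1 (by positivity : 0 ≤ 3 / 2 * α)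
    have s3 := mul_le_mul_of_nonneg_right htr.le hP0
    nlinarith
  rw [Finset.sum_div]
  calc _ ≤ ∑ i, (4 * (h i * (1 / (N * γ)) / (h i + 1 / (N * γ)) * a 0 i) +
        2 * P / (N : ℝ) ^ 2 * min 1 (N * γ * g i)) :=
        Finset.sum_le_sum fun i _ => weighted_cum_le hγ (hg i) (hgh i) hn (ha 0 i) hP0
          (k1 i).1 (k1 i).2 (k2 i).1 (k2 i).2
    _ = 4 * ∑ i, h i * (1 / (N * γ)) / (h i + 1 / (N * γ)) * a 0 i +
        2 * P / (N : ℝ) ^ 2 * ∑ i, min 1 (N * γ * g i) := by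
        rw [Finset.sum_add_distrib, Finset.mul_sum, Finset.mul_sum]
    _ ≤ _ := by
        refine add_le_add_right (mul_le_mul_of_nonneg_right ?_ (Finset.sum_nonneg fun i _ =>
          le_min zero_le_one (mul_nonneg (by positivity) (hg i)))) _
        · rw [div_le_div_iff₀ (by positivity) hn]
          nlinarith [mul_le_mul_of_nonneg_right hPle hn.le]

end QuantSGD

namespace QuantSGD

section Risk

variable {p M : ℕ}

/-! ### The risk of the averaged iterate -/

/-- The excess risk `|Sᵀ v - w|²` in the norm of `H`. -/
noncomputable def excess (D : DataModel p) (S : Sketch M p) (w : Vec p) (v : Vec M) : ℝ :=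
  ((Matrix.of S)ᵀ *ᵥ v - w) ⬝ᵥ (D.H *ᵥ ((Matrix.of S)ᵀ *ᵥ v - w))

theorem measurable_quadForm {n : ℕ} (A : Matrix (Fin n) (Fin n) ℝ) :
    Measurable fun u : Vec n => u ⬝ᵥ (A *ᵥ u) := by
  simp only [dotProduct, mulVec]
  fun_prop

theorem excess_sum_sq {D : DataModel p} {q : Fin p → Vec p} {lam : Fin p → ℝ}
    (hd : Diagonal q lam D.H) (S : Sketch M p) (w : Vec p) (v : Vec M) :
    excess D S w v =
      ∑ j, lam j * ((Matrix.of S *ᵥ q j) ⬝ᵥ v - q j ⬝ᵥ w) ^ 2 := by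
  rw [excess, hd]
  refine Finset.sum_congr rfl fun j _ => ?_
  rw [dotProduct_sub, dotProduct_mulVec, ← mulVec_transpose, transpose_transpose, pow_two]

/-- By `½ (x + y)² ≤ x² + y²`, so the cross term between label noise and prediction error needs no
discussion. The full `σ²` is allowed in the final bound. -/
theorem risk_le (D : DataModel p) (hH : HasSecondMoment D.feature) (S : Sketch M p) (w : Vec p)
    (v : Vec M) : D.risk S w v ≤
      ∫⁻ z, ENNReal.ofReal ((z.2 - z.1 ⬝ᵥ w) ^ 2) ∂(D.sample w) +
        ENNReal.ofReal (excess D S w v) := by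
  obtain ⟨h1, h2⟩ := hH.integral_sq ((Matrix.of S)ᵀ *ᵥ v - w)
  have hm1 : Measurable fun z : Vec p × ℝ => ENNReal.ofReal ((z.2 - z.1 ⬝ᵥ w) ^ 2) := by
    simp only [dotProduct]
    fun_prop
  have hm2 : Measurable fun x : Vec p =>
      ENNReal.ofReal ((((Matrix.of S)ᵀ *ᵥ v - w) ⬝ᵥ x) ^ 2) :=
    ((measurable_dotProduct_left _).pow_const 2).ennreal_ofReal
  have hx : ∫⁻ z, ENNReal.ofReal ((((Matrix.of S)ᵀ *ᵥ v - w) ⬝ᵥ z.1) ^ 2) ∂(D.sample w) =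
      ENNReal.ofReal (excess D S w v) := by
    rw [lintegral_sample D w (g := fun z => ENNReal.ofReal ((((Matrix.of S)ᵀ *ᵥ v - w) ⬝ᵥ z.1) ^ 2))
      (hm2.comp measurable_fst)]
    simp only [lintegral_const, measure_univ, mul_one]
    rw [← ofReal_integral_eq_lintegral_ofReal h1
      (Filter.Eventually.of_forall fun _ => sq_nonneg _), h2]
    rfl
  rw [← hx, ← lintegral_add_left hm1, DataModel.risk]
  refine lintegral_mono fun z => ?_
  rw [← ENNReal.ofReal_add (sq_nonneg _) (sq_nonneg _)]
  refine ENNReal.ofReal_le_ofReal ?_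
  have : (Matrix.of S *ᵥ z.1) ⬝ᵥ v = ((Matrix.of S)ᵀ *ᵥ v) ⬝ᵥ z.1 := by
    rw [dotProduct_comm, dotProduct_mulVec, ← mulVec_transpose]
  rw [this, sub_dotProduct, dotProduct_comm z.1 w]
  nlinarith [sq_nonneg ((z.2 - w ⬝ᵥ z.1) + (((Matrix.of S)ᵀ *ᵥ v) ⬝ᵥ z.1 - w ⬝ᵥ z.1))]

theorem quadForm_add_le {n : ℕ} {q : Fin n → Vec n} {lam : Fin n → ℝ}
    {A : Matrix (Fin n) (Fin n) ℝ} (hd : Diagonal q lam A) (hl : ∀ j, 0 ≤ lam j) (x y : Vec n) :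
    (x + y) ⬝ᵥ (A *ᵥ (x + y)) ≤ 2 * (x ⬝ᵥ (A *ᵥ x)) + 2 * (y ⬝ᵥ (A *ᵥ y)) := by
  rw [hd, hd, hd, Finset.mul_sum, Finset.mul_sum, ← Finset.sum_add_distrib]
  refine Finset.sum_le_sum fun j _ => ?_
  simp only [dotProduct_add]
  nlinarith [mul_nonneg (hl j) (sq_nonneg (q j ⬝ᵥ x - q j ⬝ᵥ y))]

namespace Setting

variable {D : DataModel p} {Q : Quantizers p M} {ε : ErrorLevels} {S : Sketch M p}
  {α β σ σmin σmax : ℝ} {e : Fin M → Vec M} {h g : Fin M → ℝ}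

/-- The two fourth-moment inequalities for `A = e_i e_iᵀ`, tested at `e_i`, read `(1 + β) h_i² ≤ α
h_i²`. The step-size condition then also gives `γ h_i ≤ 1`. -/
theorem one_le_alpha (X : Setting D Q ε S α β σ σmin σmax e h g) {i : Fin M} (hi : 0 < h i) :
    1 ≤ α := by
  have hP : (vecMulVec (e i) (e i)).PosSemidef := by
    simpa using Matrix.posSemidef_vecMulVec_self_star (e i)
  have h1 := dotProduct_mulVec_le_of_le ((X.fourth.lower _ hP).trans (X.fourth.upper _ hP)) (e i)
  have ht : (Hf D Q S * vecMulVec (e i) (e i)).trace = h i := by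
    rw [mul_vecMulVec, trace_vecMulVec, dotProduct_comm, X.diag_h.apply_self X.frame]
  have hq : e i ⬝ᵥ ((Hf D Q S * vecMulVec (e i) (e i) * Hf D Q S) *ᵥ e i) = h i * h i := by
    rw [← mulVec_mulVec, ← mulVec_mulVec, vecMulVec_mulVec, X.diag_h.apply_self X.frame]
    simp only [mulVec_smul, dotProduct_smul, X.diag_h.apply_self X.frame, op_smul_eq_mul]
  rw [ht, add_mulVec, dotProduct_add, hq, smul_mulVec, smul_mulVec, dotProduct_smul,
    dotProduct_smul, X.diag_h.apply_self X.frame, smul_eq_mul, smul_eq_mul] at h1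
  have := X.beta_pos
  have h2 : 0 ≤ β * h i * h i := by positivity
  by_contra hcon
  push Not at hcon
  nlinarith [mul_pos hi hi]

theorem mul_h_le_one (X : Setting D Q ε S α β σ σmin σmax e h g) {γ : ℝ} (hγ : 0 < γ)
    (htr : γ * α * ∑ j, h j < 1) (i : Fin M) : γ * h i ≤ 1 := by
  rcases (X.h_nonneg i).eq_or_lt with h0 | h0
  · rw [← h0]; norm_num
  · have h1 := X.one_le_alpha h0
    have h2 : h i ≤ ∑ j, h j :=
      Finset.single_le_sum (fun j _ => X.h_nonneg j) (Finset.mem_univ i)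
    have h3 : γ * h i ≤ γ * ∑ j, h j := mul_le_mul_of_nonneg_left h2 hγ.le
    have h4 : 0 ≤ γ * h i := by positivity
    nlinarith

theorem averaged_error (X : Setting D Q ε S α β σ σmin σmax e h g) {γ : ℝ} (hγ : 0 < γ)
    (htr : γ * α * ∑ j, h j < 1) {N : ℕ} (hN : 1 ≤ N) {V : ℝ}
    (hV : V = 3 * σmax ^ 2 + (ε.p * (α * ∑ j, h j) + ε.a + ε.o)) :
    (∑ i, g i * ∫ z, cumErr D S e h N i z ^ 2 ∂(sgdLaw D Q S γ N)) / (N : ℝ) ^ 2 ≤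
      4 * ∑ i, h i * (1 / (N * γ)) / (h i + 1 / (N * γ)) *
          ∫ w, (e i ⬝ᵥ optVec D S e h w) ^ 2 ∂D.prior +
        (12 * α * ∑ i, h i * ∫ w, (e i ⬝ᵥ optVec D S e h w) ^ 2 ∂D.prior + 8 * V) / N *
          ∑ i, min 1 (N * γ * g i) := by
  have hm : Measurable fun w : Vec p => (w, ((0 : Vec M), (0 : Vec M))) := by fun_prop
  have ha0 : ∀ i, ∫ w, (e i ⬝ᵥ optVec D S e h w) ^ 2 ∂D.prior =
      ∫ z, stepErr D S e h i z ^ 2 ∂(sgdLaw D Q S γ 0) := fun i => by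
    rw [sgdLaw, integral_map hm.aemeasurable
      ((measurable_stepErr D S e h i).pow_const 2).aestronglyMeasurable]
    simp [stepErr]
  have hc0 : ∀ i, ∀ᵐ z ∂(sgdLaw D Q S γ 0), cumErr D S e h 0 i z = 0 := fun i => by
    rw [sgdLaw, ae_map_iff hm.aemeasurable
      (measurableSet_eq_fun (measurable_cumErr D S e h 0 i) measurable_const)]
    simp [cumErr]
  simp_rw [ha0]
  have hV0 : 0 ≤ V := by
    have h1 := X.additive.p.nonneg X.one_le_M
    have h2 := X.additive.a.nonneg
    have h3 := X.additive.o.nonneg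
    have h4 := X.alpha_pos
    have h5 : 0 ≤ ∑ j, h j := Finset.sum_nonneg fun j _ => X.h_nonneg j
    rw [hV]
    positivity
  refine averaged_error_le (h := h) (g := g)
    (a := fun t i => ∫ z, stepErr D S e h i z ^ 2 ∂(sgdLaw D Q S γ t))
    (q := fun t i => ∫ z, cumErr D S e h t i z * stepErr D S e h i z ∂(sgdLaw D Q S γ t))
    (r := fun t i => ∫ z, cumErr D S e h t i z ^ 2 ∂(sgdLaw D Q S γ t))
    hγ X.alpha_pos hV0 X.g_nonneg X.g_le_h (X.mul_h_le_one hγ htr) htr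
    (fun t i => integral_nonneg fun _ => sq_nonneg _) (fun t i => ?_) (fun i => ?_) (fun i => ?_)
    (fun t i => (X.moment_recursion γ t i).2.1) (fun t i => (X.moment_recursion γ t i).2.2) hN
  · refine (X.moment_recursion γ t i).1.trans_eq ?_
    rw [hV, X.diag_h.trace_eq X.frame]
    ring
  · refine integral_eq_zero_of_ae ?_
    filter_upwards [hc0 i] with z hz
    simp [hz]
  · refine integral_eq_zero_of_ae ?_
    filter_upwards [hc0 i] with z hz
    simp [hz]

theorem excess_eq (X : Setting D Q ε S α β σ σmin σmax e h g) (w : Vec p) (v : Vec M) :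
    excess D S w v =
      v ⬝ᵥ (sketchCov D S *ᵥ v) - 2 * (v ⬝ᵥ crossCov D S w) + w ⬝ᵥ (D.H *ᵥ w) := by
  have hH : D.Hᵀ = D.H := by
    have := X.cov.posDef.isHermitian.eq
    rwa [conjTranspose_eq_transpose_of_trivial] at this
  have e1 : v ⬝ᵥ crossCov D S w = ((Matrix.of S)ᵀ *ᵥ v) ⬝ᵥ (D.H *ᵥ w) := by
    rw [crossCov, dotProduct_mulVec, ← mulVec_transpose]
  have e2 : w ⬝ᵥ (D.H *ᵥ ((Matrix.of S)ᵀ *ᵥ v)) = ((Matrix.of S)ᵀ *ᵥ v) ⬝ᵥ (D.H *ᵥ w) := by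
    rw [dotProduct_mulVec, ← mulVec_transpose, hH, dotProduct_comm]
  rw [excess, dotProduct_sketchCov, e1, mulVec_sub, sub_dotProduct, dotProduct_sub,
    dotProduct_sub, e2]
  ring

theorem dot_crossCov_eq_sum (X : Setting D Q ε S α β σ σmin σmax e h g) (w : Vec p) (v : Vec M) :
    v ⬝ᵥ crossCov D S w = ∑ i, h i * ((e i ⬝ᵥ v) * (e i ⬝ᵥ optVec D S e h w)) := by
  rw [← X.Hf_optVec, X.diag_h]

theorem excess_nonneg (X : Setting D Q ε S α β σ σmin σmax e h g) (w : Vec p) (v : Vec M) :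
    0 ≤ excess D S w v := by
  have := X.cov.posDef.posSemidef.dotProduct_mulVec_nonneg ((Matrix.of S)ᵀ *ᵥ v - w)
  simpa [excess] using this

/-- The quantized risk of `optVec` is nonnegative: it dominates the true excess risk there, because
`S H Sᵀ ⪯ H_f`. -/
theorem sum_mul_optVec_sq_le (X : Setting D Q ε S α β σ σmin σmax e h g) (w : Vec p) :
    ∑ i, h i * (e i ⬝ᵥ optVec D S e h w) ^ 2 ≤ w ⬝ᵥ (D.H *ᵥ w) := by
  obtain ⟨y, hy⟩ : ∃ y, y = optVec D S e h w := ⟨_, rfl⟩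
  have h1 := (quadForm_Hf X.one_le_M X.one_le_p X.unbiased X.additive X.cov y).1
  have h2 := X.excess_nonneg w y
  rw [X.diag_h] at h1
  rw [X.excess_eq, X.dot_crossCov_eq_sum, ← hy] at h2
  rw [← hy]
  simp only [pow_two]
  linarith

/-- The minimal quantized risk compared with the regularized risk of a trial vector. -/
theorem bias_le (X : Setting D Q ε S α β σ σmin σmax e h g) {lam : ℝ} (hlam : 0 < lam)
    (w : Vec p) (u : Vec M) :
    ∑ i, h i * lam / (h i + lam) * (e i ⬝ᵥ optVec D S e h w) ^ 2 +
        excess D S w (optVec D S e h w) ≤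
      excess D S w u + ε.d * (((Matrix.of S)ᵀ *ᵥ u) ⬝ᵥ ((Matrix.of S)ᵀ *ᵥ u)) +
        (lam + (ε.s * (D.H.trace + ε.d * p) + ε.f)) * (u ⬝ᵥ u) := by
  obtain ⟨y, hy⟩ : ∃ y, y = optVec D S e h w := ⟨_, rfl⟩
  have h1 := (quadForm_Hf X.one_le_M X.one_le_p X.unbiased X.additive X.cov y).1
  have h2 := (quadForm_Hf X.one_le_M X.one_le_p X.unbiased X.additive X.cov u).2
  rw [X.diag_h] at h1 h2
  rw [X.excess_eq, X.excess_eq, X.dot_crossCov_eq_sum, X.dot_crossCov_eq_sum, ← hy]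
  -- Coordinatewise, the minimum of `h (u - y)² + λ u²` over `u` is `h λ / (h + λ) y²`. The
  -- comparison `S H Sᵀ ⪯ H_f` is then applied to `y`, and the upper bound on `H_f` to `u`.
  have key : ∑ i, h i * lam / (h i + lam) * (e i ⬝ᵥ y) ^ 2 ≤
      ∑ i, h i * ((e i ⬝ᵥ u) * (e i ⬝ᵥ u)) - 2 * ∑ i, h i * ((e i ⬝ᵥ u) * (e i ⬝ᵥ y)) +
        ∑ i, h i * ((e i ⬝ᵥ y) * (e i ⬝ᵥ y)) + lam * (u ⬝ᵥ u) := by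
    rw [X.frame.dot u u, Finset.mul_sum, Finset.mul_sum, ← Finset.sum_sub_distrib,
      ← Finset.sum_add_distrib, ← Finset.sum_add_distrib]
    refine Finset.sum_le_sum fun i _ => ?_
    have hi := X.h_nonneg i
    rw [div_mul_eq_mul_div, div_le_iff₀ (by positivity)]
    nlinarith [sq_nonneg (h i * (e i ⬝ᵥ u - e i ⬝ᵥ y) + lam * (e i ⬝ᵥ u))]
  linarith

end Setting

end Risk

end QuantSGD

namespace QuantSGD

/-! ### Averaging over the isotropic target, and the risk bound with a linear trial predictor -/

section Risk

variable {p M : ℕ}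

theorem DataModel.IsotropicPrior.integral_sq {D : DataModel p} (hD : D.IsotropicPrior)
    (y : Vec p) :
    Integrable (fun w => (y ⬝ᵥ w) ^ 2) D.prior ∧ ∫ w, (y ⬝ᵥ w) ^ 2 ∂D.prior = y ⬝ᵥ y := by
  have := hD.1.integral_sq y
  rwa [hD.2, one_mulVec] at this

theorem DataModel.IsotropicPrior.integral_sum_sq {D : DataModel p} (hD : D.IsotropicPrior)
    {ι : Type*} [Fintype ι] (c : ι → ℝ) (y : ι → Vec p) :
    Integrable (fun w => ∑ j, c j * (y j ⬝ᵥ w) ^ 2) D.prior ∧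
      ∫ w, ∑ j, c j * (y j ⬝ᵥ w) ^ 2 ∂D.prior = ∑ j, c j * (y j ⬝ᵥ y j) := by
  have hi : ∀ j ∈ Finset.univ, Integrable (fun w => c j * (y j ⬝ᵥ w) ^ 2) D.prior :=
    fun j _ => (hD.integral_sq (y j)).1.const_mul _
  refine ⟨integrable_finsetSum _ hi, ?_⟩
  rw [integral_finsetSum _ hi]
  refine Finset.sum_congr rfl fun j _ => ?_
  rw [integral_const_mul, (hD.integral_sq (y j)).2]

/-- The trial risk: the expectation of the regularized risk of the linear predictor `K w`, where
`q`, `lam` diagonalize `H`, with ridge parameter `r` and data quantization level `d`. -/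
noncomputable def trialRisk (S : Sketch M p) (q : Fin p → Vec p) (lam : Fin p → ℝ)
    (K : Matrix (Fin M) (Fin p) ℝ) (d r : ℝ) : ℝ :=
  ∑ j, lam j * ((Kᵀ *ᵥ (Matrix.of S *ᵥ q j) - q j) ⬝ᵥ (Kᵀ *ᵥ (Matrix.of S *ᵥ q j) - q j)) +
    d * ∑ j, (Kᵀ *ᵥ (Matrix.of S *ᵥ q j)) ⬝ᵥ (Kᵀ *ᵥ (Matrix.of S *ᵥ q j)) +
    r * (K * Kᵀ).trace

/-- Isotropy turns each `E⟨y, w⟩²` into `|y|²`; all three terms are sums of such squares after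
expansion in the eigenbasis of `H` or along the rows of `K`. -/
theorem integral_trial {D : DataModel p} (hD : D.IsotropicPrior) {q : Fin p → Vec p}
    {lam : Fin p → ℝ} (hq : Frame q) (hd : Diagonal q lam D.H) (S : Sketch M p)
    (K : Matrix (Fin M) (Fin p) ℝ) (d r : ℝ) :
    Integrable (fun w => excess D S w (K *ᵥ w) +
      d * (((Matrix.of S)ᵀ *ᵥ (K *ᵥ w)) ⬝ᵥ ((Matrix.of S)ᵀ *ᵥ (K *ᵥ w))) +
      r * ((K *ᵥ w) ⬝ᵥ (K *ᵥ w))) D.prior ∧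
    ∫ w, (excess D S w (K *ᵥ w) +
      d * (((Matrix.of S)ᵀ *ᵥ (K *ᵥ w)) ⬝ᵥ ((Matrix.of S)ᵀ *ᵥ (K *ᵥ w))) +
      r * ((K *ᵥ w) ⬝ᵥ (K *ᵥ w))) ∂D.prior = trialRisk S q lam K d r := by
  have hy : ∀ (w : Vec p) (x : Vec M), x ⬝ᵥ (K *ᵥ w) = (Kᵀ *ᵥ x) ⬝ᵥ w := fun w x => by
    rw [dotProduct_mulVec, ← mulVec_transpose]
  have e1 : ∀ w, excess D S w (K *ᵥ w) =
      ∑ j, lam j * ((Kᵀ *ᵥ (Matrix.of S *ᵥ q j) - q j) ⬝ᵥ w) ^ 2 := fun w => by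
    rw [excess_sum_sq hd]
    refine Finset.sum_congr rfl fun j _ => ?_
    rw [hy, sub_dotProduct]
  have e2 : ∀ w, d * (((Matrix.of S)ᵀ *ᵥ (K *ᵥ w)) ⬝ᵥ ((Matrix.of S)ᵀ *ᵥ (K *ᵥ w))) =
      ∑ j, d * ((Kᵀ *ᵥ (Matrix.of S *ᵥ q j)) ⬝ᵥ w) ^ 2 := fun w => by
    rw [hq.dot, Finset.mul_sum]
    refine Finset.sum_congr rfl fun j _ => ?_
    rw [dotProduct_mulVec (q j), ← mulVec_transpose, transpose_transpose, hy, pow_two]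
  have e3 : ∀ w, r * ((K *ᵥ w) ⬝ᵥ (K *ᵥ w)) = ∑ m, r * (K m ⬝ᵥ w) ^ 2 := fun w => by
    rw [← Finset.mul_sum]
    simp [dotProduct, mulVec, pow_two]
  simp_rw [e1, e2, e3]
  obtain ⟨i1, j1⟩ := hD.integral_sum_sq lam fun j => Kᵀ *ᵥ (Matrix.of S *ᵥ q j) - q j
  obtain ⟨i2, j2⟩ := hD.integral_sum_sq (fun _ => d) fun j => Kᵀ *ᵥ (Matrix.of S *ᵥ q j)
  obtain ⟨i3, j3⟩ := hD.integral_sum_sq (fun _ => r) fun m => K m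
  have i12 : Integrable (fun w => ∑ j, lam j * ((Kᵀ *ᵥ (Matrix.of S *ᵥ q j) - q j) ⬝ᵥ w) ^ 2 +
    ∑ j, d * ((Kᵀ *ᵥ (Matrix.of S *ᵥ q j)) ⬝ᵥ w) ^ 2) D.prior := i1.add i2
  refine ⟨i12.add i3, ?_⟩
  rw [integral_add i12 i3, integral_add i1 i2, j1, j2, j3, trialRisk, Finset.mul_sum,
    ← Finset.mul_sum _ _ r]
  simp [Matrix.trace, Matrix.mul_apply, dotProduct]

namespace Setting

variable {D : DataModel p} {Q : Quantizers p M} {ε : ErrorLevels} {S : Sketch M p}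
  {α β σ σmin σmax : ℝ} {e : Fin M → Vec M} {h g : Fin M → ℝ}

theorem measurable_excess_optVec (D : DataModel p) (S : Sketch M p) (e : Fin M → Vec M)
    (h : Fin M → ℝ) : Measurable fun w => excess D S w (optVec D S e h w) := by
  have h1 : Measurable fun w : Vec p => (Matrix.of S)ᵀ *ᵥ optVec D S e h w - w := by
    refine Measurable.sub ?_ measurable_id
    have : Measurable fun v : Vec M => (Matrix.of S)ᵀ *ᵥ v := by
      refine measurable_pi_lambda _ fun i => ?_
      simp only [mulVec, dotProduct]
      fun_prop
    exact this.comp (measurable_optVec D S e h)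
  exact (measurable_quadForm D.H).comp h1

/-- `bias_le` is integrated with `u = K w`. It also dominates the excess risk of the optimum, which
gives its integrability. The last bound handles the initial error that enters the variance. -/
theorem integral_bias (X : Setting D Q ε S α β σ σmin σmax e h g) {lam₀ : ℝ} (h0 : 0 < lam₀)
    {q : Fin p → Vec p} {lam : Fin p → ℝ} (hq : Frame q) (hd : Diagonal q lam D.H)
    (K : Matrix (Fin M) (Fin p) ℝ) :
    Integrable (fun w => excess D S w (optVec D S e h w)) D.prior ∧
    ∑ i, h i * lam₀ / (h i + lam₀) * ∫ w, (e i ⬝ᵥ optVec D S e h w) ^ 2 ∂D.prior +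
        ∫ w, excess D S w (optVec D S e h w) ∂D.prior ≤
      trialRisk S q lam K ε.d (lam₀ + (ε.s * (D.H.trace + ε.d * p) + ε.f)) ∧
    ∑ i, h i * ∫ w, (e i ⬝ᵥ optVec D S e h w) ^ 2 ∂D.prior ≤ D.H.trace := by
  obtain ⟨t1, t2⟩ := integral_trial X.isotropic hq hd S K ε.d
    (lam₀ + (ε.s * (D.H.trace + ε.d * p) + ε.f))
  have hs : ∀ c : Fin M → ℝ, ∀ i ∈ Finset.univ,
      Integrable (fun w => c i * (e i ⬝ᵥ optVec D S e h w) ^ 2) D.prior := fun c i _ =>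
    (X.memLp_optVec i).integrable_sq.const_mul _
  have hs' : ∀ c : Fin M → ℝ,
      Integrable (fun w => ∑ i, c i * (e i ⬝ᵥ optVec D S e h w) ^ 2) D.prior := fun c =>
    integrable_finsetSum _ (hs c)
  have hb := fun w => X.bias_le h0 w (K *ᵥ w)
  have hex : Integrable (fun w => excess D S w (optVec D S e h w)) D.prior := by
    refine t1.mono' (measurable_excess_optVec D S e h).aestronglyMeasurable
      (Filter.Eventually.of_forall fun w => ?_)
    rw [Real.norm_of_nonneg (X.excess_nonneg w _)]
    refine le_trans ?_ (hb w)
    refine le_add_of_nonneg_left (Finset.sum_nonneg fun i _ => ?_)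
    have := X.h_nonneg i
    positivity
  refine ⟨hex, ?_, ?_⟩
  · rw [← t2]
    have := integral_mono ((hs' fun i => h i * lam₀ / (h i + lam₀)).add hex) t1 hb
    simp only [Pi.add_apply] at this
    rw [integral_add (hs' fun i => h i * lam₀ / (h i + lam₀)) hex,
      integral_finsetSum _ (hs fun i => h i * lam₀ / (h i + lam₀))] at this
    simpa only [integral_const_mul] using this
  · have hH : Integrable (fun w => ∑ j, lam j * (q j ⬝ᵥ w) ^ 2) D.prior ∧
        ∫ w, ∑ j, lam j * (q j ⬝ᵥ w) ^ 2 ∂D.prior = D.H.trace := by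
      have := X.isotropic.integral_sum_sq lam q
      simpa [hq.orth, hd.trace_eq hq] using this
    rw [← hH.2]
    have := integral_mono (hs' h) hH.1 fun w => by
      refine (X.sum_mul_optVec_sq_le w).trans_eq ?_
      rw [hd]
      exact Finset.sum_congr rfl fun j _ => by rw [pow_two]
    rw [integral_finsetSum _ (hs h)] at this
    simpa only [integral_const_mul] using this

/-- The risk bound for a fixed sketch, in terms of an arbitrary linear trial predictor. -/
theorem expectedRisk_le (X : Setting D Q ε S α β σ σmin σmax e h g) {γ : ℝ} (hγ : 0 < γ)
    (htr : γ * α * ∑ j, h j < 1) {N : ℕ} (hN : 1 ≤ N) {V : ℝ}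
    (hV : V = 3 * σmax ^ 2 + (ε.p * (α * ∑ j, h j) + ε.a + ε.o))
    {q : Fin p → Vec p} {lam : Fin p → ℝ} (hq : Frame q) (hd : Diagonal q lam D.H)
    (K : Matrix (Fin M) (Fin p) ℝ) :
    expectedRisk D Q S γ N ≤ ENNReal.ofReal (σ ^ 2 +
      8 * trialRisk S q lam K ε.d (1 / (N * γ) + (ε.s * (D.H.trace + ε.d * p) + ε.f)) +
      (24 * α * D.H.trace + 16 * V) / N * ∑ i, min 1 (N * γ * g i)) := by
  have hn : (0 : ℝ) < N := by exact_mod_cast hN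
  obtain ⟨b0, b1, b2⟩ := X.integral_bias (lam₀ := 1 / (N * γ)) (by positivity) hq hd K
  have b3 := X.averaged_error hγ htr hN hV
  have hlam : ∀ j, 0 ≤ lam j := fun j => by
    rw [← hd.apply_self hq]
    simpa using X.cov.posDef.posSemidef.dotProduct_mulVec_nonneg (q j)
  -- The averaged iterate is compared with the quantized optimum. Its deviation is measured by `S H
  -- Sᵀ`, hence by the eigenvalues `g`, although the dynamics is governed by `h`.
  have hpt : ∀ z : Vec p × (Vec M × Vec M), excess D S z.1 ((N : ℝ)⁻¹ • z.2.2) ≤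
      ∑ i, 2 / (N : ℝ) ^ 2 * g i * cumErr D S e h N i z ^ 2 +
        2 * excess D S z.1 (optVec D S e h z.1) := by
    intro z
    have hsplit : (Matrix.of S)ᵀ *ᵥ ((N : ℝ)⁻¹ • z.2.2) - z.1 =
        (Matrix.of S)ᵀ *ᵥ ((N : ℝ)⁻¹ • z.2.2 - optVec D S e h z.1) +
          ((Matrix.of S)ᵀ *ᵥ optVec D S e h z.1 - z.1) := by
      rw [mulVec_sub]
      abel
    rw [excess, hsplit]
    refine (quadForm_add_le hd hlam _ _).trans_eq ?_
    rw [← dotProduct_sketchCov, X.diag_g, Finset.mul_sum]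
    congr 1
    refine Finset.sum_congr rfl fun i _ => ?_
    rw [cumErr, dotProduct_sub, dotProduct_smul, smul_eq_mul]
    field_simp
  have hmap := map_fst_sgdLaw D Q S γ N
  have iex : Integrable (fun z : Vec p × (Vec M × Vec M) =>
      2 * excess D S z.1 (optVec D S e h z.1)) (sgdLaw D Q S γ N) := by
    have := b0
    rw [← hmap] at this
    exact (this.comp_measurable measurable_fst).const_mul 2
  have hex : ∫ z, excess D S z.1 (optVec D S e h z.1) ∂(sgdLaw D Q S γ N) =
      ∫ w, excess D S w (optVec D S e h w) ∂D.prior := by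
    rw [← hmap, integral_map measurable_fst.aemeasurable
      (measurable_excess_optVec D S e h).aestronglyMeasurable]
  have ic : ∀ i ∈ Finset.univ, Integrable (fun z => 2 / (N : ℝ) ^ 2 * g i *
      cumErr D S e h N i z ^ 2) (sgdLaw D Q S γ N) := fun i _ =>
    (X.memLp_state γ N i).2.integrable_sq.const_mul _
  have ics : Integrable (fun z => ∑ i, 2 / (N : ℝ) ^ 2 * g i * cumErr D S e h N i z ^ 2)
      (sgdLaw D Q S γ N) := integrable_finsetSum _ ic
  have iall : Integrable (fun z => ∑ i, 2 / (N : ℝ) ^ 2 * g i * cumErr D S e h N i z ^ 2 +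
      2 * excess D S z.1 (optVec D S e h z.1)) (sgdLaw D Q S γ N) := ics.add iex
  have hmn : Measurable fun w => ∫⁻ z, ENNReal.ofReal ((z.2 - z.1 ⬝ᵥ w) ^ 2) ∂(D.sample w) := by
    have : Measurable fun x : Vec p × (Vec p × ℝ) =>
        ENNReal.ofReal ((x.2.2 - x.2.1 ⬝ᵥ x.1) ^ 2) := by
      simp only [dotProduct]
      fun_prop
    exact this.lintegral_kernel_prod_right'
  have hnoise : ∫⁻ z, ∫⁻ x, ENNReal.ofReal ((x.2 - x.1 ⬝ᵥ z.1) ^ 2) ∂(D.sample z.1)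
      ∂(sgdLaw D Q S γ N) = ENNReal.ofReal (σ ^ 2) := by
    rw [← X.wellSpecified.noise, Measure.lintegral_compProd (by simp only [dotProduct]; fun_prop),
      ← hmap, lintegral_map hmn measurable_fst]
  have hE : 0 ≤ ∫ z, (∑ i, 2 / (N : ℝ) ^ 2 * g i * cumErr D S e h N i z ^ 2 +
      2 * excess D S z.1 (optVec D S e h z.1)) ∂(sgdLaw D Q S γ N) :=
    integral_nonneg fun z => (X.excess_nonneg _ _).trans (hpt z)
  calc expectedRisk D Q S γ N
      ≤ ∫⁻ z, (∫⁻ x, ENNReal.ofReal ((x.2 - x.1 ⬝ᵥ z.1) ^ 2) ∂(D.sample z.1) +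
        ENNReal.ofReal (∑ i, 2 / (N : ℝ) ^ 2 * g i * cumErr D S e h N i z ^ 2 +
          2 * excess D S z.1 (optVec D S e h z.1))) ∂(sgdLaw D Q S γ N) :=
        lintegral_mono fun z => (risk_le D X.cov.data S z.1 _).trans
          (add_le_add_right (ENNReal.ofReal_le_ofReal (hpt z)) _)
    _ = ENNReal.ofReal (σ ^ 2 + ∫ z, (∑ i, 2 / (N : ℝ) ^ 2 * g i * cumErr D S e h N i z ^ 2 +
          2 * excess D S z.1 (optVec D S e h z.1)) ∂(sgdLaw D Q S γ N)) := by
        have hmn' : Measurable fun z : Vec p × (Vec M × Vec M) =>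
            ∫⁻ x, ENNReal.ofReal ((x.2 - x.1 ⬝ᵥ z.1) ^ 2) ∂(D.sample z.1) :=
          hmn.comp measurable_fst
        rw [lintegral_add_left hmn', hnoise,
          ← ofReal_integral_eq_lintegral_ofReal iall (Filter.Eventually.of_forall fun z =>
            (X.excess_nonneg _ _).trans (hpt z)), ENNReal.ofReal_add (sq_nonneg _) hE]
    _ ≤ _ := by
        refine ENNReal.ofReal_le_ofReal ?_
        rw [integral_add ics iex, integral_finsetSum _ ic, integral_const_mul 2, hex]
        simp only [integral_const_mul]
        have hexn : 0 ≤ ∫ w, excess D S w (optVec D S e h w) ∂D.prior :=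
          integral_nonneg fun w => X.excess_nonneg _ _
        have hsum : ∑ i, 2 / (N : ℝ) ^ 2 * g i *
            ∫ z, cumErr D S e h N i z ^ 2 ∂(sgdLaw D Q S γ N) =
            2 * ((∑ i, g i * ∫ z, cumErr D S e h N i z ^ 2 ∂(sgdLaw D Q S γ N)) / (N : ℝ) ^ 2) := by
          rw [Finset.sum_div, Finset.mul_sum]
          exact Finset.sum_congr rfl fun i _ => by ring
        have hmin : 0 ≤ ∑ i, min 1 (N * γ * g i) := Finset.sum_nonneg fun i _ =>
          le_min zero_le_one (mul_nonneg (by positivity) (X.g_nonneg i))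
        have hα := X.alpha_pos
        have hfac : (12 * α * ∑ i, h i * ∫ w, (e i ⬝ᵥ optVec D S e h w) ^ 2 ∂D.prior + 8 * V) / N *
            ∑ i, min 1 (N * γ * g i) ≤
            (12 * α * D.H.trace + 8 * V) / N * ∑ i, min 1 (N * γ * g i) := by
          gcongr
        have hdbl : (24 * α * D.H.trace + 16 * V) / N * ∑ i, min 1 (N * γ * g i) =
            2 * ((12 * α * D.H.trace + 8 * V) / N * ∑ i, min 1 (N * γ * g i)) := by ring
        rw [hsum, hdbl]
        linarith

end Setting

end Risk

end QuantSGD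

namespace QuantSGD

/-! ### The trial predictor -/

section Trial

variable {p M : ℕ}

/-- With `x = G⁻¹ z`, the hypothesis reads `c² |x|² ≤ x ⬝ᵥ z`, and `|z - c² x|² ≥ 0` does the rest.
No spectral decomposition of `G` is needed. -/
theorem sq_mul_dotProduct_inv_mulVec_le {k : ℕ} {G : Matrix (Fin k) (Fin k) ℝ} {c : ℝ}
    (hG : ∀ x : Vec k, c ^ 2 * (x ⬝ᵥ x) ≤ x ⬝ᵥ (G *ᵥ x)) (hu : IsUnit G.det) (z : Vec k) :
    c ^ 2 * ((G⁻¹ *ᵥ z) ⬝ᵥ z) ≤ z ⬝ᵥ z := by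
  obtain ⟨x, hx⟩ : ∃ x, x = G⁻¹ *ᵥ z := ⟨_, rfl⟩
  have hGx : G *ᵥ x = z := by
    rw [hx, mulVec_mulVec, mul_nonsing_inv _ hu, one_mulVec]
  have h1 := hG x
  rw [hGx] at h1
  rw [← hx]
  have h2 : 0 ≤ (z - c ^ 2 • x) ⬝ᵥ (z - c ^ 2 • x) := dotProduct_self_nonneg' _
  simp only [sub_dotProduct, dotProduct_sub, smul_dotProduct, dotProduct_smul, smul_eq_mul,
    dotProduct_comm z x] at h2
  nlinarith [mul_le_mul_of_nonneg_left h1 (sq_nonneg c)]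

/-- A right inverse of the sketch of a subspace on which the sketch is bounded below. -/
theorem exists_trial {k : ℕ} {S : Sketch M p} {q : Fin k → Vec p}
    (hq : ∀ i j, q i ⬝ᵥ q j = if i = j then 1 else 0) {c : ℝ} (hc : 0 < c)
    (hS : ∀ x, c * ‖x‖ ≤ ‖sketchMap S q x‖) :
    ∃ K : Matrix (Fin M) (Fin p) ℝ, (∀ i, Kᵀ *ᵥ (Matrix.of S *ᵥ q i) = q i) ∧
      (∀ y, c ^ 2 * ((Kᵀ *ᵥ y) ⬝ᵥ (Kᵀ *ᵥ y)) ≤ y ⬝ᵥ y) ∧ c ^ 2 * (K * Kᵀ).trace ≤ k := by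
  obtain ⟨A, hA⟩ : ∃ A : Matrix (Fin p) (Fin k) ℝ, A = Matrix.of fun a i => q i a := ⟨_, rfl⟩
  have hAq : ∀ i, A *ᵥ Pi.single i 1 = q i := fun i => by
    ext a
    simp [hA]
  have hAA : Aᵀ * A = 1 := by
    ext i j
    rw [Matrix.one_apply, ← hq i j]
    simp [hA, Matrix.mul_apply, dotProduct]
  obtain ⟨B, hB⟩ : ∃ B, B = Matrix.of S * A := ⟨_, rfl⟩
  obtain ⟨G, hGdef⟩ : ∃ G, G = Bᵀ * B := ⟨_, rfl⟩
  have hBB : ∀ x, (B *ᵥ x) ⬝ᵥ (B *ᵥ x) = x ⬝ᵥ (G *ᵥ x) := fun x => by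
    rw [hGdef, ← mulVec_mulVec, dotProduct_mulVec x, ← mulVec_transpose, transpose_transpose]
  have hG : ∀ x : Vec k, c ^ 2 * (x ⬝ᵥ x) ≤ x ⬝ᵥ (G *ᵥ x) := by
    intro x
    have h1 := hS (WithLp.toLp 2 x)
    have h2 := pow_le_pow_left₀ (by positivity) h1 2
    rw [mul_pow, norm_sketchMap_sq, EuclideanSpace.norm_sq_eq] at h2
    have h3 : comb q (WithLp.toLp 2 x) = A *ᵥ x := by
      ext a
      simp [comb_apply, hA, mulVec, dotProduct, mul_comm]
    rw [h3, sketchSq, mulVec_mulVec, ← hB, hBB] at h2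
    simpa [dotProduct, pow_two] using h2
  have hu : IsUnit G := by
    rw [← mulVec_injective_iff_isUnit]
    intro x y hxy
    have h1 := hG (x - y)
    have hxy' : G *ᵥ (x - y) = 0 := by rw [mulVec_sub]; exact sub_eq_zero.mpr hxy
    rw [hxy', dotProduct_zero] at h1
    have h2 : (x - y) ⬝ᵥ (x - y) = 0 := by
      have := dotProduct_self_nonneg' (x - y)
      have hc2 : 0 < c ^ 2 := by positivity
      nlinarith
    exact sub_eq_zero.mp (dotProduct_self_eq_zero.mp h2)
  have hdet : IsUnit G.det := (isUnit_iff_isUnit_det G).mp hu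
  have hGT : Gᵀ = G := by rw [hGdef, transpose_mul, transpose_transpose]
  have hGiT : (G⁻¹)ᵀ = G⁻¹ := by rw [transpose_nonsing_inv, hGT]
  have hK : (B * G⁻¹ * Aᵀ)ᵀ = A * G⁻¹ * Bᵀ := by
    rw [transpose_mul, transpose_mul, transpose_transpose, hGiT, Matrix.mul_assoc]
  have hVV : G⁻¹ * Bᵀ * (B * G⁻¹) = G⁻¹ := by
    rw [Matrix.mul_assoc, ← Matrix.mul_assoc Bᵀ, ← hGdef, mul_nonsing_inv _ hdet, Matrix.mul_one]
  -- Thus `Kᵀ = A (BᵀB)⁻¹ Bᵀ` is the pseudo-inverse of the restricted sketch `B = S A`, followed by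
  -- the isometric embedding `A`. Its norm is at most `1/c`, and `tr (K Kᵀ) = tr G⁻¹`.
  refine ⟨B * G⁻¹ * Aᵀ, fun i => ?_, fun y => ?_, ?_⟩
  · rw [hK]
    have : Matrix.of S *ᵥ q i = B *ᵥ Pi.single i 1 := by rw [hB, ← mulVec_mulVec, hAq]
    rw [this, mulVec_mulVec, Matrix.mul_assoc, ← hGdef, Matrix.mul_assoc,
      nonsing_inv_mul _ hdet, Matrix.mul_one, hAq]
  · rw [hK]
    obtain ⟨z, hz⟩ : ∃ z, z = (G⁻¹ * Bᵀ) *ᵥ y := ⟨_, rfl⟩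
    have h1 : (A * G⁻¹ * Bᵀ) *ᵥ y = A *ᵥ z := by rw [hz, mulVec_mulVec, Matrix.mul_assoc]
    have h2 : (A *ᵥ z) ⬝ᵥ (A *ᵥ z) = z ⬝ᵥ z := by
      rw [dotProduct_mulVec, ← mulVec_transpose, mulVec_mulVec, hAA, one_mulVec]
    rw [h1, h2]
    obtain ⟨u, hu⟩ : ∃ u, u = (B * G⁻¹) *ᵥ z := ⟨_, rfl⟩
    have h3 : u ⬝ᵥ y = z ⬝ᵥ z := by
      rw [hu, dotProduct_comm, dotProduct_mulVec, ← mulVec_transpose, transpose_mul, hGiT, ← hz]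
    have h4 : c ^ 2 * (u ⬝ᵥ u) ≤ z ⬝ᵥ z := by
      have : u ⬝ᵥ u = (G⁻¹ *ᵥ z) ⬝ᵥ z := by
        rw [hu, dotProduct_mulVec, ← mulVec_transpose, mulVec_mulVec, transpose_mul, hGiT, hVV]
      rw [this]
      exact sq_mul_dotProduct_inv_mulVec_le hG hdet z
    have h5 : 0 ≤ (y - c ^ 2 • u) ⬝ᵥ (y - c ^ 2 • u) := dotProduct_self_nonneg' _
    simp only [sub_dotProduct, dotProduct_sub, smul_dotProduct, dotProduct_smul, smul_eq_mul,
      dotProduct_comm y u, h3] at h5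
    nlinarith [mul_le_mul_of_nonneg_left h4 (sq_nonneg c)]
  · rw [hK, trace_mul_comm, Matrix.mul_assoc, Matrix.mul_assoc, ← Matrix.mul_assoc Bᵀ,
      trace_mul_comm, ← Matrix.mul_assoc Bᵀ, ← hGdef]
    have : G⁻¹ * (G * G⁻¹ * Aᵀ) * A = G⁻¹ := by
      rw [mul_nonsing_inv _ hdet, Matrix.one_mul, Matrix.mul_assoc, hAA, Matrix.mul_one]
    rw [this, Matrix.trace, Finset.mul_sum]
    refine (Finset.sum_le_card_nsmul _ _ 1 fun i _ => ?_).trans_eq (by simp)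
    have := sq_mul_dotProduct_inv_mulVec_le hG hdet (Pi.single i 1)
    simpa using this

/-- The first `k` eigendirections are reproduced exactly. A tail direction costs at most `2 + 2 c⁻²
|S q_j|²` by the norm bound on `Kᵀ`. -/
theorem trialRisk_le {S : Sketch M p} {q : Fin p → Vec p} (hq : Frame q) {lam : Fin p → ℝ}
    (hlam : ∀ j, 0 ≤ lam j) {k : ℕ} (hk : k ≤ p) {c : ℝ} (hc : 0 < c)
    (hS : ∀ x, c * ‖x‖ ≤ ‖sketchMap S (fun i : Fin k => q (Fin.castLE hk i)) x‖)
    {d r : ℝ} (hd : 0 ≤ d) (hr : 0 ≤ r) :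
    ∃ K, trialRisk S q lam K d r ≤
      2 * ∑ j : Fin p, (if k ≤ j then lam j else 0) +
      (c ^ 2)⁻¹ * (2 * ∑ j : Fin p, (if k ≤ j then lam j else 0) * sketchSq S (q j) +
        d * ∑ j, sketchSq S (q j) + r * k) := by
  obtain ⟨K, h1, h2, h3⟩ := exists_trial (fun i j => by
    rw [hq.orth]; simp only [Fin.ext_iff, Fin.val_castLE]) hc hS
  have hc2 : 0 < c ^ 2 := by positivity
  have h2' : ∀ y, (Kᵀ *ᵥ y) ⬝ᵥ (Kᵀ *ᵥ y) ≤ (c ^ 2)⁻¹ * (y ⬝ᵥ y) := fun y => by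
    rw [inv_mul_eq_div, le_div_iff₀ hc2]
    linarith [h2 y]
  have h3' : (K * Kᵀ).trace ≤ (c ^ 2)⁻¹ * k := by
    rw [inv_mul_eq_div, le_div_iff₀ hc2]
    linarith
  refine ⟨K, ?_⟩
  have e1 : ∑ j, lam j * ((Kᵀ *ᵥ (Matrix.of S *ᵥ q j) - q j) ⬝ᵥ
      (Kᵀ *ᵥ (Matrix.of S *ᵥ q j) - q j)) ≤
      ∑ j : Fin p, (2 * (if k ≤ j then lam j else 0) +
        (c ^ 2)⁻¹ * (2 * ((if k ≤ j then lam j else 0) * sketchSq S (q j)))) := by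
    refine Finset.sum_le_sum fun j _ => ?_
    split_ifs with hj
    · have h4 := h2' (Matrix.of S *ᵥ q j)
      have h5 : 0 ≤ (Kᵀ *ᵥ (Matrix.of S *ᵥ q j) + q j) ⬝ᵥ (Kᵀ *ᵥ (Matrix.of S *ᵥ q j) + q j) :=
        dotProduct_self_nonneg' _
      have h6 := hq.orth j j
      rw [if_pos rfl] at h6
      rw [← sketchSq] at h4
      have h7 : (Kᵀ *ᵥ (Matrix.of S *ᵥ q j) - q j) ⬝ᵥ (Kᵀ *ᵥ (Matrix.of S *ᵥ q j) - q j) ≤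
          2 + 2 * ((c ^ 2)⁻¹ * sketchSq S (q j)) := by
        simp only [add_dotProduct, dotProduct_add, sub_dotProduct, dotProduct_sub] at h5 ⊢
        linarith
      refine (mul_le_mul_of_nonneg_left h7 (hlam j)).trans_eq ?_
      ring
    · have h4 := h1 ⟨j, not_le.mp hj⟩
      have h5 : Fin.castLE hk ⟨j, not_le.mp hj⟩ = j := rfl
      rw [h5] at h4
      simp [h4]
  have e2 : ∑ j, (Kᵀ *ᵥ (Matrix.of S *ᵥ q j)) ⬝ᵥ (Kᵀ *ᵥ (Matrix.of S *ᵥ q j)) ≤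
      (c ^ 2)⁻¹ * ∑ j, sketchSq S (q j) := by
    rw [Finset.mul_sum]
    exact Finset.sum_le_sum fun j _ => h2' _
  rw [Finset.sum_add_distrib, ← Finset.mul_sum, ← Finset.mul_sum, ← Finset.mul_sum] at e1
  have e3 := mul_le_mul_of_nonneg_left e2 hd
  have e4 := mul_le_mul_of_nonneg_left h3' hr
  rw [trialRisk]
  linarith

end Trial

/-! ### The effective dimension of the sketched covariance -/

section Dimension

variable {p M : ℕ}

/-- The vectors may be dependent, hence `m ≤ k`. The other clauses are normalization, Bessel's
inequality, and Parseval's identity inside the span. -/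
theorem exists_orthonormal_span {k : ℕ} (s : Fin k → Vec M) :
    ∃ m ≤ k, ∃ f : Fin m → Vec M, (∀ l, f l ⬝ᵥ f l = 1) ∧
      (∀ x, ∑ l, (f l ⬝ᵥ x) ^ 2 ≤ x ⬝ᵥ x) ∧ ∀ j, ∑ l, (f l ⬝ᵥ s j) ^ 2 = s j ⬝ᵥ s j := by
  obtain ⟨W, hW⟩ : ∃ W : Submodule ℝ (EuclideanSpace ℝ (Fin M)),
    W = Submodule.span ℝ (Set.range fun j => WithLp.toLp 2 (s j)) := ⟨_, rfl⟩
  have hi : ∀ x y : EuclideanSpace ℝ (Fin M), inner ℝ x y = WithLp.ofLp x ⬝ᵥ WithLp.ofLp y := by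
    intro x y
    rw [EuclideanSpace.inner_eq_star_dotProduct, star_trivial, dotProduct_comm]
  have hn : ∀ x : EuclideanSpace ℝ (Fin M), ‖x‖ ^ 2 = WithLp.ofLp x ⬝ᵥ WithLp.ofLp x := fun x => by
    rw [← hi, real_inner_self_eq_norm_sq]
  let b := stdOrthonormalBasis ℝ W
  have ho : Orthonormal ℝ fun l => (b l : EuclideanSpace ℝ (Fin M)) :=
    b.orthonormal.comp_linearIsometry W.subtypeₗᵢ
  refine ⟨Module.finrank ℝ W, ?_, fun l => WithLp.ofLp (b l : EuclideanSpace ℝ (Fin M)),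
    fun l => ?_, fun x => ?_, fun j => ?_⟩
  · rw [hW]
    exact (finrank_range_le_card _).trans_eq (Fintype.card_fin k)
  · rw [← hn, ho.1 l, one_pow]
  · have := ho.sum_inner_products_le (WithLp.toLp 2 x) (s := Finset.univ)
    rw [hn] at this
    simpa [hi] using this
  · have hmem : WithLp.toLp 2 (s j) ∈ W := hW ▸ Submodule.subset_span ⟨j, rfl⟩
    have := b.sum_sq_norm_inner_right ⟨_, hmem⟩
    have hnorm : ‖(⟨_, hmem⟩ : W)‖ = ‖WithLp.toLp 2 (s j)‖ := rfl
    rw [hnorm, hn] at this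
    simpa [hi] using this

/-- Let `P` project onto the span of the first `k` vectors `S q_j`, and let `π_i = |P e_i|²`, which
lies in `[0, 1]`. Then `min(1, t g_i) ≤ π_i + t (1 - π_i) g_i`. The `π_i` add up to the rank of `P`,
and `∑ (1 - π_i) g_i` is the trace of `(1 - P) S H Sᵀ`, where only tail directions survive. -/
theorem sum_min_le {S : Sketch M p} {D : DataModel p} {q : Fin p → Vec p} {lam : Fin p → ℝ}
    (hd : Diagonal q lam D.H) (hlam : ∀ j, 0 ≤ lam j) {e : Fin M → Vec M} {g : Fin M → ℝ}
    (he : Frame e) (hg : Diagonal e g (sketchCov D S)) (hg0 : ∀ i, 0 ≤ g i) {k : ℕ} (hk : k ≤ p)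
    {t : ℝ} (ht : 0 ≤ t) :
    ∑ i, min 1 (t * g i) ≤
      k + t * ∑ j : Fin p, (if k ≤ j then lam j else 0) * sketchSq S (q j) := by
  obtain ⟨m, hm, f, f1, f2, f3⟩ := exists_orthonormal_span
    fun j : Fin k => Matrix.of S *ᵥ q (Fin.castLE hk j)
  have hG : ∀ u : Vec M, u ⬝ᵥ (sketchCov D S *ᵥ u) =
      ∑ j, lam j * (u ⬝ᵥ (Matrix.of S *ᵥ q j)) ^ 2 := fun u => by
    rw [dotProduct_sketchCov, hd]
    refine Finset.sum_congr rfl fun j _ => ?_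
    rw [dotProduct_mulVec, ← mulVec_transpose, transpose_transpose, pow_two, dotProduct_comm u]
  have hα : ∑ i, ∑ l, (f l ⬝ᵥ e i) ^ 2 = m := by
    rw [Finset.sum_comm]
    have : ∀ l, ∑ i, (f l ⬝ᵥ e i) ^ 2 = 1 := fun l => by
      rw [← f1 l, he.dot]
      exact Finset.sum_congr rfl fun i _ => by rw [dotProduct_comm, pow_two]
    simp [this]
  have htr : ∑ i, g i = ∑ j, lam j * sketchSq S (q j) := by
    have : ∀ i, g i = ∑ j, lam j * (e i ⬝ᵥ (Matrix.of S *ᵥ q j)) ^ 2 := fun i => by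
      rw [← hG, hg.apply_self he]
    simp_rw [this]
    rw [Finset.sum_comm]
    refine Finset.sum_congr rfl fun j _ => ?_
    rw [← Finset.mul_sum, sketchSq, he.dot]
    simp only [pow_two]
  have hfG : ∑ i, g i * ∑ l, (f l ⬝ᵥ e i) ^ 2 =
      ∑ j, lam j * ∑ l, (f l ⬝ᵥ (Matrix.of S *ᵥ q j)) ^ 2 := by
    simp_rw [Finset.mul_sum]
    rw [Finset.sum_comm, Finset.sum_comm (s := Finset.univ (α := Fin p))]
    refine Finset.sum_congr rfl fun l _ => ?_
    rw [← hG, hg]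
    exact Finset.sum_congr rfl fun i _ => by rw [dotProduct_comm, pow_two]
  have hhead : ∑ j, lam j * sketchSq S (q j) -
      ∑ j, lam j * ∑ l, (f l ⬝ᵥ (Matrix.of S *ᵥ q j)) ^ 2 ≤
      ∑ j : Fin p, (if k ≤ j then lam j else 0) * sketchSq S (q j) := by
    rw [← Finset.sum_sub_distrib]
    refine Finset.sum_le_sum fun j _ => ?_
    split_ifs with hj
    · have := mul_nonneg (hlam j) (Finset.sum_nonneg fun l (_ : l ∈ Finset.univ) =>
        sq_nonneg (f l ⬝ᵥ (Matrix.of S *ᵥ q j)))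
      linarith
    · have h4 := f3 ⟨j, not_le.mp hj⟩
      have h5 : Fin.castLE hk ⟨j, not_le.mp hj⟩ = j := rfl
      rw [h5] at h4
      rw [h4, sketchSq]
      simp
  calc ∑ i, min 1 (t * g i)
      ≤ ∑ i, (∑ l, (f l ⬝ᵥ e i) ^ 2 + t * (g i - g i * ∑ l, (f l ⬝ᵥ e i) ^ 2)) := by
        refine Finset.sum_le_sum fun i _ => ?_
        have h1 := f2 (e i)
        rw [he.orth, if_pos rfl] at h1
        have h0 : 0 ≤ ∑ l, (f l ⬝ᵥ e i) ^ 2 := Finset.sum_nonneg fun l _ => sq_nonneg _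
        have h2 : 0 ≤ t * g i := mul_nonneg ht (hg0 i)
        rcases min_le_iff.mp (le_refl (min 1 (t * g i))) with h | h
        all_goals
          have m1 := min_le_left 1 (t * g i)
          have m2 := min_le_right 1 (t * g i)
          nlinarith [mul_le_mul_of_nonneg_left m1 h0,
            mul_le_mul_of_nonneg_left m2 (sub_nonneg.mpr h1)]
    _ = m + t * (∑ j, lam j * sketchSq S (q j) -
        ∑ j, lam j * ∑ l, (f l ⬝ᵥ (Matrix.of S *ᵥ q j)) ^ 2) := by
        rw [Finset.sum_add_distrib, hα, ← Finset.mul_sum, Finset.sum_sub_distrib, htr, hfG]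
    _ ≤ _ := by
        have hm' : (m : ℝ) ≤ k := by exact_mod_cast hm
        gcongr

end Dimension

end QuantSGD

namespace QuantSGD

/-! ### The power law spectrum -/

section Spectrum

variable {p : ℕ}

theorem exists_spectral_frame {D : DataModel p} {a c₁ c₂ : ℝ} (hc : 0 < c₁)
    (hP : D.PowerLaw a c₁ c₂) :
    ∃ (q : Fin p → Vec p) (lam : Fin p → ℝ), Frame q ∧ Diagonal q lam D.H ∧
      ∀ j : Fin p, 0 ≤ lam j ∧ lam j ≤ c₂ * (((j : ℕ) : ℝ) + 1) ^ (-a) := by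
  have hA := secondMoment_isHermitian D.feature
  -- The eigenbasis is indexed through this arbitrary bijection, whereas the power law concerns the
  -- sorted eigenvalues; `κ` restores the sorted order.
  let τ : Fin (Fintype.card (Fin p)) ≃ Fin p := Fintype.equivOfCardEq (Fintype.card_fin _)
  let κ : Fin p ≃ Fin p := (finCongr (Fintype.card_fin p).symm).trans τ
  have hlam : ∀ j, hA.eigenvalues (κ j) = hA.eigenvalues₀ (finCongr (Fintype.card_fin p).symm j) :=
    fun j => by simp [Matrix.IsHermitian.eigenvalues, κ, τ]
  have hq := Frame.of_orthonormalBasis (hA.eigenvectorBasis.reindex κ.symm)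
  refine ⟨_, fun j => hA.eigenvalues (κ j), hq, hq.diagonal_of_mulVec hA fun j => ?_, fun j => ?_⟩
  · have := hA.mulVec_eigenvectorBasis (κ j)
    simpa [DataModel.H] using this
  · have := hP (finCongr (Fintype.card_fin p).symm j)
    rw [← hlam] at this
    refine ⟨le_trans (by positivity) this.1, by simpa using this.2⟩

/-- The right side is the integral of `x ^ (-a)` over `[j, j+1]`, in telescoping form. After
factoring out `(j+1) ^ (1-a)`, it reduces to `log x ≤ x - 1` and `1 + y ≤ exp y`. -/
theorem rpow_neg_le_sub {a : ℝ} (ha : 1 < a) {j : ℕ} (hj : 1 ≤ j) :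
    ((j : ℝ) + 1) ^ (-a) ≤ ((j : ℝ) ^ (1 - a) - ((j : ℝ) + 1) ^ (1 - a)) / (a - 1) := by
  have hj0 : (0 : ℝ) < j := by exact_mod_cast hj
  have hx : (0 : ℝ) < (j : ℝ) + 1 := by positivity
  have ha1 : 0 < a - 1 := by linarith
  have e1 : ((j : ℝ) + 1) ^ (-a) = ((j : ℝ) + 1) ^ (1 - a) * (((j : ℝ) + 1)⁻¹) := by
    rw [← Real.rpow_neg_one, ← Real.rpow_add hx]
    ring_nf
  have e2 : (j : ℝ) ^ (1 - a) = ((j : ℝ) + 1) ^ (1 - a) * ((j : ℝ) / (j + 1)) ^ (1 - a) := by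
    rw [← Real.mul_rpow hx.le (by positivity)]
    congr 1
    field_simp
  have e3 : 1 + (a - 1) * ((j : ℝ) + 1)⁻¹ ≤ ((j : ℝ) / (j + 1)) ^ (1 - a) := by
    rw [Real.rpow_def_of_pos (by positivity)]
    have h1 := Real.log_le_sub_one_of_pos (show 0 < (j : ℝ) / (j + 1) by positivity)
    have h2 := Real.add_one_le_exp (Real.log ((j : ℝ) / (j + 1)) * (1 - a))
    have h3 : (j : ℝ) / (j + 1) - 1 = -((j : ℝ) + 1)⁻¹ := by field_simp; ring
    rw [h3] at h1
    nlinarith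
  rw [le_div_iff₀ ha1, e1, e2]
  have := mul_le_mul_of_nonneg_left e3 (Real.rpow_nonneg hx.le (1 - a))
  linarith

theorem tail_sum_le {a : ℝ} (ha : 1 < a) {k : ℕ} (hk : 1 ≤ k) (n : ℕ) :
    ∑ j ∈ Finset.range n, (if k ≤ j then ((j : ℝ) + 1) ^ (-a) else 0) ≤
      (k : ℝ) ^ (1 - a) / (a - 1) := by
  have ha1 : 0 < a - 1 := by linarith
  have key : ∑ j ∈ Finset.range n, (if k ≤ j then ((j : ℝ) + 1) ^ (-a) else 0) ≤
      ((k : ℝ) ^ (1 - a) - ((max n k : ℕ) : ℝ) ^ (1 - a)) / (a - 1) := by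
    induction n with
    | zero => simp
    | succ n ih =>
      rw [Finset.sum_range_succ]
      split_ifs with h
      · rw [max_eq_left h] at ih
        rw [max_eq_left (by omega)]
        have := rpow_neg_le_sub ha (hk.trans h)
        push_cast
        rw [sub_div] at *
        linarith
      · rw [max_eq_right (by omega)] at ih ⊢
        linarith
  refine key.trans ?_
  gcongr
  have : (0 : ℝ) ≤ ((max n k : ℕ) : ℝ) ^ (1 - a) := by positivity
  linarith

/-- The factor `1/(a-1)` is enlarged to `a/(a-1) = 1 + 1/(a-1)`, so that the tails and the full
trace share one constant. -/
theorem spectral_tail_le {a c₂ : ℝ} (ha : 1 < a) (hc : 0 < c₂) {lam : Fin p → ℝ}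
    (hlam : ∀ j : Fin p, lam j ≤ c₂ * (((j : ℕ) : ℝ) + 1) ^ (-a)) {k : ℕ} (hk : 1 ≤ k) :
    ∑ j : Fin p, (if k ≤ j then lam j else 0) ≤ c₂ * (a / (a - 1)) * (k : ℝ) ^ (1 - a) := by
  have ha1 : 0 < a - 1 := by linarith
  calc _ ≤ ∑ j : Fin p, c₂ * (if k ≤ j then (((j : ℕ) : ℝ) + 1) ^ (-a) else 0) := by
        refine Finset.sum_le_sum fun j _ => ?_
        split_ifs
        · exact hlam j
        · simp
    _ = c₂ * ∑ j ∈ Finset.range p, (if k ≤ j then ((j : ℝ) + 1) ^ (-a) else 0) := by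
        rw [← Finset.mul_sum, Fin.sum_univ_eq_sum_range
          fun j : ℕ => if k ≤ j then ((j : ℝ) + 1) ^ (-a) else 0]
    _ ≤ c₂ * ((k : ℝ) ^ (1 - a) / (a - 1)) := by gcongr; exact tail_sum_le ha hk p
    _ ≤ _ := by
        rw [mul_assoc, div_mul_eq_mul_div]
        gcongr
        have : (0 : ℝ) ≤ (k : ℝ) ^ (1 - a) := by positivity
        nlinarith

theorem spectral_sum_le {a c₂ : ℝ} (ha : 1 < a) (hc : 0 < c₂) {lam : Fin p → ℝ}
    (hlam : ∀ j : Fin p, lam j ≤ c₂ * (((j : ℕ) : ℝ) + 1) ^ (-a)) :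
    ∑ j : Fin p, lam j ≤ c₂ * (a / (a - 1)) := by
  have ha1 : 0 < a - 1 := by linarith
  calc _ ≤ ∑ j : Fin p, c₂ * ((if (j : ℕ) = 0 then 1 else 0) +
        (if 1 ≤ (j : ℕ) then (((j : ℕ) : ℝ) + 1) ^ (-a) else 0)) := by
        refine Finset.sum_le_sum fun j _ => (hlam j).trans ?_
        rcases Nat.eq_zero_or_pos (j : ℕ) with h | h
        · simp [h]
        · have h' : (j : ℕ) ≠ 0 := h.ne'
          have h'' : 1 ≤ (j : ℕ) := h
          simp only [if_neg h', if_pos h'', zero_add, le_refl]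
    _ = c₂ * (∑ j ∈ Finset.range p, (if j = 0 then 1 else 0) +
        ∑ j ∈ Finset.range p, (if 1 ≤ j then ((j : ℝ) + 1) ^ (-a) else 0)) := by
        rw [← Finset.mul_sum, Fin.sum_univ_eq_sum_range
          fun j : ℕ => (if j = 0 then (1 : ℝ) else 0) + if 1 ≤ j then ((j : ℝ) + 1) ^ (-a) else 0,
          Finset.sum_add_distrib]
    _ ≤ c₂ * (1 + 1 / (a - 1)) := by
        have h1 := tail_sum_le ha le_rfl p
        rw [Nat.cast_one, Real.one_rpow] at h1
        gcongr
        rw [Finset.sum_ite_eq']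
        split_ifs <;> norm_num
    _ = _ := by field_simp; ring

end Spectrum

/-! ### The good event -/

/-- The exceptional sets for the lower bound and for the two weighted sums (both with `R = 3`,
whence `16 = 4 (R + 1)`) have total probability at most `4 e^{-3M}`, below `e^{-M}`. -/
theorem exists_good_event {p M : ℕ} (hM : 1 ≤ M) {q : Fin p → Vec p} (hq : Frame q)
    {lam : Fin p → ℝ} (hlam : ∀ j, 0 ≤ lam j) {k : ℕ} (hk : k ≤ p) (hkM : 2 * k ≤ M) :
    ∃ E : Set (Sketch M p), MeasurableSet E ∧
      ENNReal.ofReal (1 - Real.exp (-(1 * M))) ≤ gaussianSketch M p E ∧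
      ∀ S ∈ E,
        (∀ x, Real.exp (-20) * ‖x‖ ≤ ‖sketchMap S (fun i : Fin k => q (Fin.castLE hk i)) x‖) ∧
        ∑ j : Fin p, (if k ≤ j then lam j else 0) * sketchSq S (q j) ≤
          16 * ∑ j : Fin p, (if k ≤ j then lam j else 0) ∧
        ∑ j, sketchSq S (q j) ≤ 16 * p := by
  have hq1 : ∀ j, q j ⬝ᵥ q j = 1 := fun j => by rw [hq.orth, if_pos rfl]
  obtain ⟨B, hB, hBm, hBS⟩ := exists_sketch_lower hM hkM (fun i : Fin k => q (Fin.castLE hk i))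
    (fun i j => by rw [hq.orth]; simp only [Fin.ext_iff, Fin.val_castLE])
  have m1 := measure_weighted_sketchSq hM q hq1 (fun j : Fin p => if k ≤ j then lam j else 0)
    (fun j => by split_ifs; exacts [hlam j, le_rfl]) 3
  have m2 := measure_weighted_sketchSq hM q hq1 (fun _ => 1) (fun _ => zero_le_one) 3
  have hmeas : ∀ ν : Fin p → ℝ, Measurable fun S : Sketch M p => ∑ j, ν j * sketchSq S (q j) :=
    fun ν => Finset.measurable_sum _ fun j _ => (measurable_sketchSq_left (q j)).const_mul _
  obtain ⟨B₁, hB₁⟩ : ∃ B₁, B₁ = {S : Sketch M p | ¬ ∑ j : Fin p,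
      (if k ≤ j then lam j else 0) * sketchSq S (q j) ≤
      4 * (3 + 1) * ∑ j : Fin p, if k ≤ j then lam j else 0} := ⟨_, rfl⟩
  obtain ⟨B₂, hB₂⟩ : ∃ B₂, B₂ = {S : Sketch M p | ¬ ∑ j : Fin p, 1 * sketchSq S (q j) ≤
      4 * (3 + 1) * ∑ _j : Fin p, 1} := ⟨_, rfl⟩
  rw [← hB₁] at m1
  rw [← hB₂] at m2
  have hm1 : MeasurableSet B₁ := hB₁ ▸ (measurableSet_le (hmeas _) measurable_const).compl
  have hm2 : MeasurableSet B₂ := hB₂ ▸ (measurableSet_le (hmeas _) measurable_const).compl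
  refine ⟨(B ∪ (B₁ ∪ B₂))ᶜ, (hBm.union (hm1.union hm2)).compl, ?_, fun S hS => ?_⟩
  · have hM1 : (1 : ℝ) ≤ M := by exact_mod_cast hM
    have hbad : gaussianSketch M p (B ∪ (B₁ ∪ B₂)) ≤ ENNReal.ofReal (Real.exp (-(1 * M))) := by
      refine (measure_union_le _ _).trans ((add_le_add hB ((measure_union_le _ _).trans
        (add_le_add m1 m2))).trans ?_)
      rw [← ENNReal.ofReal_add (by positivity) (by positivity),
        ← ENNReal.ofReal_add (by positivity) (by positivity)]
      refine ENNReal.ofReal_le_ofReal ?_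
      have h1 : Real.exp (-3 * M) = Real.exp (-(3 * M)) := by ring_nf
      have h2 : Real.exp (-(1 * M)) = Real.exp (-(3 * M)) * Real.exp (2 * M) := by
        rw [← Real.exp_add]
        ring_nf
      have h3 : (4 : ℝ) ≤ Real.exp (2 * M) := by
        have e1 := Real.add_one_le_exp (1 : ℝ)
        have e2 : Real.exp 1 * Real.exp 1 ≤ Real.exp (2 * M) := by
          rw [← Real.exp_add]
          exact Real.exp_le_exp.mpr (by linarith)
        nlinarith
      rw [h1, h2]
      nlinarith [Real.exp_pos (-(3 * (M : ℝ)))]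
    rw [prob_compl_eq_one_sub (hBm.union (hm1.union hm2)), ENNReal.ofReal_sub _ (Real.exp_pos _).le,
      ENNReal.ofReal_one]
    exact tsub_le_tsub_left hbad 1
  · simp only [Set.mem_compl_iff, Set.mem_union, not_or] at hS
    obtain ⟨s0, s1, s2⟩ := hS
    refine ⟨hBS S s0, ?_, ?_⟩
    · rw [hB₁, Set.mem_ofPred_eq, not_not] at s1
      linarith
    · rw [hB₂, Set.mem_ofPred_eq, not_not] at s2
      simp at s2
      linarith

end QuantSGD

namespace QuantSGD

/-! ### The truncation level and the effective sizes -/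

/-- The number of leading eigendirections of `H` that are kept. -/
noncomputable def truncLevel (a : ℝ) (p M N : ℕ) : ℕ :=
  min (min (M / 2) ⌈(N : ℝ) ^ (1 / a)⌉₊) p

section Scalars

variable {a : ℝ} {p M N : ℕ}

theorem truncLevel_le : truncLevel a p M N ≤ p := min_le_right _ _

theorem two_mul_truncLevel_le : 2 * truncLevel a p M N ≤ M := by
  have h1 : truncLevel a p M N ≤ M / 2 := (min_le_left _ _).trans (min_le_left _ _)
  omega

/-- The cap at `p` is invisible to tail sums over `Fin p`, so it never weakens a tail estimate. -/
theorem truncLevel_le_iff (j : Fin p) :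
    truncLevel a p M N ≤ j ↔ min (M / 2) ⌈(N : ℝ) ^ (1 / a)⌉₊ ≤ (j : ℕ) := by
  have := j.isLt
  unfold truncLevel
  omega

/-- The level `N ^ (1/a)` balances the dimension cost `k / N` against the spectral tail `k ^ (1-a)`;
both have order `N ^ (-(a-1)/a)`. -/
theorem ceil_rpow_le (ha : 1 < a) (hN : 1 ≤ N) :
    1 ≤ ⌈(N : ℝ) ^ (1 / a)⌉₊ ∧ (⌈(N : ℝ) ^ (1 / a)⌉₊ : ℝ) / N ≤ 2 * (N : ℝ) ^ (-((a - 1) / a)) ∧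
      (⌈(N : ℝ) ^ (1 / a)⌉₊ : ℝ) ^ (1 - a) ≤ (N : ℝ) ^ (-((a - 1) / a)) := by
  have hn : (1 : ℝ) ≤ N := by exact_mod_cast hN
  have hn0 : (0 : ℝ) < N := by linarith
  have ha0 : 0 < a := by linarith
  have h1 : 1 ≤ (N : ℝ) ^ (1 / a) := Real.one_le_rpow hn (by positivity)
  have h2 := Nat.le_ceil ((N : ℝ) ^ (1 / a))
  have h3 := Nat.ceil_lt_add_one (by linarith : 0 ≤ (N : ℝ) ^ (1 / a))
  refine ⟨Nat.one_le_ceil_iff.mpr (by linarith), ?_, ?_⟩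
  · have : (N : ℝ) ^ (-((a - 1) / a)) = (N : ℝ) ^ (1 / a) / N := by
      rw [← Real.rpow_sub_one hn0.ne']
      congr 1
      field_simp
      ring
    rw [this, ← mul_div_assoc]
    gcongr
    linarith
  · calc _ ≤ ((N : ℝ) ^ (1 / a)) ^ (1 - a) :=
          Real.rpow_le_rpow_of_nonpos (by linarith) h2 (by linarith)
      _ = _ := by
          rw [← Real.rpow_mul hn0.le]
          congr 1
          field_simp
          ring

theorem truncLevel_div_le (ha : 1 < a) (hN : 1 ≤ N) :
    (truncLevel a p M N : ℝ) / N ≤ 2 * (N : ℝ) ^ (-((a - 1) / a)) := by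
  refine le_trans ?_ (ceil_rpow_le ha hN).2.1
  have : truncLevel a p M N ≤ ⌈(N : ℝ) ^ (1 / a)⌉₊ := (min_le_left _ _).trans (min_le_right _ _)
  gcongr

/-- For `M ≥ 2` the rounded-down `M / 2` is at least `M / 3`, which explains `3 ^ (a-1)`. For `M =
1` nothing is kept and the whole trace counts as tail. -/
theorem trunc_tail_le (ha : 1 < a) (hM : 1 ≤ M) (hN : 1 ≤ N) {c₂ : ℝ} (hc : 0 < c₂)
    {lam : Fin p → ℝ}
    (hlam : ∀ j : Fin p, lam j ≤ c₂ * (((j : ℕ) : ℝ) + 1) ^ (-a)) :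
    ∑ j : Fin p, (if truncLevel a p M N ≤ j then lam j else 0) ≤
      3 ^ (a - 1) * (c₂ * (a / (a - 1))) *
        ((M : ℝ) ^ (1 - a) + (N : ℝ) ^ (-((a - 1) / a))) := by
  have ha1 : 0 < a - 1 := by linarith
  have hm : (1 : ℝ) ≤ M := by exact_mod_cast hM
  have hm0 : (0 : ℝ) < M := by linarith
  have hC : 0 ≤ c₂ * (a / (a - 1)) := by positivity
  have h3 : (1 : ℝ) ≤ 3 ^ (a - 1) := Real.one_le_rpow (by norm_num) ha1.le
  have hν : (0 : ℝ) ≤ (N : ℝ) ^ (-((a - 1) / a)) := by positivity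
  have hμ : (0 : ℝ) ≤ (M : ℝ) ^ (1 - a) := by positivity
  obtain ⟨c1, -, c3⟩ := ceil_rpow_le ha hN
  simp_rw [truncLevel_le_iff]
  rcases Nat.eq_zero_or_pos (M / 2) with hz | hz
  · have hM1 : M = 1 := by omega
    have : min (M / 2) ⌈(N : ℝ) ^ (1 / a)⌉₊ = 0 := by rw [hz]; simp
    simp only [this, Nat.zero_le, if_true]
    refine (spectral_sum_le ha hc hlam).trans ?_
    rw [hM1, Nat.cast_one, Real.one_rpow]
    have : c₂ * (a / (a - 1)) * 1 ≤ 3 ^ (a - 1) * (c₂ * (a / (a - 1))) *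
      (1 + (N : ℝ) ^ (-((a - 1) / a))) := by
      apply mul_le_mul _ (by linarith) zero_le_one (by positivity)
      exact le_mul_of_one_le_left hC h3
    linarith
  · refine (spectral_tail_le ha hc hlam (le_min hz c1)).trans ?_
    have key : ((min (M / 2) ⌈(N : ℝ) ^ (1 / a)⌉₊ : ℕ) : ℝ) ^ (1 - a) ≤
        3 ^ (a - 1) * ((M : ℝ) ^ (1 - a) + (N : ℝ) ^ (-((a - 1) / a))) := by
      rcases min_choice (M / 2) ⌈(N : ℝ) ^ (1 / a)⌉₊ with h | h
      · rw [h]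
        have h4 : (M : ℝ) / 3 ≤ ((M / 2 : ℕ) : ℝ) := by
          rw [div_le_iff₀ (by norm_num)]
          have : M ≤ M / 2 * 3 := by omega
          exact_mod_cast this
        calc _ ≤ ((M : ℝ) / 3) ^ (1 - a) :=
              Real.rpow_le_rpow_of_nonpos (by positivity) h4 (by linarith)
          _ = 3 ^ (a - 1) * (M : ℝ) ^ (1 - a) := by
              rw [Real.div_rpow hm0.le (by norm_num), div_eq_mul_inv,
                ← Real.rpow_neg (by norm_num), neg_sub, mul_comm]
          _ ≤ _ := by gcongr; linarith
      · rw [h]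
        refine c3.trans ?_
        nlinarith [mul_nonneg (sub_nonneg.mpr h3) hν, mul_nonneg (zero_le_one.trans h3) hμ]
    calc _ ≤ c₂ * (a / (a - 1)) * (3 ^ (a - 1) *
          ((M : ℝ) ^ (1 - a) + (N : ℝ) ^ (-((a - 1) / a)))) := by gcongr
      _ = _ := by ring

/-- The number of eigenvalues of the sketched covariance above `1 / (N γ)`, softly counted. -/
theorem sum_min_div_le (ha : 1 < a) (hN : 1 ≤ N) {c₂ γ : ℝ} (hc : 0 < c₂)
    (hγ : 0 < γ) {lam : Fin p → ℝ} (h0 : ∀ j, 0 ≤ lam j)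
    (hlam : ∀ j : Fin p, lam j ≤ c₂ * (((j : ℕ) : ℝ) + 1) ^ (-a)) {S : Sketch M p}
    {D : DataModel p} {q : Fin p → Vec p} (hd : Diagonal q lam D.H) {e : Fin M → Vec M}
    {g : Fin M → ℝ} (he : Frame e) (hg : Diagonal e g (sketchCov D S)) (hg0 : ∀ i, 0 ≤ g i)
    (hS : ∑ j : Fin p, (if truncLevel a p M N ≤ j then lam j else 0) * sketchSq S (q j) ≤
      16 * ∑ j : Fin p, (if truncLevel a p M N ≤ j then lam j else 0)) :
    (∑ i, min 1 (N * γ * g i)) / N ≤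
      (4 + 16 * γ * (c₂ * (a / (a - 1)))) * (N : ℝ) ^ (-((a - 1) / a)) := by
  have ha1 : 0 < a - 1 := by linarith
  have hn : (0 : ℝ) < N := by exact_mod_cast hN
  obtain ⟨c1, c2, c3⟩ := ceil_rpow_le ha hN
  have hν : (0 : ℝ) ≤ (N : ℝ) ^ (-((a - 1) / a)) := by positivity
  have hC : 0 ≤ 16 * γ * (c₂ * (a / (a - 1))) := by positivity
  -- If the model is the bottleneck, the trivial count `M` is already of order `N ^ (1/a)`.
  -- Otherwise truncation occurs at `N ^ (1/a)` or at `p`, and the tail has no `M`-dependent part.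
  rcases lt_or_ge (M / 2) ⌈(N : ℝ) ^ (1 / a)⌉₊ with hlt | hge
  · have h1 : ∑ i, min 1 (N * γ * g i) ≤ 2 * (⌈(N : ℝ) ^ (1 / a)⌉₊ : ℝ) := by
      refine (Finset.sum_le_card_nsmul _ _ 1 fun i _ => min_le_left _ _).trans ?_
      have : M ≤ 2 * ⌈(N : ℝ) ^ (1 / a)⌉₊ := by omega
      simp only [Finset.card_univ, Fintype.card_fin, nsmul_eq_mul, mul_one]
      exact_mod_cast this
    calc _ ≤ 2 * (⌈(N : ℝ) ^ (1 / a)⌉₊ : ℝ) / N := by gcongr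
      _ = 2 * ((⌈(N : ℝ) ^ (1 / a)⌉₊ : ℝ) / N) := by ring
      _ ≤ _ := by nlinarith [mul_nonneg hC hν]
  · have hb := sum_min_le hd h0 he hg hg0 (truncLevel_le (a := a) (p := p) (M := M) (N := N))
      (mul_nonneg hn.le hγ.le)
    have ht : ∑ j : Fin p, (if truncLevel a p M N ≤ j then lam j else 0) ≤
        c₂ * (a / (a - 1)) * (N : ℝ) ^ (-((a - 1) / a)) := by
      simp_rw [truncLevel_le_iff, min_eq_right hge]
      refine (spectral_tail_le ha hc hlam c1).trans ?_
      gcongr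
    have hk := truncLevel_div_le (p := p) (M := M) ha hN
    calc _ ≤ (truncLevel a p M N + N * γ * (16 * (c₂ * (a / (a - 1)) *
          (N : ℝ) ^ (-((a - 1) / a))))) / N := by
          gcongr
          refine hb.trans ?_
          gcongr
          exact hS.trans (by gcongr)
      _ = (truncLevel a p M N : ℝ) / N +
          16 * γ * (c₂ * (a / (a - 1))) * (N : ℝ) ^ (-((a - 1) / a)) := by
          field_simp
      _ ≤ _ := by nlinarith

/-- The exponents cancel: `1 / Meff ^ (a-1)` is `M ^ (1-a)` times the bracket in `Meff`, which is at
least `1`. -/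
theorem one_div_Meff_ge (ha : 1 < a) (hM : 1 ≤ M) {ε : ErrorLevels} (h2 : 0 ≤ eps2 p M ε)
    (h3 : eps3 a p M ε < 1) : (M : ℝ) ^ (1 - a) ≤ 1 / Meff a p M ε ^ (a - 1) := by
  have ha1 : 0 < a - 1 := by linarith
  have hm : (0 : ℝ) < M := by exact_mod_cast hM
  obtain ⟨x, hx⟩ : ∃ x, x = 1 + (1 + eps2 p M ε) * (eps3 a p M ε ^ 2 / (1 - eps3 a p M ε)) :=
    ⟨_, rfl⟩
  have hx1 : 1 ≤ x := by
    rw [hx]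
    have : 0 < 1 - eps3 a p M ε := by linarith
    have : 0 ≤ (1 + eps2 p M ε) * (eps3 a p M ε ^ 2 / (1 - eps3 a p M ε)) := by positivity
    linarith
  have hx0 : 0 < x := by linarith
  rw [Meff, ← hx, Real.mul_rpow hm.le (by positivity), ← Real.rpow_mul hx0.le]
  have : -(1 / (a - 1)) * (a - 1) = -1 := by field_simp
  rw [this, Real.rpow_neg_one, one_div, mul_inv, inv_inv, ← Real.rpow_neg hm.le, neg_sub]
  exact le_mul_of_one_le_right (by positivity) hx1

/-- Again the exponents cancel. The factor `1 + eps2` is kept on the left because the variance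
produces exactly it; the denominator `(1 - eps3) ^ (1/a) ≤ 1` only helps. -/
theorem one_div_Neff_ge (ha : 1 < a) (hN : 1 ≤ N) {ε : ErrorLevels} (h2 : 0 ≤ eps2 p M ε)
    (h30 : 0 ≤ eps3 a p M ε) (h3 : eps3 a p M ε < 1) :
    (1 + eps2 p M ε) * (N : ℝ) ^ (-((a - 1) / a)) ≤ 1 / Neff a p M N ε ^ ((a - 1) / a) := by
  have ha1 : 0 < a - 1 := by linarith
  have ha0 : 0 < a := by linarith
  have hn : (0 : ℝ) < N := by exact_mod_cast hN
  have h31 : 0 < 1 - eps3 a p M ε := by linarith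
  obtain ⟨x, hx⟩ : ∃ x, x = (1 + eps2 p M ε) / (1 - eps3 a p M ε) ^ (1 / a) := ⟨_, rfl⟩
  have hx1 : 1 + eps2 p M ε ≤ x := by
    rw [hx, le_div_iff₀ (by positivity)]
    have : (1 - eps3 a p M ε) ^ (1 / a) ≤ 1 :=
      Real.rpow_le_one h31.le (by linarith) (by positivity)
    exact mul_le_of_le_one_right (by linarith) this
  have hx0 : 0 < x := by linarith
  rw [Neff, ← hx, Real.mul_rpow hn.le (by positivity), ← Real.rpow_mul hx0.le]
  have : -(a / (a - 1)) * ((a - 1) / a) = -1 := by field_simp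
  rw [this, Real.rpow_neg_one, one_div, mul_inv, inv_inv, ← Real.rpow_neg hn.le, mul_comm]
  gcongr

end Scalars

/-! ### The bias -/

section Bias

variable {a : ℝ} {p M N : ℕ}

theorem exists_trialRisk_le (ha : 1 < a) (hM : 1 ≤ M) (hN : 1 ≤ N) {c₂ γ : ℝ} (hc : 0 < c₂)
    (hγ : 0 < γ) {q : Fin p → Vec p} (hq : Frame q) {lam : Fin p → ℝ} (h0 : ∀ j, 0 ≤ lam j)
    (hlam : ∀ j : Fin p, lam j ≤ c₂ * (((j : ℕ) : ℝ) + 1) ^ (-a)) {ε : ErrorLevels}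
    (hεd : 0 ≤ ε.d) (hεs : 0 ≤ ε.s) (hεf : 0 ≤ ε.f) {S : Sketch M p}
    (hS1 : ∀ x, Real.exp (-20) * ‖x‖ ≤ ‖sketchMap S (fun i : Fin (truncLevel a p M N) =>
      q (Fin.castLE truncLevel_le i)) x‖)
    (hS2 : ∑ j : Fin p, (if truncLevel a p M N ≤ j then lam j else 0) * sketchSq S (q j) ≤
      16 * ∑ j : Fin p, (if truncLevel a p M N ≤ j then lam j else 0))
    (hS3 : ∑ j, sketchSq S (q j) ≤ 16 * p) {C₁ b : ℝ} (hC₁ : C₁ = c₂ * (a / (a - 1)))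
    (hb : b = (Real.exp (-20) ^ 2)⁻¹) :
    ∃ K, trialRisk S q lam K ε.d (1 / (N * γ) + (ε.s * (∑ j, lam j + ε.d * p) + ε.f)) ≤
      ((2 + 32 * b) * (3 ^ (a - 1) * C₁) + 2 * b / γ + 2 * b * (16 + C₁) + 2 * C₁) *
        ((M : ℝ) ^ (1 - a) + (N : ℝ) ^ (-((a - 1) / a)) + eps3 a p M ε) := by
  have ha1 : 0 < a - 1 := by linarith
  have hn : (0 : ℝ) < N := by exact_mod_cast hN
  have hm1 : (1 : ℝ) ≤ M := by exact_mod_cast hM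
  have hm : (0 : ℝ) < M := by linarith
  have hb0 : 0 < b := by rw [hb]; positivity
  have hC₁0 : 0 < C₁ := by rw [hC₁]; positivity
  have htr : ∑ j, lam j ≤ C₁ := hC₁ ▸ spectral_sum_le ha hc hlam
  have htr0 : 0 ≤ ∑ j, lam j := Finset.sum_nonneg fun j _ => h0 j
  obtain ⟨Dq, hDq⟩ : ∃ Dq, Dq = ε.f + ε.s * (1 + ε.d * p) + ε.d * (p / M) := ⟨_, rfl⟩
  have hp0 : (0 : ℝ) ≤ p := Nat.cast_nonneg p
  have hDq0 : 0 ≤ Dq := by rw [hDq]; positivity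
  have hMa : 0 < (M : ℝ) ^ (-a) := by positivity
  have he3 : eps3 a p M ε = Dq / ((M : ℝ) ^ (-a) + Dq) := by rw [eps3, ← hDq]
  have he30 : 0 ≤ eps3 a p M ε := by rw [he3]; positivity
  have hν : 0 ≤ (N : ℝ) ^ (-((a - 1) / a)) := by positivity
  have hμ : 0 ≤ (M : ℝ) ^ (1 - a) := by positivity
  have h3p : 0 < (3 : ℝ) ^ (a - 1) := by positivity
  obtain ⟨ν, hνd⟩ : ∃ ν, ν = (N : ℝ) ^ (-((a - 1) / a)) := ⟨_, rfl⟩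
  obtain ⟨μ, hμd⟩ : ∃ μ, μ = (M : ℝ) ^ (1 - a) := ⟨_, rfl⟩
  obtain ⟨η, hηd⟩ : ∃ η, η = eps3 a p M ε := ⟨_, rfl⟩
  -- If quantization swamps the smallest scale `M ^ (-a)`, then `eps3 ≥ 1/2` and the zero predictor,
  -- with risk `tr H`, is good enough. Otherwise the truncated right inverse is used.
  rcases le_or_gt ((M : ℝ) ^ (-a)) Dq with hcase | hcase
  · refine ⟨0, ?_⟩
    have h1 : trialRisk S q lam 0 ε.d (1 / (N * γ) + (ε.s * (∑ j, lam j + ε.d * p) + ε.f)) =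
        ∑ j, lam j := by
      simp [trialRisk, hq.orth]
    have h2 : 1 / 2 ≤ eps3 a p M ε := by
      rw [he3, le_div_iff₀ (by positivity)]
      linarith
    rw [h1, ← hνd, ← hμd, ← hηd]
    rw [← hνd] at hν
    rw [← hμd] at hμ
    rw [← hηd] at h2
    have h4 : 0 ≤ (2 + 32 * b) * (3 ^ (a - 1) * C₁) + 2 * b / γ + 2 * b * (16 + C₁) := by
      positivity
    calc _ ≤ C₁ := htr
      _ ≤ 2 * C₁ * (μ + ν + η) := by nlinarith
      _ ≤ _ := by
        apply mul_le_mul_of_nonneg_right _ (by linarith)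
        linarith
  · have hr : 0 ≤ 1 / (N * γ) + (ε.s * (∑ j, lam j + ε.d * p) + ε.f) := by positivity
    obtain ⟨K, hK⟩ := trialRisk_le hq h0 truncLevel_le (Real.exp_pos (-20)) hS1 hεd hr
    refine ⟨K, hK.trans ?_⟩
    have ht := trunc_tail_le (p := p) ha hM hN hc hlam
    rw [← hC₁, ← hνd, ← hμd] at ht
    have hkN := truncLevel_div_le (p := p) (M := M) ha hN
    rw [← hνd] at hkN
    have hkM : (truncLevel a p M N : ℝ) ≤ M := by
      have := two_mul_truncLevel_le (a := a) (p := p) (M := M) (N := N)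
      exact_mod_cast (by omega : truncLevel a p M N ≤ M)
    rw [← hb, ← hνd, ← hμd, ← hηd]
    rw [← hνd] at hν
    rw [← hμd] at hμ
    rw [← hηd] at he3 he30
    obtain ⟨τ, hτ⟩ : ∃ τ, τ = ∑ j : Fin p, (if truncLevel a p M N ≤ j then lam j else 0) :=
      ⟨_, rfl⟩
    obtain ⟨k, hk⟩ : ∃ k : ℝ, k = truncLevel a p M N := ⟨_, rfl⟩
    rw [← hτ] at ht hS2 ⊢
    rw [← hk] at hkN hkM ⊢
    have hk0 : 0 ≤ k := by rw [hk]; positivity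
    -- In this case `M (M ^ (-a) + D) ≤ 2 M ^ (1-a) ≤ 2`. All quantization terms of the trial risk
    -- are at most a constant times `M D`, because `k ≤ M` and `ε_d p = M (ε_d p / M)`.
    have hMD : M * Dq ≤ 2 * η := by
      rw [he3, ← mul_div_assoc, le_div_iff₀ (by positivity)]
      have hMM : (M : ℝ) * (M : ℝ) ^ (-a) ≤ 1 := by
        rw [mul_comm, ← Real.rpow_add_one hm.ne']
        exact Real.rpow_le_one_of_one_le_of_nonpos hm1 (by linarith)
      have h7 : (M : ℝ) * Dq ≤ M * (M : ℝ) ^ (-a) := mul_le_mul_of_nonneg_left hcase.le hm.le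
      have : (M : ℝ) * ((M : ℝ) ^ (-a) + Dq) ≤ 2 := by rw [mul_add]; linarith
      have h8 := mul_le_mul_of_nonneg_right this hDq0
      linarith
    have hdp : ε.d * p ≤ M * (ε.d * (p / M)) := by
      rw [show (M : ℝ) * (ε.d * (p / M)) = ε.d * p by field_simp]
    have hfs : ε.s * (∑ j, lam j + ε.d * p) + ε.f ≤
        (1 + C₁) * (ε.f + ε.s * (1 + ε.d * p)) := by
      have e1 : ε.s * (∑ j, lam j + ε.d * p) ≤ ε.s * (C₁ + ε.d * p) := by gcongr
      have e2 : 0 ≤ ε.s + C₁ * ε.f + C₁ * (ε.s * (ε.d * p)) := by positivity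
      have e3 : (1 + C₁) * (ε.f + ε.s * (1 + ε.d * p)) = ε.s * (C₁ + ε.d * p) + ε.f +
        (ε.s + C₁ * ε.f + C₁ * (ε.s * (ε.d * p))) := by ring
      linarith
    have hfs0 : 0 ≤ ε.f + ε.s * (1 + ε.d * p) := by positivity
    have h1 : k * (ε.s * (∑ j, lam j + ε.d * p) + ε.f) ≤
        M * ((1 + C₁) * (ε.f + ε.s * (1 + ε.d * p))) := by
      apply mul_le_mul hkM hfs (by positivity) hm.le
    have h2 : 1 / (N * γ) * k ≤ 2 / γ * ν := by
      have : 1 / (N * γ) * k = 1 / γ * (k / N) := by field_simp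
      rw [this]
      calc _ ≤ 1 / γ * (2 * ν) := by gcongr
        _ = _ := by ring
    have h3 : ε.d * ∑ j, sketchSq S (q j) ≤ 16 * (ε.d * p) := by
      calc _ ≤ ε.d * (16 * p) := by gcongr
        _ = _ := by ring
    have hDq1 : 0 ≤ ε.d * (p / M) := by positivity
    have h4 : 16 * (ε.d * p) + M * ((1 + C₁) * (ε.f + ε.s * (1 + ε.d * p))) ≤
        (16 + C₁) * (2 * η) := by
      have e1 : (16 + C₁) * (M * Dq) ≤ (16 + C₁) * (2 * η) := by gcongr
      have e2 : 0 ≤ M * ((15 : ℝ) * (ε.f + ε.s * (1 + ε.d * p))) := by positivity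
      have e3 : 0 ≤ C₁ * (M * (ε.d * (p / M))) := by positivity
      have e4 : (16 + C₁) * (M * Dq) = M * ((1 + C₁) * (ε.f + ε.s * (1 + ε.d * p))) +
          M * ((15 : ℝ) * (ε.f + ε.s * (1 + ε.d * p))) + 16 * (M * (ε.d * (p / M))) +
          C₁ * (M * (ε.d * (p / M))) := by
        rw [hDq]; ring
      linarith
    have h5 : 2 * (∑ j : Fin p, (if truncLevel a p M N ≤ j then lam j else 0) *
        sketchSq S (q j)) + ε.d * ∑ j, sketchSq S (q j) +
        (1 / (N * γ) + (ε.s * (∑ j, lam j + ε.d * p) + ε.f)) * k ≤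
        32 * τ + 2 / γ * ν + (16 + C₁) * (2 * η) := by linarith
    have h6 := mul_le_mul_of_nonneg_left h5 hb0.le
    have h7 : 2 * τ + b * (32 * τ + 2 / γ * ν + (16 + C₁) * (2 * η)) ≤
        (2 + 32 * b) * (3 ^ (a - 1) * C₁ * (μ + ν)) + 2 * b / γ * ν + 2 * b * (16 + C₁) * η := by
      have : (2 + 32 * b) * τ ≤ (2 + 32 * b) * (3 ^ (a - 1) * C₁ * (μ + ν)) := by gcongr
      have e : b * (2 / γ * ν) = 2 * b / γ * ν := by ring
      linarith
    have g1 : 0 ≤ (2 + 32 * b) * (3 ^ (a - 1) * C₁) := by positivity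
    have g2 : 0 ≤ 2 * b / γ := by positivity
    have g3 : 0 ≤ 2 * b * (16 + C₁) := by positivity
    obtain ⟨A₁, hA₁⟩ : ∃ A, A = (2 + 32 * b) * (3 ^ (a - 1) * C₁) := ⟨_, rfl⟩
    obtain ⟨A₂, hA₂⟩ : ∃ A, A = 2 * b / γ := ⟨_, rfl⟩
    obtain ⟨A₃, hA₃⟩ : ∃ A, A = 2 * b * (16 + C₁) := ⟨_, rfl⟩
    rw [show (2 + 32 * b) * (3 ^ (a - 1) * C₁ * (μ + ν)) = A₁ * (μ + ν) by rw [hA₁]; ring,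
      ← hA₂, ← hA₃] at h7
    rw [← hA₁, ← hA₂, ← hA₃]
    rw [← hA₁] at g1
    rw [← hA₂] at g2
    rw [← hA₃] at g3
    refine (by linarith : _ ≤ A₁ * (μ + ν) + A₂ * ν + A₃ * η).trans ?_
    have : 0 ≤ A₁ * η + A₂ * μ + A₂ * η + A₃ * μ + A₃ * ν + 2 * C₁ * (μ + ν + η) := by positivity
    linarith

end Bias

end QuantSGD

namespace QuantSGD

/-! ### Assembling the scaling law -/

section Main

variable {a : ℝ} {p M N : ℕ}

theorem sketchCov_isHermitian (D : DataModel p) (S : Sketch M p) :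
    (sketchCov D S).IsHermitian := by
  rw [sketchCov, ← conjTranspose_eq_transpose_of_trivial]
  exact isHermitian_mul_mul_conjTranspose _ (secondMoment_isHermitian D.feature)

theorem le_eps2 {ε : ErrorLevels} (hs : 0 ≤ ε.s) (hd : 0 ≤ ε.d) (hf : 0 ≤ ε.f)
    (hp : 0 ≤ ε.p) : ε.a + ε.o + ε.p ≤ eps2 p M ε := by
  have : 0 ≤ ε.p * (p * ε.d + M * (ε.f + ε.s + ε.s * ε.d * p)) := by positivity
  rw [eps2]
  linarith

theorem eps3_mem {ε : ErrorLevels} (hM : 1 ≤ M) (hs : 0 ≤ ε.s) (hd : 0 ≤ ε.d) (hf : 0 ≤ ε.f) :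
    0 ≤ eps3 a p M ε ∧ eps3 a p M ε < 1 := by
  have hm : (0 : ℝ) < M := by exact_mod_cast hM
  have h1 : 0 < (M : ℝ) ^ (-a) := by positivity
  have h2 : 0 ≤ ε.f + ε.s * (1 + ε.d * p) + ε.d * (p / M) := by positivity
  refine ⟨by rw [eps3]; positivity, ?_⟩
  rw [eps3, div_lt_one (by positivity)]
  linarith

/-- The constant of the scaling law. -/
noncomputable def scalingConst (a c₂ α σmax γ : ℝ) : ℝ :=
  1 + 8 * ((2 + 32 * (Real.exp (-20) ^ 2)⁻¹) * (3 ^ (a - 1) * (c₂ * (a / (a - 1)))) +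
    2 * (Real.exp (-20) ^ 2)⁻¹ / γ + 2 * (Real.exp (-20) ^ 2)⁻¹ * (16 + c₂ * (a / (a - 1))) +
    2 * (c₂ * (a / (a - 1)))) +
  (24 * α * (c₂ * (a / (a - 1))) + 48 * σmax ^ 2 + 16 * (1 + 1 / γ)) *
    (4 + 16 * γ * (c₂ * (a / (a - 1))))

theorem scalingConst_pos {c₂ α σmax γ : ℝ} (ha : 1 < a) (hc : 0 < c₂) (hα : 0 < α)
    (hγ : 0 < γ) : 0 < scalingConst a c₂ α σmax γ := by
  have ha1 : 0 < a - 1 := by linarith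
  have ha0 : 0 < a := by linarith
  have h3 : (0 : ℝ) < 3 ^ (a - 1) := by positivity
  unfold scalingConst
  positivity

theorem Setting.expectedRisk_le_scaling {D : DataModel p} {Q : Quantizers p M} {ε : ErrorLevels}
    {S : Sketch M p} {α β σ σmin σmax : ℝ} {e : Fin M → Vec M} {h g : Fin M → ℝ}
    (X : Setting D Q ε S α β σ σmin σmax e h g) (ha : 1 < a) {c₂ γ : ℝ} (hc : 0 < c₂)
    (hγ : 0 < γ) (htr : γ * α * ∑ j, h j < 1) (hN : 1 ≤ N) {q : Fin p → Vec p} (hq : Frame q)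
    {lam : Fin p → ℝ} (hd : Diagonal q lam D.H) (h0 : ∀ j, 0 ≤ lam j)
    (hlam : ∀ j : Fin p, lam j ≤ c₂ * (((j : ℕ) : ℝ) + 1) ^ (-a))
    (hS1 : ∀ x, Real.exp (-20) * ‖x‖ ≤ ‖sketchMap S (fun i : Fin (truncLevel a p M N) =>
      q (Fin.castLE truncLevel_le i)) x‖)
    (hS2 : ∑ j : Fin p, (if truncLevel a p M N ≤ j then lam j else 0) * sketchSq S (q j) ≤
      16 * ∑ j : Fin p, (if truncLevel a p M N ≤ j then lam j else 0))
    (hS3 : ∑ j, sketchSq S (q j) ≤ 16 * p) :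
    expectedRisk D Q S γ N ≤ ENNReal.ofReal (scalingConst a c₂ α σmax γ *
      (1 / Meff a p M ε ^ (a - 1) + 1 / Neff a p M N ε ^ ((a - 1) / a) + σ ^ 2 +
        eps3 a p M ε)) := by
  have hM := X.one_le_M
  have hεs := X.additive.s.nonneg hM X.one_le_p
  have hεd := X.additive.d.nonneg X.one_le_p
  have hεf := X.additive.f.nonneg hM
  have hεp := X.additive.p.nonneg hM
  have hεa := X.additive.a.nonneg
  have hεo := X.additive.o.nonneg
  have hα := X.alpha_pos
  have ha1 : 0 < a - 1 := by linarith
  have hn : (0 : ℝ) < N := by exact_mod_cast hN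
  have he2 : ε.a + ε.o + ε.p ≤ eps2 p M ε := le_eps2 hεs hεd hεf hεp
  have he2' : 0 ≤ eps2 p M ε := by linarith
  obtain ⟨he30, he31⟩ := eps3_mem (a := a) (p := p) hM hεs hεd hεf
  obtain ⟨V, hV⟩ : ∃ V, V = 3 * σmax ^ 2 + (ε.p * (α * ∑ j, h j) + ε.a + ε.o) := ⟨_, rfl⟩
  obtain ⟨K, hK⟩ := exists_trialRisk_le ha hM hN hc hγ hq h0 hlam hεd hεs hεf hS1 hS2 hS3 rfl rfl
  have hR := X.expectedRisk_le hγ htr hN hV hq hd K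
  have htrH : D.H.trace = ∑ j, lam j := hd.trace_eq hq
  have hmin := sum_min_div_le ha hN hc hγ h0 hlam hd X.frame X.diag_g X.g_nonneg hS2
  have hMeff := one_div_Meff_ge ha hM he2' he31
  have hNeff := one_div_Neff_ge ha hN he2' he30 he31
  rw [htrH] at hR
  have htrle : ∑ j, lam j ≤ c₂ * (a / (a - 1)) := spectral_sum_le ha hc hlam
  refine hR.trans (ENNReal.ofReal_le_ofReal ?_)
  -- The step-size condition replaces `α tr H_f` by `1/γ`. The noise of parameter quantization is
  -- thus at most `ε_p / γ`, whatever the sketch, and is covered by `eps2`.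
  have hαT : α * ∑ j, h j ≤ 1 / γ := by
    rw [le_div_iff₀ hγ]
    linarith
  have hVle : 24 * α * ∑ j, lam j + 16 * V ≤
      (24 * α * (c₂ * (a / (a - 1))) + 48 * σmax ^ 2 + 16 * (1 + 1 / γ)) * (1 + eps2 p M ε) := by
    have v1 : ε.p * (α * ∑ j, h j) ≤ ε.p * (1 / γ) := by gcongr
    have v2 : ε.p * (1 / γ) ≤ eps2 p M ε * (1 / γ) := by
      gcongr
      linarith
    have v3 : 24 * α * ∑ j, lam j ≤ 24 * α * (c₂ * (a / (a - 1))) := by gcongr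
    have v4 : 0 ≤ (24 * α * (c₂ * (a / (a - 1))) + 48 * σmax ^ 2) * eps2 p M ε := by positivity
    have v5 : 0 ≤ 1 / γ := by positivity
    rw [hV]
    linarith
  obtain ⟨A, hA⟩ : ∃ A, A = (2 + 32 * (Real.exp (-20) ^ 2)⁻¹) * (3 ^ (a - 1) *
    (c₂ * (a / (a - 1)))) + 2 * (Real.exp (-20) ^ 2)⁻¹ / γ +
    2 * (Real.exp (-20) ^ 2)⁻¹ * (16 + c₂ * (a / (a - 1))) + 2 * (c₂ * (a / (a - 1))) := ⟨_, rfl⟩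
  obtain ⟨C₃, hC₃⟩ : ∃ C₃, C₃ = 24 * α * (c₂ * (a / (a - 1))) + 48 * σmax ^ 2 +
    16 * (1 + 1 / γ) := ⟨_, rfl⟩
  obtain ⟨B, hB⟩ : ∃ B, B = 4 + 16 * γ * (c₂ * (a / (a - 1))) := ⟨_, rfl⟩
  have hA0 : 0 ≤ A := by
    have h3 : (0 : ℝ) < 3 ^ (a - 1) := by positivity
    rw [hA]
    positivity
  have hC₃0 : 0 ≤ C₃ := by rw [hC₃]; positivity
  have hB0 : 0 ≤ B := by rw [hB]; positivity
  rw [scalingConst, ← hA, ← hC₃, ← hB]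
  rw [← hA] at hK
  rw [← hC₃] at hVle
  rw [← hB] at hmin
  obtain ⟨ν, hν⟩ : ∃ ν, ν = (N : ℝ) ^ (-((a - 1) / a)) := ⟨_, rfl⟩
  have hν0 : 0 ≤ ν := by rw [hν]; positivity
  rw [← hν] at hK hmin hNeff
  obtain ⟨μ, hμ⟩ : ∃ μ, μ = (M : ℝ) ^ (1 - a) := ⟨_, rfl⟩
  have hμ0 : 0 ≤ μ := by rw [hμ]; positivity
  rw [← hμ] at hK hMeff
  have hmin0 : 0 ≤ (∑ i, min 1 (N * γ * g i)) / N :=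
    div_nonneg (Finset.sum_nonneg fun i _ =>
      le_min zero_le_one (mul_nonneg (by positivity) (X.g_nonneg i))) hn.le
  have hvar : (24 * α * ∑ j, lam j + 16 * V) / N * ∑ i, min 1 (N * γ * g i) ≤
      C₃ * B * ((1 + eps2 p M ε) * ν) := by
    calc _ = (24 * α * ∑ j, lam j + 16 * V) * ((∑ i, min 1 (N * γ * g i)) / N) := by ring
      _ ≤ C₃ * (1 + eps2 p M ε) * (B * ν) := by
          apply mul_le_mul hVle hmin hmin0 (by positivity)
      _ = _ := by ring
  obtain ⟨m, hm⟩ : ∃ m, m = 1 / Meff a p M ε ^ (a - 1) := ⟨_, rfl⟩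
  obtain ⟨n, hn'⟩ : ∃ n, n = 1 / Neff a p M N ε ^ ((a - 1) / a) := ⟨_, rfl⟩
  rw [← hm] at hMeff ⊢
  rw [← hn'] at hNeff ⊢
  have hνn : ν ≤ n := le_trans (by nlinarith [mul_nonneg he2' hν0]) hNeff
  have s1 : A * (μ + ν + eps3 a p M ε) ≤ A * (m + n + σ ^ 2 + eps3 a p M ε) := by
    refine mul_le_mul_of_nonneg_left ?_ hA0
    linarith [sq_nonneg σ]
  have s2 : C₃ * B * ((1 + eps2 p M ε) * ν) ≤ C₃ * B * (m + n + σ ^ 2 + eps3 a p M ε) := by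
    refine mul_le_mul_of_nonneg_left ?_ (mul_nonneg hC₃0 hB0)
    linarith [sq_nonneg σ]
  have s3 : σ ^ 2 ≤ m + n + σ ^ 2 + eps3 a p M ε := by linarith
  linarith

end Main

end QuantSGD

theorem mainTheorem2 (a c₁ c₂ α σmax γ : ℝ) (ha : 1 < a) (hc₁ : 0 < c₁) (hc₂ : 0 < c₂)
    (hα : 0 < α) (hσmax : 0 < σmax) (hγ : 0 < γ) :
    ∃ c > 0, ∃ C > 0, ∀ (p M N : ℕ), 1 ≤ p → 1 ≤ M → 1 ≤ N →
      ∀ (β σmin σ : ℝ), 0 < β → 0 < σmin →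
      ∀ (D : QuantSGD.DataModel p) (Q : QuantSGD.Quantizers p M) (ε : QuantSGD.ErrorLevels),
        Q.Unbiased → Q.Additive ε →
        D.PowerLaw a c₁ c₂ → D.WellSpecified σ → D.IsotropicPrior →
        ∃ E : Set (QuantSGD.Sketch M p), MeasurableSet E ∧
          ENNReal.ofReal (1 - Real.exp (-(c * M))) ≤ QuantSGD.gaussianSketch M p E ∧
          ∀ S ∈ E,
            QuantSGD.CovarianceCondition D Q S →
            QuantSGD.FourthMomentCondition D Q S α β →
            QuantSGD.NoiseCondition D Q S σmin σmax →
            γ < 1 / (α * (QuantSGD.Hf D Q S).trace) →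
            Commute (QuantSGD.Hf D Q S) (Matrix.of S * D.H * (Matrix.of S).transpose) →
            QuantSGD.expectedRisk D Q S γ N ≤
              ENNReal.ofReal (C * (1 / QuantSGD.Meff a p M ε ^ (a - 1)
                + 1 / QuantSGD.Neff a p M N ε ^ ((a - 1) / a)
                + σ ^ 2 + QuantSGD.eps3 a p M ε)) := by
  refine ⟨1, one_pos, QuantSGD.scalingConst a c₂ α σmax γ,
    QuantSGD.scalingConst_pos ha hc₂ hα hγ, ?_⟩
  intro p M N hp hM hN β σmin σ hβ _ D Q ε hQ hε hP hW hI
  obtain ⟨q, lam, hq, hd, hlam⟩ := QuantSGD.exists_spectral_frame hc₁ hP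
  -- The event depends only on the eigenbasis and spectrum of `H` and on the truncation level. The
  -- conditions on the quantized feature are then imposed sketch by sketch, and the joint eigenbasis
  -- may vary with `S`.
  obtain ⟨E, hE, hprob, hgood⟩ := QuantSGD.exists_good_event hM hq (fun j => (hlam j).1)
    QuantSGD.truncLevel_le (QuantSGD.two_mul_truncLevel_le (a := a) (p := p) (M := M) (N := N))
  refine ⟨E, hE, hprob, fun S hS hC hF hNoise hstep hcomm => ?_⟩
  obtain ⟨e, h, g, he, hh, hg⟩ := QuantSGD.exists_frame_of_commute
    (QuantSGD.secondMoment_isHermitian (QuantSGD.quantFeatureLaw D Q S))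
    (QuantSGD.sketchCov_isHermitian D S) hcomm
  have X : QuantSGD.Setting D Q ε S α β σ σmin σmax e h g :=
    ⟨hM, hp, hQ, hε, hW, hI, hC, hF, hNoise, hα, hβ, he, hh, hg⟩
  have htr : γ * α * ∑ j, h j < 1 := by
    rw [QuantSGD.Hf, hh.trace_eq he] at hstep
    have h0 : 0 ≤ α * ∑ j, h j :=
      mul_nonneg hα.le (Finset.sum_nonneg fun j _ => X.h_nonneg j)
    -- Division by zero is kept apart: when `α tr H_f = 0` the required strict inequality is `0 <
    -- 1`.
    rcases h0.eq_or_lt with h0 | h0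
    · rw [mul_assoc, ← h0, mul_zero]
      exact one_pos
    · rw [lt_div_iff₀ h0] at hstep
      linarith
  obtain ⟨s1, s2, s3⟩ := hgood S hS
  exact X.expectedRisk_le_scaling ha hc₂ hγ htr hN hq hd (fun j => (hlam j).1)
    (fun j => (hlam j).2) s1 s2 s3
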